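/- **Setting.** Let $X$ be a complete Hausdorff locally convex topological vector space over $\mathbb C$, and let $J\subseteq\mathbb R$ be a nonempty open interval. Let $C^\infty(J,X)$ be the space of infinitely differentiable functions $J\to X$, with the topology of uniform convergence of all derivatives on compact subsets, and let $R=C^\infty(J)=C^\infty(J,\mathbb C)$. A *smooth deformation* is a family $\{m_t\}_{t\in J}$ of associative bilinear products on $X$ such that $(x,y)\mapsto (t\mapsto m_t(x,y))$ is a jointly continuous map $X\times X\to C^\infty(J,X)$. Its *algebra of sections* is the $R$-algebra $A=A_J=C^\infty(J,X)$ with product $(a_1a_2)(t)=m_t(a_1(t),a_2(t))$. A *connection* on a topological $R$-module $M$ is a continuous $\mathbb C$-linear map $\nabla:M\to M$ with $\nabla(f\cdot m)=f'\cdot m+f\cdot\nabla m$ for all $f\in R$, $m\in M$. Let $A_+=A\oplus R$ be the unitization of $A$ over $R$, with unit $e$. Let $C_0(A)=A$ and, for $n\ge1$, let $C_n(A)=A_+\widehat\otimes_R A^{\widehat\otimes_R n}$ (completed projective tensor product over $R$); elementary tensors are written $(a_0,\dots,a_n)$. Let $C_{\rm per}(A)=C_{\rm even}(A)\oplus C_{\rm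 odd}(A)$ with $C_{\rm even}(A)=\prod_n C_{2n}(A)$, $C_{\rm odd}(A)=\prod_n C_{2n+1}(A)$, with the product topologies. The continuous $R$-linear operators $b,B$ are given by $$b(a_0,\dots,a_n)=\sum_{j=0}^{n-1}(-1)^j(a_0,\dots,a_ja_{j+1},\dots,a_n)+(-1)^n(a_na_0,a_1,\dots,a_{n-1}),$$ $$B(a_0,\dots,a_n)=\sum_{j=0}^n(-1)^{jn}(e,a_j,\dots,a_n,a_0,\dots,a_{j-1})\ \ (a_0\in A),\qquad B(e,a_1,\dots,a_n)=0,$$ with $b=0$ on $C_0(A)$. The even and odd homology of $(C_{\rm per}(A),b+B)$, with the quotient topology, are the $R$-modules $HP_0(A)$ and $HP_1(A)$. For a connection $\nabla$ on $A$ let $E=\delta\nabla$, that is, $E(a_1,a_2)=\nabla(a_1)a_2+a_1\nabla(a_2)-\nabla(a_1a_2)$. Extend $\nabla$ to a connection on $A_+$ by $\nabla e=0$, i.e. $\nabla(a+f e)=\nabla a+f' e$. Put $$L_\nabla(a_0,\dots,a_n)=\sum_{i=0}^n(a_0,\dots,\nabla a_i,\dots,a_n),\qquad \iota_E(a_0,\dots,a_n)=-(a_0E(a_1,a_2),a_3,\dots,a_n),$$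 $$S_E(a_0,\dots,a_n)=\sum_{i=1}^{n-1}\sum_{j=0}^{n-i-1}(-1)^{i+j(n-1)}(e,a_{n-j+1},\dots,a_n,a_0,\dots,a_{i-1},E(a_i,a_{i+1}),a_{i+2},\dots,a_{n-j})\ \ (a_0\in A),$$ $S_E(e,a_1,\dots,a_n)=0$, with $\iota_E=0$ on $C_0(A)$ and $C_1(A)$, and $I_E=\iota_E+S_E$. **Proposition (Gauss–Manin connection).** For every smooth deformation, $b$ and $B$ are well-defined continuous $R$-linear operators, and for every connection $\nabla$ on $A_J$, with $E=\delta\nabla$, the formulas above define continuous operators $L_\nabla$ ($\mathbb C$-linear) and $I_E$ ($R$-linear) on $C_{\rm per}(A_J)$. The operator $$\nabla_{GM}=L_\nabla-I_E$$ is a connection on $C_{\rm per}(A_J)$ that commutes with $b+B$. It maps even (odd) cycles to even (odd) cycles, and $[z]\mapsto[\nabla_{GM}z]$ is a well-defined connection on the $R$-module $HP_p(A_J)$ for $p=0,1$. This induced connection on $HP_\bullet(A_J)$ does not depend on the choice of the connection $\nabla$ on $A_J$. -/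

import Mathlib

open Filter Topology TopologicalSpace
open scoped TensorProduct

noncomputable section

namespace GaussManin

set_option linter.unusedSectionVars false

section Smooth

variable {J : Opens ℝ} {X Y Z : Type*}

def HasDeriv [AddCommGroup X] [Module ℂ X] [TopologicalSpace X] (f f' : J → X) : Prop :=
  ∀ t : J, Tendsto (fun s : J => (((s : ℝ) - (t : ℝ) : ℝ) : ℂ)⁻¹ • (f s - f t))
    (𝓝[≠] t) (𝓝 (f' t))

def IsSmooth [AddCommGroup X] [Module ℂ X] [TopologicalSpace X] (f : J → X) : Prop :=
  ∃ g : ℕ → J → X, g 0 = f ∧ ∀ k, HasDeriv (g k) (g (k + 1))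

variable [AddCommGroup X] [Module ℂ X] [TopologicalSpace X] [IsTopologicalAddGroup X]
  [ContinuousSMul ℂ X]
variable [AddCommGroup Y] [Module ℂ Y] [TopologicalSpace Y] [IsTopologicalAddGroup Y]
  [ContinuousSMul ℂ Y]
variable [AddCommGroup Z] [Module ℂ Z] [TopologicalSpace Z] [IsTopologicalAddGroup Z]
  [ContinuousSMul ℂ Z]

theorem HasDeriv.add {f f' g g' : J → X} (hf : HasDeriv f f') (hg : HasDeriv g g') :
    HasDeriv (f + g) (f' + g') := fun t => by
  refine ((hf t).add (hg t)).congr fun s => ?_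
  rw [← smul_add]; congr 1; simp only [Pi.add_apply]; abel

theorem HasDeriv.const_smul {f f' : J → X} (c : ℂ) (hf : HasDeriv f f') :
    HasDeriv (c • f) (c • f') := fun t => by
  refine ((hf t).const_smul c).congr fun s => ?_
  rw [smul_comm, smul_sub]; rfl

theorem hasDeriv_const (x : X) : HasDeriv (fun _ : J => x) (fun _ => 0) := fun t => by
  simpa using tendsto_const_nhds

theorem HasDeriv.continuous {f f' : J → X} (hf : HasDeriv f f') : Continuous f := by
  refine continuous_iff_continuousAt.2 fun t => ?_
  rw [← continuousWithinAt_compl_self]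
  have h1 : Tendsto (fun s : J => (((s : ℝ) - (t : ℝ) : ℝ) : ℂ)) (𝓝[≠] t) (𝓝 0) := by
    have : Continuous fun s : J => (((s : ℝ) - (t : ℝ) : ℝ) : ℂ) := by fun_prop
    simpa using (this.tendsto t).mono_left nhdsWithin_le_nhds
  have h2 := (h1.smul (hf t)).add_const (f t)
  rw [zero_smul, zero_add] at h2
  refine h2.congr' ?_
  filter_upwards [self_mem_nhdsWithin] with s hs
  have : (((s : ℝ) - (t : ℝ) : ℝ) : ℂ) ≠ 0 := by
    rw [Complex.ofReal_ne_zero, sub_ne_zero]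
    exact fun h => hs (Subtype.ext h)
  rw [smul_inv_smul₀ this, sub_add_cancel]

instance punctured_neBot (t : J) : NeBot (𝓝[≠] t) := by
  have h : Topology.IsOpenEmbedding (Subtype.val : J → ℝ) := J.isOpen.isOpenEmbedding_subtypeVal
  have := h.toIsEmbedding.map_nhdsWithin_eq {t}ᶜ t
  have h2 : (Subtype.val '' ({t}ᶜ : Set J)) = (J : Set ℝ) \ {(t : ℝ)} := by
    ext s
    constructor
    · rintro ⟨u, hu, rfl⟩
      exact ⟨u.2, fun h => hu (Subtype.ext h)⟩
    · rintro ⟨h1, h2⟩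
      exact ⟨⟨s, h1⟩, fun h => h2 (congrArg Subtype.val h), rfl⟩
  rw [h2, Set.sdiff_eq, Set.inter_comm, nhdsWithin_inter_of_mem'] at this
  · rw [← Filter.map_neBot_iff (Subtype.val : J → ℝ), this]; infer_instance
  · exact mem_nhdsWithin_of_mem_nhds (J.isOpen.mem_nhds t.2)

theorem HasDeriv.unique [T2Space X] {f f' g' : J → X} (h : HasDeriv f f') (h' : HasDeriv f g') :
    f' = g' := funext fun t => tendsto_nhds_unique (h t) (h' t)

theorem isSmooth_of_set (S : Set (J → X)) (hS : ∀ f ∈ S, ∃ f' ∈ S, HasDeriv f f')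
    {f : J → X} (hf : f ∈ S) : IsSmooth f := by
  choose! d hd hd' using hS
  have hm : ∀ k, d^[k] f ∈ S := fun k => by
    induction k with
    | zero => exact hf
    | succ k ih => rw [Function.iterate_succ_apply']; exact hd _ ih
  refine ⟨fun k => d^[k] f, rfl, fun k => ?_⟩
  have := hd' _ (hm k)
  rwa [← Function.iterate_succ_apply' d] at this

variable (J X) in
/-- The smooth functions, as a subspace of all functions `J → X`. -/
def smoothSubmodule : Submodule ℂ (J → X) where
  carrier := {f | IsSmooth f}
  zero_mem' := ⟨fun _ => 0, rfl, fun _ => hasDeriv_const 0⟩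
  add_mem' := by
    rintro f g ⟨F, rfl, hF⟩ ⟨G, rfl, hG⟩
    exact ⟨fun k => F k + G k, rfl, fun k => (hF k).add (hG k)⟩
  smul_mem' := by
    rintro c f ⟨F, rfl, hF⟩
    exact ⟨fun k => c • F k, rfl, fun k => (hF k).const_smul c⟩

variable (J X) in
/-- The space `C^∞(J, X)`. -/
structure SmoothFun where
  toFun : J → X
  isSmooth' : IsSmooth toFun

namespace SmoothFun

instance : FunLike (SmoothFun J X) J X where
  coe := toFun
  coe_injective := fun ⟨_, _⟩ ⟨_, _⟩ h => by congr

instance : Zero (SmoothFun J X) := ⟨⟨0, (smoothSubmodule J X).zero_mem⟩⟩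
instance : Add (SmoothFun J X) :=
  ⟨fun f g => ⟨f + g, (smoothSubmodule J X).add_mem f.isSmooth' g.isSmooth'⟩⟩
instance : Neg (SmoothFun J X) :=
  ⟨fun f => ⟨-f, (smoothSubmodule J X).neg_mem f.isSmooth'⟩⟩
instance : Sub (SmoothFun J X) :=
  ⟨fun f g => ⟨f - g, (smoothSubmodule J X).sub_mem f.isSmooth' g.isSmooth'⟩⟩
instance : SMul ℂ (SmoothFun J X) :=
  ⟨fun c f => ⟨c • f, (smoothSubmodule J X).smul_mem c f.isSmooth'⟩⟩
instance : SMul ℕ (SmoothFun J X) :=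
  ⟨fun c f => ⟨c • f, (smoothSubmodule J X).nsmul_mem f.isSmooth' c⟩⟩
instance : SMul ℤ (SmoothFun J X) :=
  ⟨fun c f => ⟨c • f, (smoothSubmodule J X).toAddSubgroup.zsmul_mem f.isSmooth' c⟩⟩

instance : AddCommGroup (SmoothFun J X) :=
  DFunLike.coe_injective.addCommGroup (fun f : SmoothFun J X => (f : J → X)) rfl
    (fun _ _ => rfl) (fun _ => rfl) (fun _ _ => rfl) (fun _ _ => rfl) (fun _ _ => rfl)

instance : Module ℂ (SmoothFun J X) :=
  Function.Injective.module ℂ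
    { toFun := fun f : SmoothFun J X => (f : J → X), map_zero' := rfl, map_add' := fun _ _ => rfl }
    DFunLike.coe_injective (fun _ _ => rfl)

theorem isSmooth (f : SmoothFun J X) : IsSmooth f := f.isSmooth'

@[ext] theorem ext {f g : SmoothFun J X} (h : ∀ t, f t = g t) : f = g := DFunLike.ext _ _ h

@[simp] theorem mk_apply (f : J → X) (hf : IsSmooth f) (t : J) :
    (⟨f, hf⟩ : SmoothFun J X) t = f t := rfl
@[simp] theorem add_apply (f g : SmoothFun J X) (t : J) : (f + g) t = f t + g t := rfl
@[simp] theorem zero_apply (t : J) : (0 : SmoothFun J X) t = 0 := rfl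
@[simp] theorem smul_apply (c : ℂ) (f : SmoothFun J X) (t : J) : (c • f) t = c • f t := rfl
@[simp] theorem neg_apply (f : SmoothFun J X) (t : J) : (-f) t = -f t := rfl
@[simp] theorem sub_apply (f g : SmoothFun J X) (t : J) : (f - g) t = f t - g t := rfl

theorem exists_hasDeriv (f : SmoothFun J X) : ∃ f' : SmoothFun J X, HasDeriv f f' := by
  obtain ⟨g, h0, hg⟩ := f.isSmooth
  exact ⟨⟨g 1, fun k => g (k + 1), rfl, fun k => hg (k + 1)⟩, by rw [← h0]; exact hg 0⟩

variable [T2Space X] [T2Space Y] [T2Space Z]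

/-- The operator `d/dt` on `C^∞(J, X)`. -/
def D : SmoothFun J X →ₗ[ℂ] SmoothFun J X where
  toFun f := f.exists_hasDeriv.choose
  map_add' f g := ext fun t => congrFun
    ((f + g).exists_hasDeriv.choose_spec.unique
      (f.exists_hasDeriv.choose_spec.add g.exists_hasDeriv.choose_spec)) t
  map_smul' c f := ext fun t => congrFun
    ((c • f).exists_hasDeriv.choose_spec.unique (f.exists_hasDeriv.choose_spec.const_smul c)) t

theorem hasDeriv_D (f : SmoothFun J X) : HasDeriv f (D f) := f.exists_hasDeriv.choose_spec

theorem D_eq {f f' : SmoothFun J X} (h : HasDeriv f f') : D f = f' :=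
  ext fun t => congrFun ((hasDeriv_D f).unique h) t

/-- A smooth function as a continuous function. -/
def toC : SmoothFun J X →ₗ[ℂ] C(J, X) where
  toFun f := ⟨f, (hasDeriv_D f).continuous⟩
  map_add' _ _ := rfl
  map_smul' _ _ := rfl

/-- The topology of uniform convergence of functions and all their derivatives on compact
subsets of `J`. -/
instance : TopologicalSpace (SmoothFun J X) :=
  ⨅ k : ℕ, TopologicalSpace.induced (fun f => toC ((D ^ k) f)) inferInstance

instance : IsTopologicalAddGroup (SmoothFun J X) :=
  topologicalAddGroup_iInf fun k => topologicalAddGroup_induced (toC ∘ₗ (D ^ k))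

theorem continuous_rng_iff {W : Type*} [TopologicalSpace W] {F : W → SmoothFun J X} :
    Continuous F ↔ ∀ k, Continuous fun w => toC ((D ^ k) (F w)) := by
  simp only [continuous_iInf_rng, continuous_induced_rng, Function.comp_def]

theorem continuous_toC_pow (k : ℕ) :
    Continuous fun f : SmoothFun J X => toC ((D ^ k) f) :=
  continuous_rng_iff.1 continuous_id k

theorem continuous_D : Continuous (D : SmoothFun J X → SmoothFun J X) :=
  continuous_rng_iff.2 fun k => continuous_toC_pow (k + 1)

theorem continuous_D_pow (k : ℕ) : Continuous ((D ^ k : SmoothFun J X →ₗ[ℂ] SmoothFun J X)) := by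
  induction k with
  | zero => exact continuous_id
  | succ k ih => rw [pow_succ]; exact ih.comp continuous_D

theorem continuous_eval : Continuous fun p : SmoothFun J X × J => p.1 p.2 := by
  have : LocallyCompactSpace J := J.isOpen.locallyCompactSpace
  have h : Continuous fun f : SmoothFun J X => toC f := continuous_toC_pow 0
  exact (ContinuousEval.continuous_eval (F := C(J, X))).comp (h.prodMap continuous_id)

variable (J) in
/-- Constant functions. -/
def const : X →ₗ[ℂ] SmoothFun J X where
  toFun x := ⟨fun _ => x, fun k _ => if k = 0 then x else 0, by simp, fun k => by
    by_cases hk : k = 0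
    · simpa [hk] using hasDeriv_const x
    · simpa [hk] using hasDeriv_const 0⟩
  map_add' _ _ := rfl
  map_smul' _ _ := rfl

@[simp] theorem const_apply (x : X) (t : J) : const J x t = x := rfl

theorem D_const (x : X) : D (const J x) = 0 := D_eq (hasDeriv_const x)

theorem continuous_const : Continuous (const J : X → SmoothFun J X) := by
  refine continuous_rng_iff.2 fun k => ?_
  cases k with
  | zero => exact ContinuousMap.continuous_const'
  | succ k =>
    have : (fun w : X => toC ((D ^ (k + 1)) (const J w))) = fun _ => 0 := by
      funext w; rw [pow_succ]; simp [D_const]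
    rw [this]; exact _root_.continuous_const

/-- Leibniz rule for a smooth family of bilinear maps. -/
theorem hasDeriv_bilin (N : X →ₗ[ℂ] Y →ₗ[ℂ] SmoothFun J Z)
    (hN : Continuous fun p : X × Y => N p.1 p.2) (a : SmoothFun J X) (b : SmoothFun J Y) :
    HasDeriv (fun t => N (a t) (b t) t)
      ((fun t => D (N (a t) (b t)) t) +
        ((fun t => N (D a t) (b t) t) + fun t => N (a t) (D b t) t)) := fun t => by
  have hcont : ∀ x y, Tendsto (fun q : (X × Y) × J => N q.1.1 q.1.2 q.2) (𝓝 ((x, y), t))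
      (𝓝 (N x y t)) := fun x y =>
    (continuous_eval.comp (hN.prodMap continuous_id)).tendsto ((x, y), t)
  have hid : Tendsto (fun s : J => s) (𝓝[≠] t) (𝓝 t) := nhdsWithin_le_nhds
  have hb : Tendsto (fun s : J => b s) (𝓝[≠] t) (𝓝 (b t)) :=
    ((hasDeriv_D b).continuous.tendsto t).mono_left nhdsWithin_le_nhds
  have h1 := hasDeriv_D (N (a t) (b t)) t
  have h2 := (hcont _ _).comp ((((hasDeriv_D a) t).prodMk_nhds hb).prodMk_nhds hid)
  have h3 := (hcont _ _).comp (((tendsto_const_nhds (x := a t)).prodMk_nhds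
    ((hasDeriv_D b) t)).prodMk_nhds hid)
  refine (h1.add (h2.add h3)).congr fun s => ?_
  simp only [Function.comp, map_smul, LinearMap.smul_apply, map_sub, LinearMap.sub_apply,
    smul_apply, sub_apply, ← smul_add]
  congr 1; abel

theorem isSmooth_bilin (M : X →ₗ[ℂ] Y →ₗ[ℂ] SmoothFun J Z)
    (hM : Continuous fun p : X × Y => M p.1 p.2) (a : SmoothFun J X) (b : SmoothFun J Y) :
    IsSmooth (fun t => M (a t) (b t) t) := by
  let G : Set (J → Z) := {h | ∃ k i j : ℕ, h = fun t =>
    (D ^ k) (M ((D ^ i) a t) ((D ^ j) b t)) t}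
  refine isSmooth_of_set (AddSubmonoid.closure G : Set (J → Z)) (fun f hf => ?_)
    (AddSubmonoid.subset_closure ⟨0, 0, 0, rfl⟩)
  induction hf using AddSubmonoid.closure_induction with
  | mem f hf =>
    obtain ⟨k, i, j, rfl⟩ := hf
    have key := hasDeriv_bilin (M.compr₂ (D ^ k)) ((continuous_D_pow k).comp hM)
      ((D ^ i) a) ((D ^ j) b)
    refine ⟨_, ?_, key⟩
    refine add_mem (AddSubmonoid.subset_closure ⟨k + 1, i, j, ?_⟩)
      (add_mem (AddSubmonoid.subset_closure ⟨k, i + 1, j, ?_⟩)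
        (AddSubmonoid.subset_closure ⟨k, i, j + 1, ?_⟩)) <;> simp [pow_succ']
  | zero => exact ⟨0, zero_mem _, hasDeriv_const 0⟩
  | add f g _ _ hf hg =>
    obtain ⟨f', hf', h1⟩ := hf
    obtain ⟨g', hg', h2⟩ := hg
    exact ⟨f' + g', add_mem hf' hg', h1.add h2⟩

variable (J X) in
/-- The constant family with value the scalar multiplication `ℂ × X → X`. -/
def smulBilin : ℂ →ₗ[ℂ] X →ₗ[ℂ] SmoothFun J X := (LinearMap.lsmul ℂ X).compr₂ (const J)

theorem continuous_smulBilin : Continuous fun p : ℂ × X => smulBilin J X p.1 p.2 :=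
  continuous_const.comp continuous_smul

/-- The pointwise product of a scalar function and an `X`-valued function. -/
def fsmul (f : SmoothFun J ℂ) (x : SmoothFun J X) : SmoothFun J X :=
  ⟨fun t => f t • x t, isSmooth_bilin _ continuous_smulBilin f x⟩

@[simp] theorem fsmul_apply (f : SmoothFun J ℂ) (x : SmoothFun J X) (t : J) :
    fsmul f x t = f t • x t := rfl

theorem D_fsmul (f : SmoothFun J ℂ) (x : SmoothFun J X) :
    D (fsmul f x) = fsmul (D f) x + fsmul f (D x) := by
  refine D_eq ?_
  have h := hasDeriv_bilin _ continuous_smulBilin f x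
  have e : (fun t => D (smulBilin J X (f t) (x t)) t) = 0 := funext fun t => by
    have : D (smulBilin J X (f t) (x t)) = 0 := D_const _
    rw [this]; rfl
  rw [e, zero_add] at h
  exact h

theorem continuous_fsmul (f : SmoothFun J ℂ) :
    Continuous fun x : SmoothFun J X => fsmul f x := by
  refine continuous_rng_iff.2 fun k => ?_
  induction k generalizing f with
  | zero =>
    have h0 : Continuous fun x : SmoothFun J X => toC x := continuous_toC_pow 0
    refine ContinuousMap.continuous_of_continuous_uncurry _ ?_
    have h : Continuous fun q : SmoothFun J X × J => f q.2 • q.1 q.2 :=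
      ((hasDeriv_D f).continuous.comp continuous_snd).smul continuous_eval
    exact h
  | succ k ih =>
    have : (fun x : SmoothFun J X => toC ((D ^ (k + 1)) (fsmul f x))) =
        fun x => toC ((D ^ k) (fsmul (D f) x)) + toC ((D ^ k) (fsmul f (D x))) := by
      funext x
      rw [pow_succ, Module.End.mul_apply, D_fsmul, map_add, map_add]
    rw [this]
    exact (ih (D f)).add ((ih f).comp continuous_D)

/-- The ring `C^∞(J) = C^∞(J, ℂ)` with pointwise operations. -/
instance : CommRing (SmoothFun J ℂ) where
  __ := (inferInstance : AddCommGroup (SmoothFun J ℂ))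
  mul f g := fsmul f g
  one := const J 1
  mul_assoc _ _ _ := ext fun _ => mul_assoc _ _ _
  one_mul _ := ext fun _ => one_mul _
  mul_one _ := ext fun _ => mul_one _
  left_distrib _ _ _ := ext fun _ => mul_add _ _ _
  right_distrib _ _ _ := ext fun _ => add_mul _ _ _
  zero_mul _ := ext fun _ => zero_mul _
  mul_zero _ := ext fun _ => mul_zero _
  mul_comm _ _ := ext fun _ => mul_comm _ _

instance : Algebra ℂ (SmoothFun J ℂ) :=
  Algebra.ofModule (fun c f g => ext fun t => smul_mul_assoc c (f t) (g t))
    (fun c f g => ext fun t => mul_smul_comm c (f t) (g t))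

@[simp] theorem mul_apply (f g : SmoothFun J ℂ) (t : J) : (f * g) t = f t * g t := rfl
@[simp] theorem one_apply (t : J) : (1 : SmoothFun J ℂ) t = 1 := rfl

end SmoothFun

end Smooth

/-! ### Smooth deformations and their algebras of sections -/

section Deformation

variable (J : Opens ℝ) (X : Type*) [AddCommGroup X] [Module ℂ X] [TopologicalSpace X]
  [IsTopologicalAddGroup X] [ContinuousSMul ℂ X] [T2Space X]

/-- A smooth one-parameter deformation of algebras with underlying space `X`: associative
products `m_t` on `X` such that `(x, y) ↦ (t ↦ m_t(x, y))` is a jointly continuous bilinear map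
from `X × X` to `C^∞(J, X)`, that is, a continuous linear map on the completed projective tensor
square of `X`. -/
structure SmoothDeformation where
  mul : J → X →ₗ[ℂ] X →ₗ[ℂ] X
  assoc : ∀ t x y z, mul t (mul t x y) z = mul t x (mul t y z)
  smooth : ∃ M : X → X → SmoothFun J X, Continuous (fun p : X × X => M p.1 p.2) ∧
    ∀ x y t, M x y t = mul t x y

variable {J X}

namespace SmoothDeformation

theorem isSmooth_mul (𝒜 : SmoothDeformation J X) (a b : SmoothFun J X) :
    IsSmooth (fun t => 𝒜.mul t (a t) (b t)) := by
  obtain ⟨M, hM, h⟩ := 𝒜.smooth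
  let M' : X →ₗ[ℂ] X →ₗ[ℂ] SmoothFun J X := LinearMap.mk₂ ℂ M
    (fun _ _ _ => SmoothFun.ext fun _ => by simp [h])
    (fun _ _ _ => SmoothFun.ext fun _ => by simp [h])
    (fun _ _ _ => SmoothFun.ext fun _ => by simp [h])
    (fun _ _ _ => SmoothFun.ext fun _ => by simp [h])
  have := SmoothFun.isSmooth_bilin M' hM a b
  simpa [M', h] using this

/-- The algebra of sections `A_J`: the space `C^∞(J, X)` with the product
`(a b)(t) = m_t(a(t), b(t))`. -/
def Sections (_ : SmoothDeformation J X) : Type _ := SmoothFun J X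

variable (𝒜 : SmoothDeformation J X)

instance : AddCommGroup 𝒜.Sections := inferInstanceAs (AddCommGroup (SmoothFun J X))
instance : Module ℂ 𝒜.Sections := inferInstanceAs (Module ℂ (SmoothFun J X))
instance : FunLike 𝒜.Sections J X := inferInstanceAs (FunLike (SmoothFun J X) J X)
instance : TopologicalSpace 𝒜.Sections := inferInstanceAs (TopologicalSpace (SmoothFun J X))
instance : IsTopologicalAddGroup 𝒜.Sections :=
  inferInstanceAs (IsTopologicalAddGroup (SmoothFun J X))

variable {𝒜}

@[ext] theorem Sections.ext {a b : 𝒜.Sections} (h : ∀ t, a t = b t) : a = b :=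
  SmoothFun.ext h

instance : Mul 𝒜.Sections := ⟨fun a b => SmoothFun.mk _ (𝒜.isSmooth_mul a b)⟩
instance : SMul (SmoothFun J ℂ) 𝒜.Sections := ⟨fun f a => SmoothFun.fsmul (X := X) f a⟩

@[simp] theorem mul_apply (a b : 𝒜.Sections) (t : J) : (a * b) t = 𝒜.mul t (a t) (b t) := rfl
@[simp] theorem fsmul_apply (f : SmoothFun J ℂ) (a : 𝒜.Sections) (t : J) :
    (f • a) t = f t • a t := rfl
@[simp] theorem smul_apply (c : ℂ) (a : 𝒜.Sections) (t : J) : (c • a) t = c • a t := rfl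
@[simp] theorem add_apply (a b : 𝒜.Sections) (t : J) : (a + b) t = a t + b t := rfl
@[simp] theorem zero_apply (t : J) : (0 : 𝒜.Sections) t = 0 := rfl

instance : NonUnitalRing 𝒜.Sections where
  __ := (inferInstance : AddCommGroup 𝒜.Sections)
  left_distrib _ _ _ := Sections.ext fun _ => by simp
  right_distrib _ _ _ := Sections.ext fun _ => by simp
  zero_mul _ := Sections.ext fun _ => by simp
  mul_zero _ := Sections.ext fun _ => by simp
  mul_assoc _ _ _ := Sections.ext fun _ => 𝒜.assoc _ _ _ _

instance : Module (SmoothFun J ℂ) 𝒜.Sections where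
  one_smul _ := Sections.ext fun _ => one_smul _ _
  mul_smul _ _ _ := Sections.ext fun _ => mul_smul _ _ _
  smul_zero _ := Sections.ext fun _ => smul_zero _
  smul_add _ _ _ := Sections.ext fun _ => smul_add _ _ _
  add_smul _ _ _ := Sections.ext fun _ => add_smul _ _ _
  zero_smul _ := Sections.ext fun _ => zero_smul _ _

instance : IsScalarTower ℂ (SmoothFun J ℂ) 𝒜.Sections :=
  ⟨fun c f a => Sections.ext fun t => smul_assoc c (f t) (a t)⟩

instance : IsScalarTower (SmoothFun J ℂ) 𝒜.Sections 𝒜.Sections :=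
  ⟨fun _ _ _ => Sections.ext fun _ => by simp⟩

instance : SMulCommClass (SmoothFun J ℂ) 𝒜.Sections 𝒜.Sections :=
  ⟨fun _ _ _ => Sections.ext fun _ => by simp⟩

instance : ContinuousConstSMul (SmoothFun J ℂ) 𝒜.Sections :=
  ⟨fun f => SmoothFun.continuous_fsmul (X := X) f⟩

instance : ContinuousConstSMul (SmoothFun J ℂ) (SmoothFun J ℂ) :=
  ⟨fun f => SmoothFun.continuous_fsmul f⟩

end SmoothDeformation

end Deformation

/-! ### Chains, and the periodic cyclic complex, of a topological algebra over a commutative ring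

`R` is a commutative topological algebra over `ℂ` and `A` is a topological algebra over `R`,
possibly without unit. `Unitization R A` is `A₊ = A ⊕ R`; its unit `1` is written `e` below. -/

section Chains

/-- The topology of `A₊ = R ⊕ A`, that of the product. -/
instance unitizationTopology (R : Type) (A : Type*) [TopologicalSpace R] [TopologicalSpace A] :
    TopologicalSpace (Unitization R A) :=
  TopologicalSpace.induced (fun x => (x.fst, x.snd)) inferInstance

theorem continuous_unitization_smul {R : Type} {A : Type*} [CommRing R] [TopologicalSpace R]
    [ContinuousConstSMul R R] [AddCommGroup A] [Module R A] [TopologicalSpace A]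
    [ContinuousConstSMul R A] (r : R) : Continuous fun x : Unitization R A => r • x := by
  have h : Continuous fun x : Unitization R A => (x.fst, x.snd) := continuous_induced_dom
  refine continuous_induced_rng.2 ?_
  exact ((continuous_fst.comp h).const_smul r).prodMk ((continuous_snd.comp h).const_smul r)

variable (R : Type) (A : Type*) [CommRing R] [Algebra ℂ R] [TopologicalSpace R]
  [ContinuousConstSMul R R]
  [NonUnitalRing A] [Module ℂ A] [Module R A] [IsScalarTower ℂ R A] [IsScalarTower R A A]
  [SMulCommClass R A A] [TopologicalSpace A] [IsTopologicalAddGroup A] [ContinuousConstSMul R A]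

/-- The algebraic tensor product `A₊ ⊗ A ⊗ ⋯ ⊗ A` over `R`, with `n` factors `A`. -/
def PreChain (n : ℕ) : Type _ := Unitization R A ⊗[R] (⨂[R] _ : Fin n, A)

variable {R A}

namespace PreChain

variable {n : ℕ}

instance : AddCommGroup (PreChain R A n) :=
  inferInstanceAs (AddCommGroup (Unitization R A ⊗[R] (⨂[R] _ : Fin n, A)))
instance : Module R (PreChain R A n) :=
  inferInstanceAs (Module R (Unitization R A ⊗[R] (⨂[R] _ : Fin n, A)))
instance : Module ℂ (PreChain R A n) :=
  inferInstanceAs (Module ℂ (Unitization R A ⊗[R] (⨂[R] _ : Fin n, A)))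
instance : IsScalarTower ℂ R (PreChain R A n) :=
  inferInstanceAs (IsScalarTower ℂ R (Unitization R A ⊗[R] (⨂[R] _ : Fin n, A)))

/-- The elementary tensor `a₀ ⊗ a₁ ⊗ ⋯ ⊗ aₙ`. -/
def tensor (s : Unitization R A × (Fin n → A)) : PreChain R A n :=
  s.1 ⊗ₜ[R] PiTensorProduct.tprod R s.2

theorem smul_tensor (r : R) (s : Unitization R A × (Fin n → A)) :
    r • tensor s = tensor (r • s.1, s.2) := rfl

/-- The seminorm `p` is continuous for the projective topology: the canonical multilinear map
`(a₀, …, aₙ) ↦ a₀ ⊗ ⋯ ⊗ aₙ` is jointly continuous into the space seminormed by `p`. -/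
def IsProjective (p : Seminorm ℂ (PreChain R A n)) : Prop :=
  ∀ s : Unitization R A × (Fin n → A),
    Tendsto (fun u => p (tensor u - tensor s)) (𝓝 s) (𝓝 0)

/-- The projective topology: the strongest locally convex topology for which the canonical
multilinear map is jointly continuous. -/
instance : UniformSpace (PreChain R A n) :=
  ⨅ p : {p : Seminorm ℂ (PreChain R A n) // IsProjective p},
    p.1.toAddGroupSeminorm.toSeminormedAddCommGroup.toUniformSpace

instance : IsUniformAddGroup (PreChain R A n) :=
  isUniformAddGroup_iInf fun p =>
    @SeminormedAddCommGroup.to_isUniformAddGroup _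
      p.1.toAddGroupSeminorm.toSeminormedAddCommGroup

/-- A linear map that pulls projective seminorms back to multiples of projective seminorms is
uniformly continuous. -/
theorem uniformContinuous_of_le (T : PreChain R A n →+ PreChain R A n)
    (h : ∀ p : Seminorm ℂ (PreChain R A n), IsProjective p →
      ∃ q : Seminorm ℂ (PreChain R A n), IsProjective q ∧ ∃ c : ℝ, ∀ x, p (T x) ≤ c * q x) :
    UniformContinuous T := by
  refine uniformContinuous_iInf_rng.2 fun p => ?_
  obtain ⟨q, hq, c, hc⟩ := h p.1 p.2
  refine uniformContinuous_iInf_dom (i := (⟨q, hq⟩ : {p // IsProjective p})) ?_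
  have L := @AddMonoidHomClass.lipschitz_of_bound (PreChain R A n →+ PreChain R A n) _ _
    q.toAddGroupSeminorm.toSeminormedAddCommGroup.toSeminormedAddGroup
    p.1.toAddGroupSeminorm.toSeminormedAddCommGroup.toSeminormedAddGroup _ _ T c hc
  exact @LipschitzWith.uniformContinuous _ _
    q.toAddGroupSeminorm.toSeminormedAddCommGroup.toPseudoMetricSpace.toPseudoEMetricSpace
    p.1.toAddGroupSeminorm.toSeminormedAddCommGroup.toPseudoMetricSpace.toPseudoEMetricSpace
    _ _ L

instance : UniformContinuousConstSMul ℂ (PreChain R A n) :=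
  ⟨fun c => uniformContinuous_of_le (DistribSMul.toAddMonoidHom _ c)
    fun p hp => ⟨p, hp, ‖c‖, fun x => (map_smul_eq_mul p c x).le⟩⟩

instance : UniformContinuousConstSMul R (PreChain R A n) :=
  ⟨fun r => uniformContinuous_of_le (DistribSMul.toAddMonoidHom _ r) fun p hp => by
    have : SMulCommClass R ℂ (PreChain R A n) := IsScalarTower.to_smulCommClass'
    refine ⟨p.comp (DistribSMul.toLinearMap ℂ _ r), fun s => ?_, 1, fun x => (one_mul _).ge⟩
    have hc : Continuous fun u : Unitization R A × (Fin n → A) => (r • u.1, u.2) :=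
      ((continuous_unitization_smul r).comp continuous_fst).prodMk continuous_snd
    refine ((hp (r • s.1, s.2)).comp (hc.tendsto s)).congr fun u => ?_
    simp [Function.comp, ← smul_tensor, smul_sub]⟩

end PreChain

variable (R A) in
/-- The space of Hochschild `n`-chains: `C_0(A) = A`, and `C_n(A)` is the completed projective
tensor product over `R` of `A₊` and `n` copies of `A` for `n ≥ 1`. -/
def Chain : ℕ → Type _
  | 0 => A
  | n + 1 => UniformSpace.Completion (PreChain R A (n + 1))

namespace Chain

instance : ∀ n, AddCommGroup (Chain R A n)
  | 0 => inferInstanceAs (AddCommGroup A)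
  | n + 1 => inferInstanceAs (AddCommGroup (UniformSpace.Completion (PreChain R A (n + 1))))

instance : ∀ n, Module R (Chain R A n)
  | 0 => inferInstanceAs (Module R A)
  | n + 1 => inferInstanceAs (Module R (UniformSpace.Completion (PreChain R A (n + 1))))

instance : ∀ n, Module ℂ (Chain R A n)
  | 0 => inferInstanceAs (Module ℂ A)
  | n + 1 => inferInstanceAs (Module ℂ (UniformSpace.Completion (PreChain R A (n + 1))))

instance : ∀ n, IsScalarTower ℂ R (Chain R A n)
  | 0 => inferInstanceAs (IsScalarTower ℂ R A)
  | n + 1 => inferInstanceAs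
      (IsScalarTower ℂ R (UniformSpace.Completion (PreChain R A (n + 1))))

instance : ∀ n, TopologicalSpace (Chain R A n)
  | 0 => inferInstanceAs (TopologicalSpace A)
  | n + 1 => inferInstanceAs
      (TopologicalSpace (UniformSpace.Completion (PreChain R A (n + 1))))

instance : ∀ n, IsTopologicalAddGroup (Chain R A n)
  | 0 => inferInstanceAs (IsTopologicalAddGroup A)
  | n + 1 => inferInstanceAs
      (IsTopologicalAddGroup (UniformSpace.Completion (PreChain R A (n + 1))))

/-- The elementary chain `(x₀, x₁, …, xₙ)`. The entries `x₁, …, xₙ` (and `x₀` if `n = 0`) are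
projected from `A₊` to `A` along `e`; so a chain with `e` in one of these places is `0`. -/
def elem : ∀ n, (ℕ → Unitization R A) → Chain R A n
  | 0, x => (x 0).snd
  | n + 1, x =>
    ((PreChain.tensor (x 0, fun i : Fin (n + 1) => (x (i + 1)).snd) : PreChain R A (n + 1)) :
      UniformSpace.Completion (PreChain R A (n + 1)))

end Chain

/-- The word `(a₀, a₁, a₂, …)` with `a₀ ∈ A₊` and `aᵢ ∈ A` for `i ≥ 1`. -/
def word (a₀ : Unitization R A) (a : ℕ → A) : ℕ → Unitization R A :=
  fun i => if i = 0 then a₀ else (a i : Unitization R A)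

/-- The operator `T` is given on elementary chains by the formula `φ`. -/
def ActsBy {S : Type*} [Semiring S] {n m : ℕ} [Module S (Chain R A n)] [Module S (Chain R A m)]
    (T : Chain R A n →L[S] Chain R A m) (φ : (ℕ → Unitization R A) → Chain R A m) : Prop :=
  ∀ (a₀ : Unitization R A) (a : ℕ → A), (n = 0 → a₀.fst = 0) →
    T (Chain.elem n (word a₀ a)) = φ (word a₀ a)

open Classical in
/-- The continuous `S`-linear operator given on elementary chains by the formula `φ` (if there
is one; it is unique because the elementary chains span a dense subspace). -/
def extend (S : Type*) [Semiring S] (n m : ℕ) [Module S (Chain R A n)] [Module S (Chain R A m)]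
    (φ : (ℕ → Unitization R A) → Chain R A m) : Chain R A n →L[S] Chain R A m :=
  if h : ∃ T : Chain R A n →L[S] Chain R A m, ActsBy T φ then h.choose else 0

/-- `b(a₀, …, aₙ₊₁) = ∑_{j=0}^{n} (-1)^j (a₀, …, aⱼaⱼ₊₁, …, aₙ₊₁)
+ (-1)^{n+1} (aₙ₊₁a₀, a₁, …, aₙ)`. -/
def bFormula (n : ℕ) (x : ℕ → Unitization R A) : Chain R A n :=
  ∑ j ∈ Finset.range (n + 1), (-1 : ℤ) ^ j • Chain.elem n (fun i =>
    if i < j then x i else if i = j then x j * x (j + 1) else x (i + 1)) +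
  (-1 : ℤ) ^ (n + 1) • Chain.elem n (fun i => if i = 0 then x (n + 1) * x 0 else x i)

/-- `B(a₀, …, aₙ) = ∑_{j=0}^{n} (-1)^{jn} (e, aⱼ, …, aₙ, a₀, …, aⱼ₋₁)` for `a₀ ∈ A`, and
`B(e, a₁, …, aₙ) = 0`. -/
def BFormula (n : ℕ) (x : ℕ → Unitization R A) : Chain R A (n + 1) :=
  ∑ j ∈ Finset.range (n + 1), (-1 : ℤ) ^ (j * n) • Chain.elem (n + 1) (fun i =>
    if i = 0 then 1 else x ((i - 1 + j) % (n + 1)))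

/-- `L(a₀, …, aₙ) = ∑_{i=0}^{n} (a₀, …, ∇aᵢ, …, aₙ)`, where `∇` is extended to `A₊` by
`∇(a + r e) = ∇a + (∂r) e`; here `∂` is the derivation of `R` that enters the Leibniz rule of
`∇`, so that this is the extension with `∇e = 0`. -/
def lieFormula (der : R → R) (nabla : A → A) (n : ℕ) (x : ℕ → Unitization R A) : Chain R A n :=
  ∑ i ∈ Finset.range (n + 1), Chain.elem n (Function.update x i
    (Unitization.inl (der (x i).fst) + (nabla (x i).snd : Unitization R A)))

/-- `ι_E(a₀, …, aₙ₊₂) = -(a₀E(a₁, a₂), a₃, …, aₙ₊₂)` for a `2`-cochain `E`. -/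
def iotaFormula (E : A → A → A) (n : ℕ) (x : ℕ → Unitization R A) : Chain R A n :=
  -Chain.elem n (fun i =>
    if i = 0 then x 0 * (E (x 1).snd (x 2).snd : Unitization R A) else x (i + 2))

/-- `S_E(a₀, …, aₙ) = ∑_{i=1}^{n-1} ∑_{j=0}^{n-i-1} (-1)^{i+j(n-1)}
(e, aₙ₋ⱼ₊₁, …, aₙ, a₀, …, aᵢ₋₁, E(aᵢ, aᵢ₊₁), aᵢ₊₂, …, aₙ₋ⱼ)` for a `2`-cochain `E` and `a₀ ∈ A`,
and `S_E(e, a₁, …, aₙ) = 0`. -/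
def sFormula (E : A → A → A) (n : ℕ) (x : ℕ → Unitization R A) : Chain R A n :=
  ∑ i ∈ Finset.Icc 1 (n - 1), ∑ j ∈ Finset.range (n - i),
    (-1 : ℤ) ^ (i + j * (n - 1)) • Chain.elem n (fun k =>
      if k = 0 then 1
      else if k ≤ j then x (n - j + k)
      else if k ≤ j + i then x (k - j - 1)
      else if k = j + i + 1 then (E (x i).snd (x (i + 1)).snd : Unitization R A)
      else x (k - j))

variable (R A) in
/-- The Hochschild boundary `b : C_{n+1}(A) → C_n(A)`. -/
def hochschildB (n : ℕ) : Chain R A (n + 1) →L[R] Chain R A n := extend R _ _ (bFormula n)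

variable (R A) in
/-- The operator `B : C_n(A) → C_{n+1}(A)`. -/
def connesB (n : ℕ) : Chain R A n →L[R] Chain R A (n + 1) := extend R _ _ (BFormula n)

/-- The Lie derivative along a connection, on `C_n(A)`. -/
def lie (der : R → R) (nabla : A → A) (n : ℕ) : Chain R A n →L[ℂ] Chain R A n :=
  extend ℂ _ _ (lieFormula der nabla n)

variable (R) in
/-- The contraction `ι_E : C_{n+2}(A) → C_n(A)`. -/
def iota (E : A → A → A) (n : ℕ) : Chain R A (n + 2) →L[R] Chain R A n :=
  extend R _ _ (iotaFormula E n)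

variable (R) in
/-- The operator `S_E : C_n(A) → C_n(A)`. -/
def cyclicS (E : A → A → A) (n : ℕ) : Chain R A n →L[R] Chain R A n :=
  extend R _ _ (sFormula E n)

variable (R A) in
/-- The space `C_per(A)`, the product of all `C_n(A)` with the product topology. It is the direct
sum of its even part and its odd part, see `parity`. -/
abbrev Per : Type _ := ∀ n, Chain R A n

variable (R A) in
/-- The differential `b + B` on `C_per(A)`. -/
def perD : Per R A →L[R] Per R A :=
  ContinuousLinearMap.pi fun n => match n with
    | 0 => hochschildB R A 0 ∘L ContinuousLinearMap.proj 1
    | n + 1 => hochschildB R A (n + 1) ∘L ContinuousLinearMap.proj (n + 2) +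
        connesB R A n ∘L ContinuousLinearMap.proj n

/-- The Lie derivative along a connection, on `C_per(A)`. -/
def perLie (der : R → R) (nabla : A → A) : Per R A →L[ℂ] Per R A :=
  ContinuousLinearMap.pi fun n => lie der nabla n ∘L ContinuousLinearMap.proj n

variable (R) in
/-- The cyclic contraction `I_E = ι_E + S_E` on `C_per(A)` with a `2`-cochain `E`. -/
def perI (E : A → A → A) : Per R A →L[R] Per R A :=
  ContinuousLinearMap.pi fun n => iota R E n ∘L ContinuousLinearMap.proj (n + 2) +
    cyclicS R E n ∘L ContinuousLinearMap.proj n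

/-- The Hochschild coboundary of a `1`-cochain:
`(δD)(a₁, a₂) = D(a₁)a₂ + a₁D(a₂) - D(a₁a₂)`. -/
def coboundary (D : A → A) (a₁ a₂ : A) : A := D a₁ * a₂ + a₁ * D a₂ - D (a₁ * a₂)

/-- `L_∇ - I_E` with `E = δ∇`. -/
def perGM (der : R → R) (nabla : A → A) : Per R A →L[ℂ] Per R A :=
  perLie der nabla - (perI R (coboundary nabla)).restrictScalars ℂ

variable (R A) in
/-- The even (`p = 0`) and odd (`p = 1`) part of `C_per(A)`. -/
def parity (p : ZMod 2) : Submodule R (Per R A) where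
  carrier := {x | ∀ n : ℕ, (n : ZMod 2) ≠ p → x n = 0}
  zero_mem' _ _ := rfl
  add_mem' hx hy n hn := by simp [hx n hn, hy n hn]
  smul_mem' r x hx n hn := by simp [hx n hn]

variable (R A) in
/-- The cycles of parity `p`. -/
def cycles (p : ZMod 2) : Submodule R (Per R A) :=
  LinearMap.ker (perD R A : Per R A →ₗ[R] Per R A) ⊓ parity R A p

variable (R A) in
/-- The boundaries of parity `p`. -/
def boundaries (p : ZMod 2) : Submodule R (Per R A) :=
  (parity R A (p + 1)).map (perD R A : Per R A →ₗ[R] Per R A)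

variable (R A) in
/-- The periodic cyclic homology `HP_p(A)` over `R`, with the quotient topology. -/
abbrev HP (p : ZMod 2) : Type _ := cycles R A p ⧸ (boundaries R A p).submoduleOf (cycles R A p)

/-- `N` is the operator on `HP_p(A)` induced by the operator `T` on `C_per(A)`: `T` maps cycles
of parity `p` to such cycles, and `N[z] = [Tz]`. -/
def Induces (T : Per R A →L[ℂ] Per R A) (p : ZMod 2) (N : HP R A p →L[ℂ] HP R A p) : Prop :=
  ∀ z : cycles R A p, ∃ h : T z ∈ cycles R A p,
    N (Submodule.Quotient.mk z) = Submodule.Quotient.mk ⟨T z, h⟩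

end Chains

/-! ### Connections -/

/-- A continuous `ℂ`-linear operator on a topological `C^∞(J)`-module is a connection if it
satisfies the Leibniz rule. -/
def IsConnection {J : Opens ℝ} {M : Type*} [AddCommGroup M] [Module ℂ M]
    [Module (SmoothFun J ℂ) M] [TopologicalSpace M] (nabla : M →L[ℂ] M) : Prop :=
  ∀ (f : SmoothFun J ℂ) (m : M), nabla (f • m) = SmoothFun.D f • m + f • nabla m

section

variable {J : Opens ℝ} {X : Type*} [AddCommGroup X] [Module ℂ X] [TopologicalSpace X]
  [IsTopologicalAddGroup X] [ContinuousSMul ℂ X] [T2Space X]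

/-- The operator `∇_GM = L_∇ - I_E`, `E = δ∇`, on `C_per(A_J)`. -/
def gaussManin {𝒜 : SmoothDeformation J X} (nabla : 𝒜.Sections →L[ℂ] 𝒜.Sections) :
    Per (SmoothFun J ℂ) 𝒜.Sections →L[ℂ] Per (SmoothFun J ℂ) 𝒜.Sections :=
  perGM SmoothFun.D nabla

end

end GaussManin

end

/-! The heart of the matter is a Cartan homotopy formula. For a `1`-cochain `D`, let
$I_D=\iota_D+S_D$, where $\iota_D(a_0,\dots,a_n)=(a_0D(a_1),a_2,\dots)$ and $S_D$ is the signed sum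
of the words $(e,\dots,a_0,\dots,D(a_p),\dots)$ obtained by rotating, putting $e$ in front, and
applying $D$ to a letter to the right of $a_0$. Then $[b+B,I_D]=L_D-I_{\delta D}$. Its graded pieces
are $[b,\iota_D]=-\iota_{\delta D}$ (`iotaD_bF_add`), $[b,S_D]+[B,\iota_D]=L_D-S_{\delta D}$
(`homotopy_formula`) and $BS_D=S_DB=0$ (`SD_BF`, `BF_SD`); the last holds because the unit would
occur at an interior place.

With $D=\nabla$ the right side is $\nabla_{GM}$, but $I_\nabla$ does not exist on tensor products
over $R$: $\nabla$ is not $R$-linear, so $\iota_\nabla$ is not balanced. This is why $\nabla_{GM}$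
is a connection and not a null-homotopic operator. The formula nevertheless makes sense for words of
elements of $A_+$, before any tensor product is formed. All operators are therefore first treated as
transformations of additive functions of words. There $\nabla_{GM}$ is built from commutators with
$b+B$, and it follows that it commutes with $b+B$ (`iotaE_bF`, `lieF_bF_zero`, `lieF_bF_succ`,
`lieF_BF`, `SE_BF`, `BF_SE`). Only $b$, $B$, $L_\nabla$, $\iota_E$ and $S_E$ occur in the resulting
identities, and these do descend: $E=\delta\nabla$ is $R$-bilinear, and $L_\nabla$ is balanced
because $\nabla$ produces the same extra term $f'\cdot(a_0,\dots,a_n)$ whichever letter carries the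
scalar $f$ (`lieF_smul`).

For two connections the difference $D=\nabla-\nabla'$ is $R$-linear. Hence $I_D$ does exist on
chains, and the homotopy formula shows that the two operators $\nabla_{GM}$ are homotopic
(`perGM_sub`), so they agree on homology.

The analytic part is that a jointly continuous, balanced formula defines a continuous operator on
the completed tensor product (`exists_continuous_hom`). The target must be locally convex and
complete. In degree `0` this is a statement on $C^\infty(J,X)$, whose completeness rests on the mean
value inequality (`SmoothFun.completeSpace`). -/

noncomputable section

namespace GaussManin

set_option linter.unusedSectionVars false

/-! ### Operations on words -/

section Words

variable {U M : Type*} [Ring U] [AddCommGroup M]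

/-- Replace the letters `m` and `m + 1` of a word by a single letter. -/
def merge (β : U → U → U) (m : ℕ) (x : ℕ → U) : ℕ → U :=
  fun i => if i < m then x i else if i = m then β (x m) (x (m + 1)) else x (i + 1)

/-- Apply a map to the letter `p` of a word. -/
def app (D : U → U) (p : ℕ) (x : ℕ → U) : ℕ → U := Function.update x p (D (x p))

/-- Rotate the letters `0, …, n` of a word to the right by `j` places. -/
def rot (n j : ℕ) (x : ℕ → U) : ℕ → U :=
  fun i => if i < j then x (n + 1 - j + i) else x (i - j)

/-- Insert the unit in front of a word. -/
def ins (x : ℕ → U) : ℕ → U := fun i => if i = 0 then 1 else x (i - 1)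

/-- The `k`-th Hochschild face of a word with letters `0, …, n`. -/
def face (n k : ℕ) (x : ℕ → U) : ℕ → U :=
  if k < n then merge (· * ·) k x else fun i => if i = 0 then x n * x 0 else x i

/-- The function `g` depends only on the letters `0, …, n`. -/
def IsLocal {V : Type*} (n : ℕ) (g : (ℕ → U) → V) : Prop :=
  ∀ x y, (∀ i ≤ n, x i = y i) → g x = g y

/-- The function `g` is additive in the letter `k`. -/
def AddAt (k : ℕ) (g : (ℕ → U) → M) : Prop :=
  ∀ x u v, g (Function.update x k (u + v)) = g (Function.update x k u) + g (Function.update x k v)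

/-- The coboundary of a map `D : U → U`. -/
def cobd (D : U → U) (u v : U) : U := D u * v + u * D v - D (u * v)

/-- The Hochschild boundary, as an operator on functions of words. -/
def bF (n : ℕ) (g : (ℕ → U) → M) (x : ℕ → U) : M :=
  ∑ k ∈ Finset.range (n + 2), (-1 : ℤ) ^ k • g (face (n + 1) k x)

/-- The Connes operator, as an operator on functions of words. -/
def BF (n : ℕ) (g : (ℕ → U) → M) (x : ℕ → U) : M :=
  ∑ j ∈ Finset.range (n + 1), (-1 : ℤ) ^ (j * n) • g (ins (rot n j x))

/-- The Lie derivative, as an operator on functions of words. -/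
def lieF (D : U → U) (n : ℕ) (g : (ℕ → U) → M) (x : ℕ → U) : M :=
  ∑ i ∈ Finset.range (n + 1), g (app D i x)

/-- The contraction with a `1`-cochain, as an operator on functions of words. -/
def iotaD (D : U → U) (g : (ℕ → U) → M) (x : ℕ → U) : M :=
  g (merge (· * ·) 0 (app D 1 x))

/-- The cyclic correction of the contraction with a `1`-cochain, on functions of words. -/
def SD (D : U → U) (n : ℕ) (g : (ℕ → U) → M) (x : ℕ → U) : M :=
  ∑ j ∈ Finset.range (n + 1), ∑ p ∈ Finset.Ico (j + 1) (n + 1),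
    (-1 : ℤ) ^ (j * n) • g (ins (app D p (rot n j x)))

/-- The contraction with a `2`-cochain, as an operator on functions of words. -/
def iotaE (E : U → U → U) (g : (ℕ → U) → M) (x : ℕ → U) : M :=
  - g (merge (· * ·) 0 (merge E 1 x))

/-- The cyclic correction of the contraction with a `2`-cochain, on functions of words. -/
def SE (E : U → U → U) (n : ℕ) (g : (ℕ → U) → M) (x : ℕ → U) : M :=
  ∑ j ∈ Finset.range n, ∑ m ∈ Finset.Ico (j + 1) n,
    (-1 : ℤ) ^ (m + j * n) • g (ins (merge E m (rot n j x)))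

theorem AddAt.map_zero {k : ℕ} {g : (ℕ → U) → M} (h : AddAt k g) {x : ℕ → U} (hx : x k = 0) :
    g x = 0 := by
  have := h x 0 0
  rw [add_zero, ← hx, Function.update_eq_self] at this
  exact left_eq_add.mp this

theorem AddAt.map_sub {k : ℕ} {g : (ℕ → U) → M} (h : AddAt k g) (x : ℕ → U) (u v : U) :
    g (Function.update x k (u - v)) = g (Function.update x k u) - g (Function.update x k v) := by
  rw [eq_sub_iff_add_eq, ← h, sub_add_cancel]

/-- The simplicial identity of the cyclic bar construction, by associativity. Only the letters `t ≤
n` are compared: the last face does not shift the letters behind the word, so the irrelevant tails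
differ. -/
theorem face_face {n i j t : ℕ} (hij : i < j) (hj : j ≤ n + 2) (ht : t ≤ n) (x : ℕ → U) :
    face (n + 1) i (face (n + 2) j x) t = face (n + 1) (j - 1) (face (n + 2) i x) t := by
  unfold face merge
  have h1 : i < n + 2 := by omega
  have h3 : i < n + 1 ∨ i = n + 1 := by omega
  rcases h3 with h3 | h3
  · simp only [h1, h3, if_true]
    by_cases h2 : j < n + 2
    · have h4 : j - 1 < n + 1 := by omega
      simp only [h2, h4, if_true]
      grind
    · have h4 : ¬ (j - 1 < n + 1) := by omega
      obtain rfl : j = n + 2 := by omega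
      simp only [h2, h4, if_false]
      grind
  · obtain rfl : j = n + 2 := by omega
    subst h3
    simp
    grind

/-- After a rotation by `j` the letter $a_0$ stands at place `j`. Merging at or to the right of it
is an ordinary face taken before the rotation; merging to the left of it (next lemma) uses up one
rotated letter, and `m = j - 1` is the cyclic face $a_{n+1}a_0$. -/
theorem merge_rot_of_le {n m j i : ℕ} (h : j ≤ m) (hm : m ≤ n) (x : ℕ → U) :
    merge (· * ·) m (rot (n + 1) j x) i = rot n j (face (n + 1) (m - j) x) i := by
  have : m - j < n + 1 := by omega
  simp only [face, this, if_true, merge, rot]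
  grind

theorem merge_rot_of_lt {n m j i : ℕ} (h : m < j) (hj : j ≤ n + 1) (hi : i ≤ n) (x : ℕ → U) :
    merge (· * ·) m (rot (n + 1) j x) i = rot n (j - 1) (face (n + 1) (n + 2 - j + m) x) i := by
  unfold face
  split_ifs with h1
  · simp only [merge, rot]; grind
  · simp only [merge, rot]; grind

theorem face_ins_zero (n : ℕ) (z : ℕ → U) : face (n + 1) 0 (ins z) = z := by
  funext i
  simp only [face, merge, ins, Nat.zero_lt_succ, if_true]; grind

theorem face_ins_succ {n k : ℕ} (hk : k < n) (z : ℕ → U) :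
    face (n + 1) (k + 1) (ins z) = ins (merge (· * ·) k z) := by
  funext i
  have : k + 1 < n + 1 := by omega
  simp only [face, merge, ins, this, if_true]; grind

theorem face_ins_last {n i : ℕ} (z : ℕ → U) :
    face (n + 1) (n + 1) (ins z) i = rot n 1 z i := by
  simp only [face, rot, ins]; grind

theorem rot_one_rot {n j i : ℕ} (hj : j ≤ n) (x : ℕ → U) :
    rot n 1 (rot n j x) i = rot n (j + 1) x i := by
  simp only [rot]; grind

theorem rot_zero (n : ℕ) (x : ℕ → U) : rot n 0 x = x := by
  funext i; simp [rot]

theorem rot_full {n i : ℕ} (hi : i ≤ n) (x : ℕ → U) : rot n (n + 1) x i = x i := by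
  simp only [rot]; grind

theorem rot_app {n j i : ℕ} (D : U → U) (h : i + j ≤ n) (x : ℕ → U) :
    rot n j (app D i x) = app D (i + j) (rot n j x) := by
  funext k
  simp only [rot, app, Function.update_apply]; grind

theorem app_zero_rot {n j i k : ℕ} (D : U → U) (hj : 1 ≤ j) (hk : k ≤ n)
    (h : i + j = n + 1) (x : ℕ → U) :
    rot n j (app D i x) k = app D 0 (rot n j x) k := by
  simp only [rot, app, Function.update_apply]; grind

theorem merge_app_of_lt {m p : ℕ} (D : U → U) (β : U → U → U) (h : p < m) (x : ℕ → U) :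
    merge β m (app D p x) = app D p (merge β m x) := by
  funext k
  simp only [merge, app, Function.update_apply]; grind

theorem merge_app_of_gt {m p : ℕ} (D : U → U) (β : U → U → U) (h : m + 1 < p) (x : ℕ → U) :
    merge β m (app D p x) = app D (p - 1) (merge β m x) := by
  funext k
  simp only [merge, app, Function.update_apply]; grind

theorem IsLocal.comp_ins {n : ℕ} {g : (ℕ → U) → M} (h : IsLocal (n + 1) g) :
    IsLocal n (fun z => g (ins z)) := fun x y hxy => h _ _ fun i hi => by
  unfold ins
  split_ifs
  · rfl
  · exact hxy _ (by omega)

theorem AddAt.comp_ins {k : ℕ} {g : (ℕ → U) → M} (h : AddAt (k + 1) g) :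
    AddAt k (fun z => g (ins z)) := fun x u v => by
  have e : ∀ w, ins (Function.update x k w) = Function.update (ins x) (k + 1) w := fun w => by
    funext i; simp only [ins, Function.update_apply]; grind
  simp only [e, h _ u v]

/-- The four words differ only in the letter `m`, where `g` is additive. The identity measures how
far `D` is from commuting with the multiplication of two neighbouring letters. -/
theorem merge_cobd {m : ℕ} {g : (ℕ → U) → M} (h : AddAt m g) (D : U → U) (z : ℕ → U) :
    g (merge (cobd D) m z) = g (merge (· * ·) m (app D m z)) + g (merge (· * ·) m (app D (m + 1) z))
      - g (app D m (merge (· * ·) m z)) := by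
  have e : ∀ (y : ℕ → U) w, (∀ i, i ≠ m → y i = merge (· * ·) m z i) → y m = w →
      y = Function.update (merge (· * ·) m z) m w := fun y w h1 h2 => by
    funext i
    rw [Function.update_apply]
    split_ifs with hi
    · rw [hi, h2]
    · exact h1 i hi
  rw [e (merge (cobd D) m z) (D (z m) * z (m + 1) + z m * D (z (m + 1)) - D (z m * z (m + 1))),
    h.map_sub, h, ← e, ← e, ← e]
  all_goals try intro i hi
  all_goals simp only [merge, app, cobd, Function.update_apply]
  all_goals grind

end Words

/-! ### The identities between $b$, $B$ and the contractions on words. -/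

section WordIdentities

variable {U M : Type*} [Ring U] [AddCommGroup M]

theorem neg_one_pow_congr' {a b : ℕ} (c : ℕ) (h : b = a + 2 * c) : (-1 : ℤ) ^ b = (-1) ^ a := by
  rw [h, pow_add, pow_mul]; simp

/-- The substitution `p = i + j` passes from the place `p` in the word rotated by `j` to the place
`i` that the letter had before the rotation. -/
theorem sum_range_Ico_diag (N : ℕ) (F : ℕ → ℕ → M) :
    ∑ j ∈ Finset.range N, ∑ p ∈ Finset.Ico (j + 1) N, F p j =
      ∑ i ∈ Finset.Ico 1 N, ∑ j ∈ Finset.range (N - i), F (i + j) j := by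
  rw [Finset.sum_sigma', Finset.sum_sigma']
  refine Finset.sum_nbij' (fun a => ⟨a.2 - a.1, a.1⟩) (fun a => ⟨a.2, a.1 + a.2⟩) ?_ ?_ ?_ ?_ ?_
  · rintro ⟨j, p⟩ h
    simp only [Finset.mem_sigma, Finset.mem_range, Finset.mem_Ico] at h ⊢; omega
  · rintro ⟨j, p⟩ h
    simp only [Finset.mem_sigma, Finset.mem_range, Finset.mem_Ico] at h ⊢; omega
  · rintro ⟨j, p⟩ h
    simp only [Finset.mem_sigma, Finset.mem_range, Finset.mem_Ico] at h ⊢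
    congr; omega
  · rintro ⟨j, p⟩ h
    simp only [Finset.mem_sigma, Finset.mem_range, Finset.mem_Ico] at h ⊢
    congr; omega
  · rintro ⟨j, p⟩ h
    simp only [Finset.mem_sigma, Finset.mem_range, Finset.mem_Ico] at h ⊢
    congr; omega

/-- Counts the pairs (face, rotation of the face) by the pairs (rotation, merging in the rotated
word). The bijection is dictated by `merge_rot_of_le` and `merge_rot_of_lt`. -/
theorem sum_face_rot (n : ℕ) (H : ℕ → ℕ → M) :
    ∑ k ∈ Finset.range (n + 2), ∑ j ∈ Finset.range (n + 1), H k j =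
      ∑ j ∈ Finset.range (n + 2), ∑ m ∈ Finset.range (n + 1),
        if m < j then H (n + 2 - j + m) (j - 1) else H (m - j) j := by
  rw [← Finset.sum_product', ← Finset.sum_product']
  refine Finset.sum_nbij' (fun a => if a.1 + a.2 ≤ n then (a.2, a.1 + a.2)
      else (a.2 + 1, a.1 + a.2 - (n + 1)))
    (fun a => if a.2 < a.1 then (n + 2 - a.1 + a.2, a.1 - 1) else (a.2 - a.1, a.1)) ?_ ?_ ?_ ?_ ?_
  all_goals
    rintro ⟨j, p⟩ h
    simp only [Finset.mem_product, Finset.mem_range] at h ⊢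
  · split_ifs <;> simp only <;> omega
  · split_ifs <;> simp only <;> omega
  · by_cases h1 : j + p ≤ n
    · have h2 : ¬ (j + p < p) := by omega
      simp only [h1, h2, if_true, if_false]; congr; omega
    · have h2 : j + p - (n + 1) < p + 1 := by omega
      simp only [h1, h2, if_true, if_false]; congr; omega
  · by_cases h1 : p < j
    · have h2 : ¬ (n + 2 - j + p + (j - 1) ≤ n) := by omega
      simp only [h1, h2, if_true, if_false]; congr <;> omega
    · have h2 : p - j + j ≤ n := by omega
      simp only [h1, h2, if_true, if_false]; congr; omega
  · by_cases h1 : j + p ≤ n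
    · have h2 : ¬ (j + p < p) := by omega
      simp only [h1, h2, if_true, if_false]; congr; omega
    · have h2 : j + p - (n + 1) < p + 1 := by omega
      simp only [h1, h2, if_true, if_false]; congr; omega

theorem bF_bF {n : ℕ} {g : (ℕ → U) → M} (hg : IsLocal n g) (x : ℕ → U) :
    bF (n + 1) (bF n g) x = 0 := by
  simp only [bF, Finset.smul_sum, ← Finset.sum_product', smul_smul, ← pow_add]
  -- The simplicial identity pairs the terms $d_id_j$ and $d_{j-1}d_i$, $i<j$, which carry opposite
  -- signs.
  refine Finset.sum_involution
    (fun a _ => if a.2 < a.1 then (a.2, a.1 - 1) else (a.2 + 1, a.1)) ?_ ?_ ?_ ?_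
  · rintro ⟨j, i⟩ h
    simp only [Finset.mem_product, Finset.mem_range] at h ⊢
    by_cases h1 : i < j
    · simp only [h1, if_true]
      rw [hg _ _ fun t ht => face_face h1 (by omega) ht x, ← add_smul]
      obtain ⟨j, rfl⟩ : ∃ k, j = k + 1 := ⟨j - 1, by omega⟩
      simp only [Nat.add_sub_cancel, add_comm i j]
      rw [show j + 1 + i = j + i + 1 by ring, pow_succ]; simp
    · simp only [h1, if_false]
      rw [hg _ (face (n + 1) i (face (n + 1 + 1) j x)) fun t ht =>
        face_face (i := j) (j := i + 1) (by omega) (by omega) ht x, ← add_smul]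
      rw [show i + 1 + j = j + i + 1 by ring, pow_succ]; simp
  · rintro ⟨j, i⟩ h _
    split_ifs with h1 <;> simp only [ne_eq, Prod.mk.injEq] <;> omega
  · rintro ⟨j, i⟩ h
    simp only [Finset.mem_product, Finset.mem_range] at h ⊢
    split_ifs <;> simp only <;> omega
  · rintro ⟨j, i⟩ h
    by_cases h1 : i < j
    · have h2 : ¬ (j - 1 < i) := by omega
      simp only [h1, h2, if_true, if_false]; congr; omega
    · have h2 : j < i + 1 := by omega
      simp only [h1, h2, if_true, if_false]; congr

/-- The first face removes the unit and the last one removes it while rotating the word. With $s$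
the insertion of $e$, $t$ the signed rotation and $b'$ the boundary without the cyclic face, this is
$bs=1-t-sb'$. -/
theorem bF_ins {n : ℕ} {g : (ℕ → U) → M} (hg : IsLocal n g) (z : ℕ → U) :
    bF n g (ins z) = g z - ∑ m ∈ Finset.range n, (-1 : ℤ) ^ m • g (ins (merge (· * ·) m z))
      - (-1 : ℤ) ^ n • g (rot n 1 z) := by
  rw [bF, Finset.sum_range_succ, Finset.sum_range_succ', face_ins_zero,
    hg _ _ fun i _ => face_ins_last z]
  have : ∀ m ∈ Finset.range n, (-1 : ℤ) ^ (m + 1) • g (face (n + 1) (m + 1) (ins z)) =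
      - ((-1 : ℤ) ^ m • g (ins (merge (· * ·) m z))) := fun m hm => by
    rw [face_ins_succ (Finset.mem_range.1 hm), pow_succ]; simp
  rw [Finset.sum_congr rfl this, Finset.sum_neg_distrib, pow_succ]
  simp only [pow_zero, one_smul, mul_neg, mul_one, neg_smul]
  abel

/-- This is $(1+t+\dots+t^{c-1})(1-t)=1-t^c$ for the signed rotation $t$. The full turn gives
$[b,B]=0$; partial turns enter `sum_outer`. -/
theorem sum_rot_telescope {n : ℕ} {g : (ℕ → U) → M} (hg : IsLocal n g) (y : ℕ → U) {c : ℕ}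
    (hc : c ≤ n + 1) :
    ∑ j ∈ Finset.range c, (-1 : ℤ) ^ (j * n) • (g (rot n j y) - (-1 : ℤ) ^ n • g (rot n 1 (rot n j y)))
      = g y - (-1 : ℤ) ^ (c * n) • g (rot n c y) := by
  have : ∀ j ∈ Finset.range c, (-1 : ℤ) ^ (j * n) •
      (g (rot n j y) - (-1 : ℤ) ^ n • g (rot n 1 (rot n j y))) =
      (-1 : ℤ) ^ (j * n) • g (rot n j y) - (-1 : ℤ) ^ ((j + 1) * n) • g (rot n (j + 1) y) := by
    intro j hj
    have := Finset.mem_range.1 hj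
    rw [hg _ _ fun i _ => rot_one_rot (by omega) y, smul_sub, smul_smul, ← pow_add]
    congr 4; ring
  rw [Finset.sum_congr rfl this, Finset.sum_range_sub']
  simp [rot_zero]

theorem BF_bF_zero {g : (ℕ → U) → M} (hg : IsLocal 0 g) (x : ℕ → U) : BF 0 (bF 0 g) x = 0 := by
  simp only [BF, zero_add, Finset.sum_range_one, mul_zero, pow_zero, one_smul, bF_ins hg, rot_zero,
    Finset.range_zero, Finset.sum_empty, sub_zero]
  rw [hg _ _ fun i hi => rot_full hi x, sub_self]

/-- The sums over the faces of a rotated word and over the rotations of a face agree. -/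
theorem sum_rot_face {n : ℕ} {h : ℕ → (ℕ → U) → M} (hh : ∀ j, IsLocal n (h j)) (x : ℕ → U) :
    ∑ k ∈ Finset.range (n + 2), (-1 : ℤ) ^ k • ∑ j ∈ Finset.range (n + 1), (-1 : ℤ) ^ (j * n) •
        h j (rot n j (face (n + 1) k x)) =
      ∑ j ∈ Finset.range (n + 2), (-1 : ℤ) ^ (j * (n + 1)) • ∑ m ∈ Finset.range (n + 1),
        (-1 : ℤ) ^ m • h (if m < j then j - 1 else j) (merge (· * ·) m (rot (n + 1) j x)) := by
  simp only [Finset.smul_sum, smul_smul, ← pow_add]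
  rw [sum_face_rot]
  refine Finset.sum_congr rfl fun j hj => Finset.sum_congr rfl fun m hm => ?_
  rw [Finset.mem_range] at hj hm
  split_ifs with h1
  · rw [hh _ _ _ fun i hi => merge_rot_of_lt h1 (by omega) hi x]
    congr 1
    obtain ⟨j, rfl⟩ : ∃ i, j = i + 1 := ⟨j - 1, by omega⟩
    obtain ⟨c, rfl⟩ : ∃ c, n = j + c := ⟨n - j, by omega⟩
    -- The two exponents differ by twice the number `j` that remains after the substitution above,
    -- so the rotation signs absorb the change of the face index.
    refine (neg_one_pow_congr' j ?_).symm
    rw [show j + c + 2 - (j + 1) = c + 1 by omega, Nat.add_sub_cancel]; ring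
  · rw [hh _ _ _ fun i hi => merge_rot_of_le (n := n) (by omega) (by omega) x]
    congr 1
    obtain ⟨c, rfl⟩ : ∃ c, m = j + c := ⟨m - j, by omega⟩
    refine (neg_one_pow_congr' j ?_).symm
    rw [Nat.add_sub_cancel_left]; ring

/-- By `sum_rot_face` the terms $sb'$ of $bB$ cancel against $Bb$. What remains is the sum of $1-t$
over a full turn. -/
theorem BF_bF_add_bF_BF {n : ℕ} {g : (ℕ → U) → M} (hg : IsLocal (n + 1) g) (x : ℕ → U) :
    BF (n + 1) (bF (n + 1) g) x + bF n (BF n g) x = 0 := by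
  have h := sum_rot_face (fun _ => hg.comp_ins) x
  simp only [bF, BF] at h ⊢
  rw [h]
  have e : ∀ z : ℕ → U, ∑ k ∈ Finset.range (n + 1 + 2), (-1 : ℤ) ^ k • g (face (n + 1 + 1) k (ins z))
    = _ := fun z => bF_ins hg z
  simp only [e]
  rw [← Finset.sum_add_distrib]
  have t := sum_rot_telescope hg x (c := n + 2) (by omega)
  -- The signed rotation of `n + 2` letters has order dividing `n + 2`: a product of consecutive
  -- integers is even.
  have s : (-1 : ℤ) ^ ((n + 2) * (n + 1)) = 1 := by
    rw [mul_comm]; exact (Nat.even_mul_succ_self (n + 1)).neg_one_pow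
  rw [hg _ _ fun i hi => rot_full hi x, s, one_smul, sub_self] at t
  rw [← t]
  refine Finset.sum_congr rfl fun j _ => ?_
  rw [← smul_add]; congr 1; abel

/-- The faces of the word that do not involve both $a_1$ and one of its neighbours commute with the
contraction up to a shift of the index, hence cancel. The three remaining terms have first letters
$a_0D(a_1)a_2$, $a_0a_1D(a_2)$ and $-a_0D(a_1a_2)$. -/
theorem iotaD_bF_add {n : ℕ} {g : (ℕ → U) → M} (hg : IsLocal n g) (hg0 : AddAt 0 g) (D : U → U)
    (x : ℕ → U) :
    iotaD D (bF n g) x + bF (n + 1) (iotaD D g) x = - iotaE (cobd D) g x := by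
  have e : ∀ k, k ≤ n → (-1 : ℤ) ^ (k + 1 + 1) • iotaD D g (face (n + 1 + 1) (k + 1 + 1) x) =
      - ((-1 : ℤ) ^ (k + 1) • g (face (n + 1) (k + 1) (merge (· * ·) 0 (app D 1 x)))) := by
    intro k hk
    rw [pow_succ, mul_neg, mul_one, neg_smul, iotaD]
    congr 2
    refine hg _ _ fun i hi => ?_
    rcases hk.lt_or_eq with h | rfl
    · have h1 : k + 1 < n + 1 := by omega
      have h2 : k + 1 + 1 < n + 1 + 1 := by omega
      simp only [face, h1, h2, if_true, merge, app, Function.update_apply]; grind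
    · simp only [face, lt_irrefl, if_false, merge, app, Function.update_apply]; grind
  rw [iotaD, bF, bF, Finset.sum_range_succ' _ (n + 2), Finset.sum_range_succ' _ (n + 1),
    Finset.sum_range_succ' _ (n + 1),
    Finset.sum_congr rfl fun k hk => e k (Nat.lt_succ_iff.1 (Finset.mem_range.1 hk)),
    Finset.sum_neg_distrib, iotaE, neg_neg]
  simp only [zero_add, pow_zero, one_smul, pow_one, neg_smul, iotaD]
  -- The remaining words share the letters after the first, so additivity at place `0` combines
  -- them.
  have c : ∀ y w : _, (∀ i, i ≠ 0 → y i = x (i + 2)) → y 0 = w →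
      y = Function.update (fun i => x (i + 2)) 0 w := fun y w h1 h2 => by
    funext i
    rw [Function.update_apply]
    split_ifs with hi
    · rw [hi, h2]
    · exact h1 i hi
  rw [c (merge (· * ·) 0 (merge (cobd D) 1 x))
      (x 0 * D (x 1) * x 2 + x 0 * x 1 * D (x 2) - x 0 * D (x 1 * x 2)),
    hg0.map_sub, hg0, ← c (face (n + 1) 0 (merge (· * ·) 0 (app D 1 x))),
    ← c (merge (· * ·) 0 (app D 1 (face (n + 1 + 1) 0 x))),
    ← c (merge (· * ·) 0 (app D 1 (face (n + 1 + 1) 1 x)))]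
  · abel
  all_goals try intro i hi
  all_goals simp [face, merge, app, cobd, Function.update_apply]
  all_goals grind

/-- Here `j` is the place of $a_0$, and `D` runs over the letters to the right of it. Merging two
letters to the left of $a_0$, or $a_0$ with its left neighbour, only shifts the range. Merging $a_0$
with its right neighbour leaves a term in which `D` hits the right factor alone. Merging two letters
further right gives two terms where the merged word has one, and the difference is the coboundary.
-/
theorem sum_merge_app {N m j : ℕ} {h : (ℕ → U) → M} (ha : AddAt m h) (hm : m < N + 1)
    (D : U → U) (z : ℕ → U) :
    ∑ p ∈ Finset.Ico (j + 1) (N + 2), h (merge (· * ·) m (app D p z)) =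
      ∑ p ∈ Finset.Ico ((if m < j then j - 1 else j) + 1) (N + 1), h (app D p (merge (· * ·) m z)) +
      (if m < j then 0 else if m = j then h (merge (· * ·) j (app D (j + 1) z))
        else h (merge (cobd D) m z)) := by
  have shift : ∀ c, m + 1 ≤ c → ∑ p ∈ Finset.Ico (c + 1) (N + 2), h (merge (· * ·) m (app D p z)) =
      ∑ p ∈ Finset.Ico c (N + 1), h (app D p (merge (· * ·) m z)) := fun c hc => by
    rw [← Finset.sum_Ico_add' (fun p => h (merge (· * ·) m (app D p z))) c (N + 1) 1]
    refine Finset.sum_congr rfl fun p hp => ?_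
    rw [Finset.mem_Ico] at hp
    rw [merge_app_of_gt D _ (by omega), Nat.add_sub_cancel]
  rcases lt_trichotomy m j with h1 | h1 | h1
  · simp only [h1, if_true, add_zero]
    rw [Nat.sub_add_cancel (by omega), shift j (by omega)]
  · subst h1
    simp only [lt_irrefl, if_true, if_false]
    rw [Finset.sum_eq_sum_Ico_succ_bot (by omega), shift _ le_rfl, add_comm]
  · have h2 : ¬ m < j := by omega
    have h3 : m ≠ j := by omega
    simp only [h2, h3, if_false]
    rw [← Finset.sum_Ico_consecutive _ (show j + 1 ≤ m by omega) (show m ≤ N + 2 by omega),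
      ← Finset.sum_Ico_consecutive _ (show j + 1 ≤ m by omega) (show m ≤ N + 1 by omega),
      Finset.sum_eq_sum_Ico_succ_bot (show m < N + 2 by omega),
      Finset.sum_eq_sum_Ico_succ_bot (show m + 1 < N + 2 by omega),
      Finset.sum_eq_sum_Ico_succ_bot (show m < N + 1 by omega), shift _ le_rfl, merge_cobd ha]
    have : ∑ p ∈ Finset.Ico (j + 1) m, h (merge (· * ·) m (app D p z)) =
        ∑ p ∈ Finset.Ico (j + 1) m, h (app D p (merge (· * ·) m z)) :=
      Finset.sum_congr rfl fun p hp => by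
        rw [merge_app_of_lt D _ (Finset.mem_Ico.1 hp).2]
    rw [this]; abel

theorem merge_zero_app_ins (D : U → U) (z : ℕ → U) :
    merge (· * ·) 0 (app D 1 (ins z)) = app D 0 z := by
  funext i
  simp only [merge, app, ins, Function.update_apply]; grind

/-- The part of the homotopy formula in which the unit is removed. -/
theorem sum_outer {n : ℕ} {g : (ℕ → U) → M} (hg : IsLocal n g) (D : U → U) (x : ℕ → U) :
    ∑ j ∈ Finset.range (n + 1), ∑ p ∈ Finset.Ico (j + 1) (n + 1), (-1 : ℤ) ^ (j * n) •
      (g (app D p (rot n j x)) - (-1 : ℤ) ^ n • g (rot n 1 (app D p (rot n j x)))) +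
      BF n (iotaD D g) x = lieF D n g x := by
  rw [sum_range_Ico_diag]
  -- For a fixed letter $a_i$ the admissible rotations stop just before $a_i$ would come to the
  -- front. The telescope runs from the unrotated word to the word that begins with $D(a_i)$.
  have h1 : ∀ i ∈ Finset.Ico 1 (n + 1), ∑ j ∈ Finset.range (n + 1 - i), (-1 : ℤ) ^ (j * n) •
      (g (app D (i + j) (rot n j x)) - (-1 : ℤ) ^ n • g (rot n 1 (app D (i + j) (rot n j x)))) =
      g (app D i x) - (-1 : ℤ) ^ ((n + 1 - i) * n) • g (app D 0 (rot n (n + 1 - i) x)) := by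
    intro i hi
    rw [Finset.mem_Ico] at hi
    rw [← hg _ _ fun k hk => app_zero_rot (n := n) (j := n + 1 - i) (i := i) D (by omega) hk
      (by omega) x, ← sum_rot_telescope hg (app D i x) (by omega)]
    refine Finset.sum_congr rfl fun j hj => ?_
    rw [Finset.mem_range] at hj
    rw [← rot_app (n := n) (j := j) (i := i) D (by omega)]
  rw [Finset.sum_congr rfl h1, Finset.sum_sub_distrib]
  -- Contracting $(e,a_i,\dots)$ yields $(D(a_i),\dots)$. These terms cancel the ends of the
  -- telescopes, except for $i=0$, which supplies the term $D(a_0)$ of $L_D$.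
  have h2 : BF n (iotaD D g) x = g (app D 0 x) + ∑ i ∈ Finset.Ico 1 (n + 1),
      (-1 : ℤ) ^ ((n + 1 - i) * n) • g (app D 0 (rot n (n + 1 - i) x)) := by
    simp only [BF, iotaD, merge_zero_app_ins]
    rw [Finset.range_eq_Ico, Finset.sum_eq_sum_Ico_succ_bot (by omega), rot_zero]
    congr 1
    · simp
    · refine Finset.sum_nbij' (fun j => n + 1 - j) (fun j => n + 1 - j) ?_ ?_ ?_ ?_ ?_
      all_goals intro a ha; simp only [Finset.mem_Ico] at ha ⊢
      any_goals omega
      rw [show n + 1 - (n + 1 - a) = a by omega]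
  rw [h2, lieF, Finset.range_eq_Ico, 
    Finset.sum_eq_sum_Ico_succ_bot (a := 0) (b := n + 1) (by omega)]
  abel

theorem homotopy_formula_zero {g : (ℕ → U) → M} (hg : IsLocal 0 g) (D : U → U) (x : ℕ → U) :
    BF 0 (iotaD D g) x = lieF D 0 g x := by
  rw [← sum_outer hg]; simp

theorem IsLocal.app {n : ℕ} {g : (ℕ → U) → M} (hg : IsLocal n g) (D : U → U) (p : ℕ) :
    IsLocal n (fun z => g (GaussManin.app D p z)) := fun x y hxy => hg _ _ fun i hi => by
  simp only [GaussManin.app, Function.update_apply]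
  split_ifs with h
  · rw [← h, hxy i hi]
  · exact hxy i hi

theorem IsLocal.sum {n : ℕ} {ι : Type*} {s : Finset ι} {g : ι → (ℕ → U) → M}
    (hg : ∀ i ∈ s, IsLocal n (g i)) : IsLocal n (fun x => ∑ i ∈ s, g i x) := fun x y hxy =>
  Finset.sum_congr rfl fun i hi => hg i hi x y hxy

/-- As operators this reads $bS_D+S_Db+B\iota_D+\iota_DB=L_D-S_{\delta D}$; composition is reversed
on functions of words. The $1-t$ part of $bS_D$ together with $\iota_DB$ is $L_D$ by `sum_outer`.
The merging part of $bS_D$ is compared with $S_Db$ by `sum_merge_app`: its exceptional terms are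
$B\iota_D$ (merging at $a_0$) and $S_{\delta D}$. No linearity of `D` is used, which is what allows
`D` to be a connection. -/
theorem homotopy_formula {n : ℕ} {g : (ℕ → U) → M} (hg : IsLocal (n + 1) g)
    (ha : ∀ k ≤ n + 1, AddAt k g) (D : U → U) (x : ℕ → U) :
    SD D (n + 1) (bF (n + 1) g) x + bF n (SD D n g) x + iotaD D (BF n g) x +
      BF (n + 1) (iotaD D g) x = lieF D (n + 1) g x - SE (cobd D) (n + 1) g x := by
  rw [← sum_outer hg, SD]
  have e1 : ∑ j ∈ Finset.range (n + 1 + 1), ∑ p ∈ Finset.Ico (j + 1) (n + 1 + 1),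
      (-1 : ℤ) ^ (j * (n + 1)) • bF (n + 1) g (ins (app D p (rot (n + 1) j x))) =
      ∑ j ∈ Finset.range (n + 1 + 1), ∑ p ∈ Finset.Ico (j + 1) (n + 1 + 1), (-1 : ℤ) ^ (j * (n + 1)) •
      (g (app D p (rot (n + 1) j x)) -
        (-1 : ℤ) ^ (n + 1) • g (rot (n + 1) 1 (app D p (rot (n + 1) j x)))) -
      ∑ j ∈ Finset.range (n + 2), (-1 : ℤ) ^ (j * (n + 1)) • ∑ m ∈ Finset.range (n + 1),
        (-1 : ℤ) ^ m • ∑ p ∈ Finset.Ico (j + 1) (n + 2),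
          g (ins (merge (· * ·) m (app D p (rot (n + 1) j x)))) := by
    rw [← Finset.sum_sub_distrib]
    refine Finset.sum_congr rfl fun j _ => ?_
    simp only [Finset.smul_sum (s := Finset.Ico _ _)]
    rw [Finset.sum_comm (s := Finset.range (n + 1)), Finset.smul_sum, ← Finset.sum_sub_distrib]
    refine Finset.sum_congr rfl fun p _ => ?_
    rw [bF_ins hg, ← smul_sub]; congr 1; abel
  have e2 : bF n (SD D n g) x = ∑ j ∈ Finset.range (n + 2), (-1 : ℤ) ^ (j * (n + 1)) •
      ∑ m ∈ Finset.range (n + 1), (-1 : ℤ) ^ m •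
        ∑ p ∈ Finset.Ico ((if m < j then j - 1 else j) + 1) (n + 1),
          g (ins (app D p (merge (· * ·) m (rot (n + 1) j x)))) := by
    rw [← sum_rot_face (h := fun j z => ∑ p ∈ Finset.Ico (j + 1) (n + 1), g (ins (app D p z)))
      (fun j => IsLocal.sum fun p _ => hg.comp_ins.app D p)]
    simp only [bF, SD, Finset.smul_sum]
  have e3 : ∑ j ∈ Finset.range (n + 2), (-1 : ℤ) ^ (j * (n + 1)) • ∑ m ∈ Finset.range (n + 1),
        (-1 : ℤ) ^ m • (if m < j then 0 else if m = j then
          g (ins (merge (· * ·) j (app D (j + 1) (rot (n + 1) j x))))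
        else g (ins (merge (cobd D) m (rot (n + 1) j x)))) =
      SE (cobd D) (n + 1) g x + iotaD D (BF n g) x := by
    rw [SE, iotaD, BF, ← Finset.sum_add_distrib, Finset.sum_range_succ]
    refine Eq.trans (congrArg₂ HAdd.hAdd (Finset.sum_congr rfl fun j hj => ?_) ?_) (add_zero _)
    swap
    -- For the last rotation, by `n + 1`, the letter $a_0$ is at the end, so every merging is to its
    -- left and there is no exceptional term.
    · rw [Finset.sum_eq_zero fun m hm => ?_, smul_zero]
      rw [if_pos (Finset.mem_range.1 hm), smul_zero]
    rw [Finset.mem_range] at hj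
    rw [Finset.range_eq_Ico, ← Finset.sum_Ico_consecutive _ (Nat.zero_le j) hj.le,
      Finset.sum_eq_sum_Ico_succ_bot hj]
    rw [Finset.sum_congr rfl (g := fun _ => (0 : M)) fun m hm => by
      rw [if_pos (Finset.mem_Ico.1 hm).2, smul_zero], Finset.sum_const_zero, zero_add,
      if_neg (lt_irrefl j), if_pos rfl, smul_add, add_comm, Finset.smul_sum, smul_smul, ← pow_add]
    congr 1
    · refine Finset.sum_congr rfl fun m hm => ?_
      rw [Finset.mem_Ico] at hm
      rw [if_neg (by omega), if_neg (by omega), smul_smul, ← pow_add, add_comm]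
    -- The term with $a_0D(a_1)$ merged after the rotation is the rotation of the contracted word.
    · have : rot n j (merge (· * ·) 0 (app D 1 x)) =
          merge (· * ·) j (app D (j + 1) (rot (n + 1) j x)) := by
        funext i
        rw [add_comm j 1, ← rot_app D (by omega), merge_rot_of_le le_rfl (by omega), Nat.sub_self,
          face, if_pos (by omega)]
      rw [this, neg_one_pow_congr' j (a := j * n)]
      ring
  have e4 := fun (j m : ℕ) (hm : m < n + 1) => sum_merge_app (j := j) (ha (m + 1) (by omega)).comp_ins
    hm D (rot (n + 1) j x)
  rw [e1, e2]
  rw [Finset.sum_congr (g := fun j => _) rfl fun j _ => congrArg _ <| Finset.sum_congr rfl fun m hm =>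
    congrArg _ (e4 j m (Finset.mem_range.1 hm))]
  simp only [smul_add, Finset.sum_add_distrib] at e3 ⊢
  rw [e3]
  abel

end WordIdentities

/-! ### Commutation of $L_D-I_{\delta D}$ with $b$ and $B$ on words. -/

section WordConsequences

variable {U M : Type*} [Ring U] [AddCommGroup M]

theorem IsLocal.comp_merge {n k : ℕ} {g : (ℕ → U) → M} (hg : IsLocal n g) (β : U → U → U)
    (hk : k ≤ n) : IsLocal (n + 1) (fun z => g (merge β k z)) :=
  fun x y hxy => hg _ _ fun i hi => by
    simp only [merge]
    rw [hxy i (by omega), hxy k (by omega), hxy (k + 1) (by omega), hxy (i + 1) (by omega)]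

theorem IsLocal.comp_rot {n j : ℕ} {g : (ℕ → U) → M} (hg : IsLocal n g) (hj : j ≤ n + 1) :
    IsLocal n (fun z => g (rot n j z)) :=
  fun x y hxy => hg _ _ fun i hi => by
    simp only [rot]
    split_ifs
    · exact hxy _ (by omega)
    · exact hxy _ (by omega)

theorem IsLocal.comp_face {n k : ℕ} {g : (ℕ → U) → M} (hg : IsLocal n g) :
    IsLocal (n + 1) (fun z => g (face (n + 1) k z)) := by
  unfold face
  split_ifs with h
  · exact hg.comp_merge _ (by omega)
  · exact fun x y hxy => hg _ _ fun i hi => by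
      rw [hxy _ le_rfl, hxy 0 (by omega), hxy i (by omega)]

theorem IsLocal.smul {n : ℕ} {g : (ℕ → U) → M} (hg : IsLocal n g) (c : ℤ) :
    IsLocal n (fun z => c • g z) := fun x y hxy => by simp only [hg x y hxy]

theorem IsLocal.bF {n : ℕ} {g : (ℕ → U) → M} (hg : IsLocal n g) : IsLocal (n + 1) (bF n g) :=
  IsLocal.sum fun _ _ => hg.comp_face.smul _

theorem IsLocal.BF {n : ℕ} {g : (ℕ → U) → M} (hg : IsLocal (n + 1) g) : IsLocal n (BF n g) :=
  IsLocal.sum fun _ hj => (hg.comp_ins.comp_rot (Finset.mem_range.1 hj).le).smul _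

theorem IsLocal.iotaD {n : ℕ} {g : (ℕ → U) → M} (hg : IsLocal n g) (D : U → U) :
    IsLocal (n + 1) (iotaD D g) :=
  (hg.comp_merge _ (Nat.zero_le n)).app D 1

theorem IsLocal.SD {n : ℕ} {g : (ℕ → U) → M} (hg : IsLocal (n + 1) g) (D : U → U) :
    IsLocal n (SD D n g) :=
  IsLocal.sum fun _ hj => IsLocal.sum fun p _ =>
    ((hg.comp_ins.app D p).comp_rot (Finset.mem_range.1 hj).le).smul _

theorem IsLocal.SE {n : ℕ} {g : (ℕ → U) → M} (hg : IsLocal n g) (E : U → U → U) :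
    IsLocal n (SE E n g) := by
  cases n with
  | zero => intro x y _; simp [GaussManin.SE]
  | succ n =>
    exact IsLocal.sum fun _ hj => IsLocal.sum fun m hm => ((hg.comp_ins.comp_merge E
      (Nat.lt_succ_iff.1 (Finset.mem_Ico.1 hm).2)).comp_rot
        ((Finset.mem_range.1 hj).le.trans (by omega))).smul _

theorem bF_add (n : ℕ) (g h : (ℕ → U) → M) (x : ℕ → U) :
    bF n (fun z => g z + h z) x = bF n g x + bF n h x := by
  simp only [bF, smul_add, Finset.sum_add_distrib]

theorem bF_neg (n : ℕ) (g : (ℕ → U) → M) (x : ℕ → U) :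
    bF n (fun z => - g z) x = - bF n g x := by
  simp only [bF, smul_neg, Finset.sum_neg_distrib]

theorem bF_sub (n : ℕ) (g h : (ℕ → U) → M) (x : ℕ → U) :
    bF n (fun z => g z - h z) x = bF n g x - bF n h x := by
  simp only [sub_eq_add_neg, bF_add, bF_neg]

theorem BF_add (n : ℕ) (g h : (ℕ → U) → M) (x : ℕ → U) :
    BF n (fun z => g z + h z) x = BF n g x + BF n h x := by
  simp only [BF, smul_add, Finset.sum_add_distrib]

theorem BF_neg (n : ℕ) (g : (ℕ → U) → M) (x : ℕ → U) :
    BF n (fun z => - g z) x = - BF n g x := by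
  simp only [BF, smul_neg, Finset.sum_neg_distrib]

theorem iotaD_bF_eq {n : ℕ} {g : (ℕ → U) → M} (hg : IsLocal n g) (hg0 : AddAt 0 g) (D : U → U) :
    iotaD D (bF n g) = fun x => - iotaE (cobd D) g x + - bF (n + 1) (iotaD D g) x := by
  funext x
  rw [← iotaD_bF_add hg hg0]; abel

/-- Since $\iota_{\delta D}=-[b,\iota_D]$ on words, this follows from $b^2=0$. -/
theorem iotaE_bF {n : ℕ} {g : (ℕ → U) → M} (hg : IsLocal n g) (hg0 : AddAt 0 g)
    (hb : AddAt 0 (bF n g)) (D : U → U) (x : ℕ → U) :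
    iotaE (cobd D) (bF n g) x = bF (n + 2) (iotaE (cobd D) g) x := by
  have h := iotaD_bF_add hg.bF hb D x
  have h0 : iotaD D (bF (n + 1) (bF n g)) x = 0 := bF_bF hg _
  rw [h0, zero_add, iotaD_bF_eq hg hg0, bF_add, bF_neg, bF_neg, bF_bF (hg.iotaD D), neg_zero,
    add_zero, neg_inj] at h
  exact h.symm

theorem SD_zero (D : U → U) (g : (ℕ → U) → M) (x : ℕ → U) : SD D 0 g x = 0 := by
  simp [SD]

theorem SE_zero (E : U → U → U) (g : (ℕ → U) → M) (x : ℕ → U) : SE E 0 g x = 0 := by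
  simp [SE]

theorem SD_eq_zero {n : ℕ} {g : (ℕ → U) → M} (h : ∀ x, g x = 0) (D : U → U) (x : ℕ → U) :
    SD D n g x = 0 := by
  simp [SD, h]

theorem bF_eq_zero {n : ℕ} {g : (ℕ → U) → M} (h : ∀ x, g x = 0) (x : ℕ → U) :
    bF n g x = 0 := by
  simp [bF, h]

theorem lieF_bF_zero {g : (ℕ → U) → M} (hg : IsLocal 0 g) (ha : AddAt 0 g)
    (hb : ∀ k ≤ 1, AddAt k (bF 0 g)) (D : U → U) (x : ℕ → U) :
    lieF D 1 (bF 0 g) x - SE (cobd D) 1 (bF 0 g) x =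
      bF 0 (lieF D 0 g) x - BF 1 (iotaE (cobd D) g) x := by
  have h1 := homotopy_formula hg.bF hb D x
  have e : lieF D 0 g = BF 0 (iotaD D g) := by
    funext y; exact (homotopy_formula_zero hg D y).symm
  have h3 := BF_bF_add_bF_BF (hg.iotaD D) x
  have h4 : iotaD D (BF 0 (bF 0 g)) x = 0 := BF_bF_zero hg _
  rw [SD_eq_zero (bF_bF hg), bF_eq_zero (SD_zero D _), h4, iotaD_bF_eq hg ha, BF_add, BF_neg, BF_neg]
    at h1
  rw [← h1, e, ← sub_eq_zero]
  have e4 : ∀ a d e : M, d + e = 0 → 0 + 0 + 0 + (-a + -d) - (e - a) = 0 := fun a d e h => by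
    rw [eq_neg_of_add_eq_zero_left h]; abel
  exact e4 _ _ _ h3

/-- The part of $[b+B,L_D-I_{\delta D}]=0$ that lowers the degree by one: $[b,L_D-S_{\delta
D}]=[B,\iota_{\delta D}]$. It results from inserting $L_D-S_{\delta D}=[b,S_D]+[B,\iota_D]$ and
using $b^2=0$, $bB+Bb=0$ and $[b,\iota_D]=-\iota_{\delta D}$. Nothing about `D` itself is assumed.
-/
theorem lieF_bF_succ {n : ℕ} {g : (ℕ → U) → M} (hg : IsLocal (n + 1) g)
    (ha : ∀ k ≤ n + 1, AddAt k g) (hb : ∀ k ≤ n + 2, AddAt k (bF (n + 1) g))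
    (hB : AddAt 0 (BF n g)) (D : U → U) (x : ℕ → U) :
    lieF D (n + 2) (bF (n + 1) g) x - SE (cobd D) (n + 2) (bF (n + 1) g) x
        - iotaE (cobd D) (BF n g) x =
      bF (n + 1) (lieF D (n + 1) g) x - bF (n + 1) (SE (cobd D) (n + 1) g) x
        - BF (n + 2) (iotaE (cobd D) g) x := by
  have h1 := homotopy_formula hg.bF hb D x
  have h2 : bF (n + 1) (fun y => lieF D (n + 1) g y - SE (cobd D) (n + 1) g y) x = _ :=
    congrArg (fun f => bF (n + 1) f x) (funext fun y => (homotopy_formula hg ha D y).symm)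
  rw [bF_add, bF_add, bF_add, bF_sub, bF_bF (hg.SD D)] at h2
  have e1 : iotaD D (BF (n + 1) (bF (n + 1) g)) x = - iotaD D (bF n (BF n g)) x :=
    eq_neg_of_add_eq_zero_left (BF_bF_add_bF_BF hg _)
  have e2 := iotaD_bF_add hg.BF hB D x
  have e3 := BF_bF_add_bF_BF (hg.iotaD D) x
  rw [SD_eq_zero (bF_bF hg), e1, iotaD_bF_eq hg (ha 0 (by omega)), BF_add, BF_neg, BF_neg] at h1
  rw [← h1, h2, ← sub_eq_zero]
  rw [eq_neg_iff_add_eq_zero] at e2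
  have e4 : ∀ a b c d e f i : M, a + b + c = 0 → d + e = 0 →
      0 + f + -a + (-i + -d) - c - (f + 0 + b + e - i) = 0 := fun a b c d e f i h h' => by
    rw [← neg_eq_zero, ← h, ← add_zero (a + b + c), ← h']; abel
  exact e4 _ _ _ _ _ _ _ e2 e3

theorem app_succ_ins (D : U → U) (i : ℕ) (z : ℕ → U) :
    app D (i + 1) (ins z) = ins (app D i z) := by
  funext k
  simp only [app, ins, Function.update_apply]; grind

theorem rot_app_of_lt {n j i k : ℕ} (D : U → U) (hj : j ≤ n + 1) (hk : k ≤ n)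
    (h : n < i + j) (hi : i ≤ n) (x : ℕ → U) :
    rot n j (app D i x) k = app D (i + j - (n + 1)) (rot n j x) k := by
  simp only [rot, app, Function.update_apply]; grind

/-- Rotating permutes the letters to which `D` is applied, and the inserted unit contributes nothing
because $D(e)=0$. -/
theorem lieF_BF {n : ℕ} {g : (ℕ → U) → M} (hg : IsLocal (n + 1) g) (ha : AddAt 0 g) (D : U → U)
    (hD : D 1 = 0) (x : ℕ → U) : lieF D n (BF n g) x = BF n (lieF D (n + 1) g) x := by
  have e : ∀ z : ℕ → U, lieF D (n + 1) g (ins z) = ∑ i ∈ Finset.range (n + 1), g (ins (app D i z)) :=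
    fun z => by
      rw [lieF, Finset.sum_range_succ', ha.map_zero, add_zero]
      · simp only [app_succ_ins]
      · simp [app, ins, hD]
  rw [lieF]
  simp only [BF, e, Finset.smul_sum]
  rw [Finset.sum_comm]
  refine Finset.sum_congr rfl fun j hj => ?_
  rw [Finset.mem_range] at hj
  refine Finset.sum_nbij' (fun i => if i + j ≤ n then i + j else i + j - (n + 1))
    (fun i => if j ≤ i then i - j else i + (n + 1) - j) ?_ ?_ ?_ ?_ ?_
  all_goals intro i hi; simp only [Finset.mem_range] at hi ⊢
  any_goals grind
  split_ifs with h
  · rw [rot_app D h]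
  · exact congrArg _ (hg.comp_ins _ _ fun k hk => rot_app_of_lt D hj.le hk (by omega) (by omega) x)

/-- The function `g` vanishes on words with a unit at one of the places `1, …, n`. -/
def IsNormalized (n : ℕ) (g : (ℕ → U) → M) : Prop :=
  ∀ x k, 1 ≤ k → k ≤ n → x k = 1 → g x = 0

theorem SE_BF {n : ℕ} {g : (ℕ → U) → M} (hg : IsNormalized (n + 1) g) (E : U → U → U) (x : ℕ → U) :
    SE E n (BF n g) x = 0 := by
  refine Finset.sum_eq_zero fun j _ => Finset.sum_eq_zero fun m _ => ?_
  rw [BF, Finset.sum_eq_zero fun i hi => ?_, smul_zero]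
  rw [Finset.mem_range] at hi
  -- The first unit is moved from place `0` to `i` by the rotation and to `i + 1` by the second
  -- insertion, so it is interior.
  rw [hg _ (i + 1) (by omega) (by omega) (by simp [ins, rot]), smul_zero]

theorem SD_BF {n : ℕ} {g : (ℕ → U) → M} (hg : IsNormalized (n + 2) g) (D : U → U) (x : ℕ → U) :
    SD D n (BF (n + 1) g) x = 0 := by
  refine Finset.sum_eq_zero fun j _ => Finset.sum_eq_zero fun m _ => ?_
  rw [BF, Finset.sum_eq_zero fun i hi => ?_, smul_zero]
  rw [Finset.mem_range] at hi
  rw [hg _ (i + 1) (by omega) (by omega) (by simp [ins, rot]), smul_zero]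

theorem BF_SE {n : ℕ} {g : (ℕ → U) → M} (hg : IsNormalized (n + 1) g) (E : U → U → U) (x : ℕ → U) :
    BF n (SE E (n + 1) g) x = 0 := by
  refine Finset.sum_eq_zero fun i _ => ?_
  rw [SE, Finset.sum_eq_zero fun j hj => Finset.sum_eq_zero fun m hm => ?_, smul_zero]
  rw [Finset.mem_range] at hj
  rw [Finset.mem_Ico] at hm
  beta_reduce
  -- The unit inserted by $B$ now plays the role of $a_0$: it is rotated to place `j`, the merging
  -- happens to its right, and the new insertion moves it to `j + 1`.
  rw [hg _ (j + 1) (by omega) (by omega), smul_zero]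
  simp only [ins, merge, rot]; grind

theorem BF_SD {n : ℕ} {g : (ℕ → U) → M} (hg : IsNormalized (n + 2) g) (D : U → U) (x : ℕ → U) :
    BF n (SD D (n + 1) g) x = 0 := by
  refine Finset.sum_eq_zero fun i _ => ?_
  rw [SD, Finset.sum_eq_zero fun j hj => Finset.sum_eq_zero fun m hm => ?_, smul_zero]
  rw [Finset.mem_range] at hj
  rw [Finset.mem_Ico] at hm
  beta_reduce
  rw [hg _ (j + 1) (by omega) (by omega), smul_zero]
  simp only [ins, app, rot, Function.update_apply]; grind

end WordConsequences

/-! ### Multilinear functions of words -/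

section Multilinear

variable {R : Type} {A : Type*} [CommRing R]
  [NonUnitalRing A] [Module R A] [IsScalarTower R A A] [SMulCommClass R A A]
variable {M : Type*} [AddCommGroup M] [Module R M]

local notation "U" => Unitization R A

/-- The function `g` of a word depends only on the letters `0, …, n`, and is multilinear over `R`
in these. -/
structure IsMultilin (n : ℕ) (g : (ℕ → U) → M) : Prop where
  isLocal : IsLocal n g
  add : ∀ k ≤ n, AddAt k g
  smul : ∀ k ≤ n, ∀ (x : ℕ → U) (r : R) (u : U),
    g (Function.update x k (r • u)) = r • g (Function.update x k u)

/-- Varying one letter of the argument varies one letter of the transformed word, through a linear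
map `L` that may depend on the other letters. -/
theorem IsMultilin.comp {n n' : ℕ} {g : (ℕ → U) → M} (hg : IsMultilin n g)
    {w : (ℕ → U) → ℕ → U} (hw : IsLocal n' fun x => g (w x))
    (h : ∀ k ≤ n', ∃ l ≤ n, ∀ x, ∃ L : U →ₗ[R] U, ∀ u, ∀ i ≤ n,
      w (Function.update x k u) i = Function.update (w x) l (L u) i) :
    IsMultilin n' fun x => g (w x) where
  isLocal := hw
  add k hk x u v := by
    obtain ⟨l, hl, H⟩ := h k hk
    obtain ⟨L, HL⟩ := H x
    simp only [hg.isLocal _ _ (HL _), map_add]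
    exact hg.add l hl _ _ _
  smul k hk x r u := by
    obtain ⟨l, hl, H⟩ := h k hk
    obtain ⟨L, HL⟩ := H x
    simp only [hg.isLocal _ _ (HL _), map_smul]
    exact hg.smul l hl _ _ _

theorem IsMultilin.comp_merge {n m : ℕ} {g : (ℕ → U) → M} (hg : IsMultilin n g)
    (β : U →ₗ[R] U →ₗ[R] U) (hm : m ≤ n) :
    IsMultilin (n + 1) fun x => g (merge (fun u v => β u v) m x) := by
  refine hg.comp (hg.isLocal.comp_merge _ hm) fun k hk => ?_
  rcases lt_trichotomy k m with h | h | h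
  · refine ⟨k, by omega, fun x => ⟨LinearMap.id, fun u i _ => ?_⟩⟩
    simp only [merge, Function.update_apply, LinearMap.id_apply]; grind
  · refine ⟨m, hm, fun x => ⟨β.flip (x (m + 1)), fun u i _ => ?_⟩⟩
    simp only [merge, Function.update_apply, LinearMap.flip_apply]; grind
  · rcases (Nat.succ_le_of_lt h).eq_or_lt with h' | h'
    · refine ⟨m, hm, fun x => ⟨β (x m), fun u i _ => ?_⟩⟩
      simp only [merge, Function.update_apply]; grind
    · refine ⟨k - 1, by omega, fun x => ⟨LinearMap.id, fun u i _ => ?_⟩⟩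
      simp only [merge, Function.update_apply, LinearMap.id_apply]; grind

theorem IsMultilin.comp_app {n : ℕ} {g : (ℕ → U) → M} (hg : IsMultilin n g)
    (D : U →ₗ[R] U) (p : ℕ) : IsMultilin n fun x => g (app D p x) := by
  refine hg.comp (hg.isLocal.app _ p) fun k hk => ?_
  by_cases h : k = p
  · refine ⟨k, hk, fun x => ⟨D, fun u i _ => ?_⟩⟩
    simp only [app, Function.update_apply]; grind
  · refine ⟨k, hk, fun x => ⟨LinearMap.id, fun u i _ => ?_⟩⟩
    simp only [app, Function.update_apply, LinearMap.id_apply]; grind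

theorem IsMultilin.comp_rot {n j : ℕ} {g : (ℕ → U) → M} (hg : IsMultilin n g) (hj : j ≤ n + 1) :
    IsMultilin n fun x => g (rot n j x) := by
  refine hg.comp (hg.isLocal.comp_rot hj) fun k hk => ?_
  refine ⟨if k + j ≤ n then k + j else k + j - (n + 1), by split_ifs <;> omega,
    fun x => ⟨LinearMap.id, fun u i hi => ?_⟩⟩
  simp only [rot, Function.update_apply, LinearMap.id_apply]; grind

theorem IsMultilin.comp_ins {n : ℕ} {g : (ℕ → U) → M} (hg : IsMultilin (n + 1) g) :
    IsMultilin n fun x => g (ins x) := by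
  refine hg.comp hg.isLocal.comp_ins fun k hk => ?_
  refine ⟨k + 1, by omega, fun x => ⟨LinearMap.id, fun u i hi => ?_⟩⟩
  simp only [ins, Function.update_apply, LinearMap.id_apply]; grind

theorem IsMultilin.comp_face {n k : ℕ} {g : (ℕ → U) → M} (hg : IsMultilin n g) :
    IsMultilin (n + 1) fun x => g (face (n + 1) k x) := by
  by_cases h : k < n + 1
  · simp only [face, h, if_true]
    exact hg.comp_merge (LinearMap.mul R U) (Nat.lt_succ_iff.1 h)
  · refine hg.comp hg.isLocal.comp_face fun k hk => ?_
    simp only [face, h, if_false]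
    rcases Nat.eq_zero_or_pos k with h0 | h0
    · refine ⟨0, by omega, fun x => ⟨LinearMap.mul R U (x (n + 1)), fun u i _ => ?_⟩⟩
      simp only [Function.update_apply, LinearMap.mul_apply']; grind
    · rcases hk.eq_or_lt with h' | h'
      · refine ⟨0, by omega, fun x => ⟨(LinearMap.mul R U).flip (x 0), fun u i _ => ?_⟩⟩
        simp only [Function.update_apply, LinearMap.mul_apply', LinearMap.flip_apply]; grind
      · refine ⟨k, by omega, fun x => ⟨LinearMap.id, fun u i _ => ?_⟩⟩
        simp only [Function.update_apply, LinearMap.id_apply]; grind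

theorem AddAt.sum {k : ℕ} {ι : Type*} {s : Finset ι} {g : ι → (ℕ → U) → M}
    (hg : ∀ i ∈ s, AddAt k (g i)) : AddAt k (fun x => ∑ i ∈ s, g i x) := fun x u v => by
  rw [← Finset.sum_add_distrib]
  exact Finset.sum_congr rfl fun i hi => hg i hi x u v

theorem IsMultilin.sum {n : ℕ} {ι : Type*} {s : Finset ι} {g : ι → (ℕ → U) → M}
    (hg : ∀ i ∈ s, IsMultilin n (g i)) : IsMultilin n (fun x => ∑ i ∈ s, g i x) where
  isLocal := IsLocal.sum fun i hi => (hg i hi).isLocal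
  add k hk := AddAt.sum fun i hi => (hg i hi).add k hk
  smul k hk x r u := by
    rw [Finset.smul_sum]
    exact Finset.sum_congr rfl fun i hi => (hg i hi).smul k hk x r u

theorem IsMultilin.zsmul {n : ℕ} {g : (ℕ → U) → M} (hg : IsMultilin n g) (c : ℤ) :
    IsMultilin n (fun x => c • g x) where
  isLocal := hg.isLocal.smul c
  add k hk x u v := by simp only [hg.add k hk x u v, smul_add]
  smul k hk x r u := by simp only [hg.smul k hk x r u, smul_comm c r]

theorem IsMultilin.neg {n : ℕ} {g : (ℕ → U) → M} (hg : IsMultilin n g) :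
    IsMultilin n (fun x => - g x) := by
  simpa using hg.zsmul (-1)

theorem IsMultilin.bF {n : ℕ} {g : (ℕ → U) → M} (hg : IsMultilin n g) :
    IsMultilin (n + 1) (bF n g) :=
  IsMultilin.sum fun _ _ => hg.comp_face.zsmul _

theorem IsMultilin.BF {n : ℕ} {g : (ℕ → U) → M} (hg : IsMultilin (n + 1) g) :
    IsMultilin n (BF n g) :=
  IsMultilin.sum fun _ hj => (hg.comp_ins.comp_rot (Finset.mem_range.1 hj).le).zsmul _

theorem IsMultilin.iotaD {n : ℕ} {g : (ℕ → U) → M} (hg : IsMultilin n g) (D : U →ₗ[R] U) :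
    IsMultilin (n + 1) (iotaD D g) :=
  (hg.comp_merge (LinearMap.mul R U) (Nat.zero_le n)).comp_app D 1

theorem IsMultilin.SD {n : ℕ} {g : (ℕ → U) → M} (hg : IsMultilin (n + 1) g) (D : U →ₗ[R] U) :
    IsMultilin n (SD D n g) :=
  IsMultilin.sum fun _ hj => IsMultilin.sum fun p _ =>
    ((hg.comp_ins.comp_app D p).comp_rot (Finset.mem_range.1 hj).le).zsmul _

theorem IsMultilin.iotaE {n : ℕ} {g : (ℕ → U) → M} (hg : IsMultilin n g)
    (E : U →ₗ[R] U →ₗ[R] U) : IsMultilin (n + 2) (iotaE (fun u v => E u v) g) :=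
  ((hg.comp_merge (LinearMap.mul R U) (Nat.zero_le n)).comp_merge E (by omega)).neg

theorem IsMultilin.SE {n : ℕ} {g : (ℕ → U) → M} (hg : IsMultilin n g)
    (E : U →ₗ[R] U →ₗ[R] U) : IsMultilin n (SE (fun u v => E u v) n g) := by
  cases n with
  | zero =>
    refine ⟨hg.isLocal.SE _, fun k _ x u v => ?_, fun k _ x r u => ?_⟩ <;> simp [GaussManin.SE]
  | succ n =>
    exact IsMultilin.sum fun _ hj => IsMultilin.sum fun m hm => ((hg.comp_ins.comp_merge E
      (Nat.lt_succ_iff.1 (Finset.mem_Ico.1 hm).2)).comp_rot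
        ((Finset.mem_range.1 hj).le.trans (by omega))).zsmul _

/-- The function `g` of a word depends only on the letter `0` and on the classes modulo `R e` of the
letters `1, …, n`; if `n = 0`, only on the class of the letter `0`. -/
def Descends {V : Type*} (n : ℕ) (g : (ℕ → U) → V) : Prop :=
  ∀ x y, (n ≠ 0 → x 0 = y 0) → (∀ i ≤ n, (x i).snd = (y i).snd) → g x = g y

theorem Descends.isLocal {V : Type*} {n : ℕ} {g : (ℕ → U) → V} (hg : Descends n g) : IsLocal n g :=
  fun x y h => hg x y (fun _ => h 0 (Nat.zero_le n)) fun i hi => by rw [h i hi]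

theorem Descends.eq_zero {n k : ℕ} {g : (ℕ → U) → M} (hg : Descends n g) (ha : AddAt k g)
    (hk : 1 ≤ k) {x : ℕ → U} (hx : (x k).snd = 0) : g x = 0 := by
  rw [hg x (Function.update x k 0), ha.map_zero (Function.update_self _ _ _)]
  · intro _
    rw [Function.update_of_ne (by omega)]
  · intro i _
    rw [Function.update_apply]
    split_ifs with h
    · rw [h, hx]; rfl
    · rfl

theorem Descends.isNormalized {n : ℕ} {g : (ℕ → U) → M} (hg : Descends n g)
    (ha : ∀ k ≤ n, AddAt k g) : IsNormalized n g := fun _ k hk hkn hx =>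
  hg.eq_zero (ha k hkn) hk (by rw [hx]; rfl)

theorem Descends.sum {n : ℕ} {ι : Type*} {s : Finset ι} {g : ι → (ℕ → U) → M}
    (hg : ∀ i ∈ s, Descends n (g i)) : Descends n (fun x => ∑ i ∈ s, g i x) := fun x y h h' =>
  Finset.sum_congr rfl fun i hi => hg i hi x y h h'

theorem Descends.zsmul {n : ℕ} {g : (ℕ → U) → M} (hg : Descends n g) (c : ℤ) :
    Descends n (fun x => c • g x) := fun x y h₁ h₂ => by simp only [hg x y h₁ h₂]

/-- Remove the letter `k` of a word. -/
def del (k : ℕ) (x : ℕ → U) : ℕ → U := fun i => if i < k then x i else x (i + 1)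

/-- The two faces that absorb the scalar at place `k` both give `r` times the word with this letter
deleted, with opposite signs. Every other face keeps the scalar at an interior place, where `g`
vanishes. -/
theorem bF_eq_zero_of_scalar {n k : ℕ} {g : (ℕ → U) → M} (hg : Descends n g)
    (hm : IsMultilin n g) (hk : 1 ≤ k) (hkn : k ≤ n + 1) {x : ℕ → U} {r : R}
    (hx : x k = Unitization.inl r) : bF n g x = 0 := by
  have hr : ∀ u : U, Unitization.inl r * u = r • u := fun u => by
    rw [← Unitization.algebraMap_eq_inl, ← Algebra.smul_def]
  have hr' : ∀ u : U, u * Unitization.inl r = r • u := fun u => by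
    rw [← Unitization.algebraMap_eq_inl, ← Algebra.commutes, ← Algebra.smul_def]
  have h1 : g (face (n + 1) (k - 1) x) = r • g (del k x) := by
    have : face (n + 1) (k - 1) x = Function.update (del k x) (k - 1) (r • x (k - 1)) := by
      funext i
      have : k - 1 < n + 1 := by omega
      simp only [face, this, if_true, merge, del, Function.update_apply]
      rw [show k - 1 + 1 = k by omega, hx, hr']
      grind
    rw [this, hm.smul _ (by omega)]
    congr 2
    funext i
    simp only [del, Function.update_apply]; grind
  have h2 : g (face (n + 1) k x) = r • g (del k x) := by
    rcases hkn.eq_or_lt with rfl | h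
    · have : ∀ i ≤ n, face (n + 1) (n + 1) x i =
          Function.update (del (n + 1) x) 0 (r • x 0) i := by
        intro i hi
        simp only [face, lt_irrefl, if_false, del, Function.update_apply, hx, hr]
        grind
      rw [hm.isLocal _ _ this, hm.smul _ (by omega)]
      congr 2
      funext i
      simp only [del, Function.update_apply]; grind
    · have : face (n + 1) k x = Function.update (del k x) k (r • x (k + 1)) := by
        funext i
        simp only [face, h, if_true, merge, del, Function.update_apply, hx, hr]
        grind
      rw [this, hm.smul _ (by omega)]
      congr 2
      funext i
      simp only [del, Function.update_apply]; grind
  have h3 : ∀ j, j ≤ n + 1 → j ≠ k - 1 → j ≠ k → g (face (n + 1) j x) = 0 := by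
    intro j hj hj1 hj2
    rcases lt_or_gt_of_ne hj2 with h | h
    · refine hg.eq_zero (k := k - 1) (hm.add _ (by omega)) (by omega) ?_
      have h4 : j < n + 1 := by omega
      have h5 : ¬ k - 1 < j := by omega
      have h6 : ¬ k - 1 = j := by omega
      simp only [face, h4, if_true, merge, h5, h6, if_false]
      rw [show k - 1 + 1 = k by omega, hx]; rfl
    · refine hg.eq_zero (k := k) (hm.add _ (by omega)) (by omega) ?_
      have h5 : face (n + 1) j x k = x k := by
        unfold face
        split_ifs
        · exact if_pos h
        · exact if_neg (by omega)
      rw [h5, hx]; rfl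
  rw [bF, ← Finset.sum_subset (s₁ := {k - 1, k})]
  · rw [Finset.sum_pair (by omega), h1, h2]
    obtain ⟨k, rfl⟩ : ∃ l, k = l + 1 := ⟨k - 1, by omega⟩
    rw [Nat.add_sub_cancel, pow_succ, mul_neg, mul_one, neg_smul, add_neg_cancel]
  · intro j hj
    simp only [Finset.mem_insert, Finset.mem_singleton, Finset.mem_range] at hj ⊢
    omega
  · intro j hj hj'
    simp only [Finset.mem_insert, Finset.mem_singleton, Finset.mem_range, not_or] at hj hj'
    rw [h3 j (by omega) hj'.1 hj'.2, smul_zero]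

/-- Not formal, since the faces multiply interior letters in $A_+$. The interior letters are
exchanged one at a time, and each exchange changes the value by that of a word with a scalar at an
interior place. -/
theorem Descends.bF {n : ℕ} {g : (ℕ → U) → M} (hg : Descends n g) (hm : IsMultilin n g) :
    Descends (n + 1) (bF n g) := by
  intro x y h0 h
  have h0 : x 0 = y 0 := h0 (by omega)
  have key : ∀ j ≤ n + 1, GaussManin.bF n g x =
      GaussManin.bF n g (fun i => if i ≤ j then y i else x i) := by
    intro j
    induction j with
    | zero =>
      intro _
      congr 1
      funext i
      split_ifs with hi
      · rw [Nat.le_zero.1 hi, h0]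
      · rfl
    | succ j ih =>
      intro hj
      rw [ih (by omega)]
      set z : ℕ → U := fun i => if i ≤ j then y i else x i with hz
      have e1 : z = Function.update z (j + 1) (x (j + 1)) := by
        funext i; rw [Function.update_apply]; split_ifs with hi
        · simp [hz, hi]
        · rfl
      have e2 : (fun i => if i ≤ j + 1 then y i else x i) = Function.update z (j + 1) (y (j + 1)) := by
        funext i; rw [Function.update_apply]; split_ifs with h1 h2 h2
        · rw [h2]
        · simp only [hz]; rw [if_pos (by omega)]
        · omega
        · simp only [hz]; rw [if_neg (by omega)]
      rw [e2, e1, Function.update_idem, ← sub_eq_zero, ← (hm.bF.add (j + 1) hj).map_sub]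
      refine bF_eq_zero_of_scalar hg hm (k := j + 1) (r := (x (j + 1)).fst - (y (j + 1)).fst)
        (by omega) hj ?_
      rw [Function.update_self]
      rw [sub_eq_add_neg, sub_eq_add_neg]
      ext
      · simp
      · simp [h (j + 1) hj]
  rw [key (n + 1) le_rfl]
  exact hm.bF.isLocal _ _ fun i hi => if_pos hi

/-- With the unit in front, all other letters are interior and only their classes matter. This also
accounts for the conventions $B(e,\dots)=0$ and $S_E(e,\dots)=0$. -/
theorem descends_ins {V : Type*} {n : ℕ} {g : (ℕ → U) → V} (hg : Descends (n + 1) g)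
    {w : (ℕ → U) → ℕ → U}
    (hw : ∀ x y, (∀ i ≤ n, (x i).snd = (y i).snd) → ∀ i ≤ n, (w x i).snd = (w y i).snd) :
    Descends n fun x => g (ins (w x)) := fun x y _ h => hg _ _ (fun _ => rfl) fun i hi => by
  simp only [ins]
  split_ifs
  · rfl
  · exact hw x y h _ (by omega)

theorem rot_snd_congr {n j : ℕ} (hj : j ≤ n + 1) {x y : ℕ → U}
    (h : ∀ i ≤ n, (x i).snd = (y i).snd) : ∀ i ≤ n, (rot n j x i).snd = (rot n j y i).snd := by
  intro i hi
  simp only [rot]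
  split_ifs
  · exact h _ (by omega)
  · exact h _ (by omega)

theorem Descends.BF {n : ℕ} {g : (ℕ → U) → M} (hg : Descends (n + 1) g) : Descends n (BF n g) :=
  Descends.sum fun _ hj => (descends_ins hg fun _ _ h =>
    rot_snd_congr (Finset.mem_range.1 hj).le h).zsmul _

theorem Descends.SD {n : ℕ} {g : (ℕ → U) → M} (hg : Descends (n + 1) g) {D : U → U}
    (hD : ∀ u v : U, u.snd = v.snd → (D u).snd = (D v).snd) : Descends n (SD D n g) :=
  Descends.sum fun j hj => Descends.sum fun p hp => (descends_ins hg fun x y h i hi => by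
    have hr := rot_snd_congr (Finset.mem_range.1 hj).le h
    simp only [app, Function.update_apply]
    split_ifs with hi'
    · exact hD _ _ (hr p (Nat.lt_succ_iff.1 (Finset.mem_Ico.1 hp).2))
    · exact hr i hi).zsmul _

theorem Descends.SE {n : ℕ} {g : (ℕ → U) → M} (hg : Descends n g) {E : U → U → U}
    (hE : ∀ u u' v v' : U, u.snd = u'.snd → v.snd = v'.snd → E u v = E u' v') :
    Descends n (SE E n g) := by
  cases n with
  | zero => intro x y _ _; simp [GaussManin.SE]
  | succ n =>
    refine Descends.sum fun j hj => Descends.sum fun m hm => Descends.zsmul ?_ _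
    rw [Finset.mem_range] at hj
    rw [Finset.mem_Ico] at hm
    intro x y _ h
    have hr := rot_snd_congr (n := n + 1) (j := j) (by omega) h
    refine hg _ _ (fun _ => rfl) fun i hi => ?_
    simp only [ins, merge]
    split_ifs
    · rfl
    · exact hr _ (by omega)
    · rw [hE _ _ _ _ (hr m (by omega)) (hr (m + 1) (by omega))]
    · exact hr _ (by omega)

theorem Descends.iotaE {n : ℕ} {g : (ℕ → U) → M} (hg : Descends n g) {E : U → U → U}
    (hE : ∀ u u' v v' : U, u.snd = u'.snd → v.snd = v'.snd → E u v = E u' v') :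
    Descends (n + 2) (iotaE E g) := by
  intro x y h0 h
  have h0 := h0 (by omega)
  have e : x 0 * E (x 1) (x 2) = y 0 * E (y 1) (y 2) := by
    rw [h0, hE _ _ _ _ (h 1 (by omega)) (h 2 (by omega))]
  refine congrArg Neg.neg (hg _ _ (fun _ => ?_) fun i hi => ?_)
  · simpa [merge] using e
  · rcases Nat.eq_zero_or_pos i with rfl | hi'
    · simpa [merge] using congrArg (fun u : U => u.snd) e
    · have h1 : i ≠ 0 := by omega
      have h2 : ¬ i + 1 < 1 := by omega
      simp only [merge, Nat.not_lt_zero, h1, h2, if_false, Nat.add_eq_right]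
      exact h _ (by omega)

/-- The value of `D` is multiplied into the letter `0`, whose scalar part can be seen by `g`; hence
all of `D u`, not only its class, must depend on the class of `u`. An extended connection fulfils
this if its derivation is `0`. -/
theorem Descends.iotaD {n : ℕ} {g : (ℕ → U) → M} (hg : Descends n g) {D : U → U}
    (hD : ∀ u v : U, u.snd = v.snd → D u = D v) : Descends (n + 1) (iotaD D g) := by
  intro x y h0 h
  have h0 := h0 (by omega)
  have e : x 0 * D (x 1) = y 0 * D (y 1) := by
    rw [h0, hD _ _ (h 1 (by omega))]
  refine hg _ _ (fun _ => ?_) fun i hi => ?_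
  · simpa [merge, app] using e
  · rcases Nat.eq_zero_or_pos i with rfl | hi'
    · simpa [merge, app] using congrArg (fun u : U => u.snd) e
    · have h1 : i ≠ 0 := by omega
      have h2 : i + 1 ≠ 1 := by omega
      simp only [merge, app, Nat.not_lt_zero, h1, if_false, Function.update_of_ne h2]
      exact h _ (by omega)

theorem Descends.lieF {n : ℕ} {g : (ℕ → U) → M} (hg : Descends n g) {D : U → U}
    (hD : ∀ u v : U, u.snd = v.snd → (D u).snd = (D v).snd) : Descends n (lieF D n g) :=
  Descends.sum fun p hp x y h0 h => hg _ _
    (fun hn => by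
      simp only [app, Function.update_apply]
      split_ifs with h'
      · rw [← h', h0 hn]
      · exact h0 hn)
    fun i hi => by
      simp only [app, Function.update_apply]
      split_ifs
      · exact hD _ _ (h p (Nat.lt_succ_iff.1 (Finset.mem_range.1 hp)))
      · exact h i hi

end Multilinear

/-! ### Operators given by formulas on elementary chains -/

section Extension

variable {R : Type} {A : Type*} [CommRing R] [Algebra ℂ R] [TopologicalSpace R]
  [ContinuousConstSMul R R]
  [NonUnitalRing A] [Module ℂ A] [Module R A] [IsScalarTower ℂ R A] [IsScalarTower R A A]
  [SMulCommClass R A A] [TopologicalSpace A] [IsTopologicalAddGroup A] [ContinuousConstSMul R A]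

local notation "U" => Unitization R A

namespace PreChain

theorem tensor_induction {n : ℕ} {P : PreChain R A n → Prop} (h0 : P 0)
    (ht : ∀ s, P (tensor s)) (ha : ∀ a b, P a → P b → P (a + b)) (z : PreChain R A n) : P z := by
  refine TensorProduct.induction_on (motive := P) z h0 (fun u t => ?_) ha
  induction t using PiTensorProduct.induction_on with
  | smul_tprod r v =>
    rw [← TensorProduct.smul_tmul]
    exact ht (r • u, v)
  | add a b iha ihb => rw [TensorProduct.tmul_add]; exact ha _ _ iha ihb

/-- The word of an elementary tensor. -/
def toWord {n : ℕ} (s : U × (Fin n → A)) : ℕ → U :=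
  fun i => if i = 0 then s.1 else if h : i - 1 < n then (s.2 ⟨i - 1, h⟩ : U) else 0

theorem toWord_update_zero {n : ℕ} (u w : U) (v : Fin n → A) :
    Function.update (toWord (u, v)) 0 w = toWord (w, v) := by
  funext i
  simp only [toWord, Function.update_apply]; split_ifs <;> rfl

theorem toWord_update_succ {n : ℕ} (u : U) (v : Fin n → A) (i : Fin n) (a : A) :
    toWord (u, Function.update v i a) = Function.update (toWord (u, v)) (i + 1) (a : U) := by
  funext k
  simp only [toWord, Function.update_apply]
  by_cases hk : k = 0
  · simp [hk]
  · by_cases hk' : k - 1 < n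
    · simp only [hk, hk', if_false, dif_pos, Fin.ext_iff]
      have : k - 1 = (i : ℕ) ↔ k = i + 1 := by omega
      simp only [this]
      split_ifs <;> rfl
    · have : k ≠ i + 1 := by have := i.2; omega
      simp [hk, hk', this]

/-- Slotwise additive functions of words that are balanced over `R` factor through the tensor
product over `R`. -/
theorem exists_lift {n : ℕ} {M : Type*} [AddCommGroup M] {φ : (ℕ → U) → M}
    (hadd : ∀ k ≤ n, AddAt k φ)
    (hbal : ∀ k ≤ n, ∀ (x : ℕ → U) (r : R),
      φ (Function.update x k (r • x k)) = φ (Function.update x 0 (r • x 0))) :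
    ∃ T : PreChain R A n →+ M, ∀ s, T (tensor s) = φ (toWord s) := by
  have hz : ∀ (u w : U) (v : Fin n → A), φ (toWord (u + w, v)) =
      φ (toWord (u, v)) + φ (toWord (w, v)) := fun u w v => by
    rw [← toWord_update_zero 0 (u + w), hadd 0 (Nat.zero_le n), toWord_update_zero,
      toWord_update_zero]
  have hz0 : ∀ v : Fin n → A, φ (toWord ((0 : U), v)) = 0 := fun v =>
    (hadd 0 (Nat.zero_le n)).map_zero rfl
  -- Tensors come with a coefficient in `R`. It is absorbed into the letter `0`, which is where
  -- balancedness moves all scalars.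
  let F (u : U) : (⨂[R] _ : Fin n, A) →+ M :=
    PiTensorProduct.liftAddHom (fun p : R × (Fin n → A) => φ (toWord (p.1 • u, p.2)))
      (fun r v i hv => (hadd (i + 1) i.2).map_zero (by simp [toWord, hv]))
      (fun v => by simp only [zero_smul, hz0])
      (fun {inst} r v i a b => by
        obtain rfl : inst = instDecidableEqFin n := Subsingleton.elim _ _
        simp only [toWord_update_succ, Unitization.inr_add]
        exact (hadd (i + 1) i.2 _ _ _).symm)
      (fun r r' v => by simp only [add_smul, hz])
      (fun {inst} r v i r' => by
        obtain rfl : inst = instDecidableEqFin n := Subsingleton.elim _ _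
        simp only [toWord_update_succ]
        have h1 : toWord (r • u, v) (i + 1) = (v i : U) := by simp [toWord]
        have := hbal (i + 1) i.2 (toWord (r • u, v)) r'
        rw [h1] at this
        rw [Unitization.inr_smul, this, toWord_update_zero, mul_smul]
        rfl)
  have hF : ∀ u r v, F u (PiTensorProduct.tprodCoeff R r v) = φ (toWord (r • u, v)) :=
    fun u r v => rfl
  let G : U →+ (⨂[R] _ : Fin n, A) →+ M := AddMonoidHom.mk' F fun u w => by
    ext t
    induction t using PiTensorProduct.induction_on' with
    | tprodCoeff r v => rw [AddMonoidHom.add_apply, hF, hF, hF, smul_add, hz]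
    | add a b ha hb => rw [map_add, map_add, ha, hb]
  have hG : ∀ (r : R) (u : U) (t : ⨂[R] _ : Fin n, A), G (r • u) t = G u (r • t) := fun r u t => by
    induction t using PiTensorProduct.induction_on' with
    | tprodCoeff r' v =>
      rw [PiTensorProduct.smul_tprodCoeff']
      change F (r • u) _ = F u _
      rw [hF, hF, smul_smul, smul_eq_mul, mul_comm]
    | add a b ha hb => rw [smul_add, map_add, map_add, ha, hb]
  refine ⟨TensorProduct.liftAddHom G hG, fun s => ?_⟩
  change F s.1 (PiTensorProduct.tprodCoeff R 1 s.2) = _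
  rw [hF, one_smul]

end PreChain

/-- Every neighbourhood of `0` contains the open unit ball of a continuous seminorm. -/
def HasSeminormNhds (M : Type*) [AddCommGroup M] [Module ℂ M] [TopologicalSpace M] : Prop :=
  ∀ V ∈ 𝓝 (0 : M), ∃ p : Seminorm ℂ M, Continuous p ∧ {x | p x < 1} ⊆ V

theorem hasSeminormNhds_of_polynormable (M : Type*) [AddCommGroup M] [Module ℂ M]
    [TopologicalSpace M] [PolynormableSpace ℂ M] : HasSeminormNhds M := by
  intro V hV
  have h := PolynormableSpace.withSeminorms ℂ M
  obtain ⟨⟨s, r⟩, hr, hs⟩ := h.hasBasis_zero_ball.mem_iff.1 hV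
  have hr : 0 < r := hr
  have hs0 : (s.sup fun i : {p : Seminorm ℂ M // Continuous p} => i.1).ball 0 r ⊆ V := hs
  set q := s.sup fun i : {p : Seminorm ℂ M // Continuous p} => i.1 with hq
  have hqc : Continuous q := by
    have : ∀ t : Finset {p : Seminorm ℂ M // Continuous p}, 
        Continuous (t.sup (fun i => i.1) : Seminorm ℂ M) := by
      intro t
      induction t using Finset.cons_induction with
      | empty => exact continuous_const (y := (0 : ℝ))
      | cons a t ha ih =>
        rw [Finset.sup_cons]
        exact a.2.sup ih
    exact this s
  refine ⟨r⁻¹.toNNReal • q, ?_, fun x hx => hs0 ?_⟩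
  · exact hqc.const_smul (r⁻¹.toNNReal)
  · rw [Seminorm.mem_ball_zero]
    have hx : r⁻¹.toNNReal • q x < 1 := hx
    rw [NNReal.smul_def, Real.coe_toNNReal _ (inv_nonneg.2 hr.le), smul_eq_mul,
      inv_mul_lt_iff₀ hr, mul_one] at hx
    exact hx

namespace PreChain

theorem withSeminorms (n : ℕ) : WithSeminorms
    (fun p : {p : Seminorm ℂ (PreChain R A n) // IsProjective p} => p.1) :=
  (SeminormFamily.withSeminorms_iff_uniformSpace_eq_iInf _).2 rfl

theorem IsProjective.continuous {n : ℕ} {p : Seminorm ℂ (PreChain R A n)} (hp : IsProjective p) :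
    Continuous p :=
  (withSeminorms n).continuous_seminorm ⟨p, hp⟩

theorem continuous_tensor (n : ℕ) :
    Continuous (tensor : U × (Fin n → A) → PreChain R A n) := by
  refine continuous_iff_continuousAt.2 fun s => ?_
  refine ((withSeminorms n).tendsto_nhds _ _).2 fun p ε hε => ?_
  exact (p.2 s).eventually_lt_const hε

/-- The universal property of the projective topology: a continuous seminorm of the target pulls
back to a projective seminorm. -/
theorem continuous_of_tensor {n : ℕ} {M : Type*} [AddCommGroup M] [Module ℂ M] [TopologicalSpace M]
    [IsTopologicalAddGroup M] (hM : HasSeminormNhds M) (T : PreChain R A n →ₗ[ℂ] M)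
    (hT : Continuous fun s : U × (Fin n → A) => T (tensor s)) : Continuous T := by
  refine continuous_of_continuousAt_zero T ?_
  rw [ContinuousAt, map_zero]
  intro V hV
  obtain ⟨p, hp, hpV⟩ := hM V hV
  have hq : IsProjective (p.comp T) := fun s => by
    have h : Continuous fun u : U × (Fin n → A) => p (T (tensor u) - T (tensor s)) :=
      hp.comp (hT.sub continuous_const)
    have := h.tendsto s
    rw [sub_self, map_zero] at this
    simpa [Seminorm.comp_apply] using this
  have h : {z | p.comp T z < 1} ∈ 𝓝 (0 : PreChain R A n) :=
    (isOpen_lt hq.continuous continuous_const).mem_nhds (by simp)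
  exact mem_of_superset h fun z hz => hpV hz

end PreChain

end Extension

/-! ### Local convexity, completeness and extension of formulas to chains. -/

section ChainTopology

theorem HasSeminormNhds.completion {Q : Type*} [AddCommGroup Q] [Module ℂ Q] [UniformSpace Q]
    [IsUniformAddGroup Q] [UniformContinuousConstSMul ℂ Q] (hQ : HasSeminormNhds Q) :
    HasSeminormNhds (UniformSpace.Completion Q) := by
  intro V hV
  -- A closed neighbourhood is chosen so that an inclusion of unit balls, checked on the dense
  -- subspace, passes to the completion.
  obtain ⟨W, hW, hWc, hWV⟩ := exists_mem_nhds_isClosed_subset hV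
  have hW' : ((↑) : Q → UniformSpace.Completion Q) ⁻¹' W ∈ 𝓝 (0 : Q) :=
    (UniformSpace.Completion.continuous_coe Q).continuousAt.preimage_mem_nhds
      (by rwa [UniformSpace.Completion.coe_zero])
  obtain ⟨p, hp, hpW⟩ := hQ _ hW'
  have hpu : UniformContinuous p := Seminorm.uniformContinuous_of_continuousAt_zero hp.continuousAt
  let q : UniformSpace.Completion Q → ℝ := UniformSpace.Completion.extension p
  have hq : Continuous q := UniformSpace.Completion.continuous_extension
  have hqc : ∀ x : Q, q x = p x := fun x => UniformSpace.Completion.extension_coe hpu x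
  let q' : Seminorm ℂ (UniformSpace.Completion Q) := Seminorm.of q
    (fun x y => by
      refine UniformSpace.Completion.induction_on₂ x y
        (isClosed_le (by fun_prop) (by fun_prop)) fun a b => ?_
      rw [← UniformSpace.Completion.coe_add, hqc, hqc, hqc]
      exact map_add_le_add p a b)
    (fun c x => by
      refine UniformSpace.Completion.induction_on x
        (isClosed_eq (hq.comp (continuous_const_smul c)) (by fun_prop)) fun a => ?_
      rw [← UniformSpace.Completion.coe_smul, hqc, hqc]
      exact map_smul_eq_mul p c a)
  refine ⟨q', hq, fun x hx => hWV ?_⟩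
  have ho : IsOpen {x | q x < 1} := isOpen_lt hq continuous_const
  have hd := UniformSpace.Completion.denseRange_coe (α := Q) |>.open_subset_closure_inter ho hx
  refine hWc.closure_subset_iff.2 ?_ hd
  rintro _ ⟨h, a, rfl⟩
  exact hpW ((hqc a).symm.trans_lt h)

variable {R : Type} {A : Type*} [CommRing R] [Algebra ℂ R] [TopologicalSpace R]
  [ContinuousConstSMul R R]
  [NonUnitalRing A] [Module ℂ A] [Module R A] [IsScalarTower ℂ R A] [IsScalarTower R A A]
  [SMulCommClass R A A] [TopologicalSpace A] [IsTopologicalAddGroup A] [ContinuousConstSMul R A]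

local notation "U" => Unitization R A

theorem complex_smul_eq {M : Type*} [AddCommGroup M] [Module ℂ M] [Module R M]
    [IsScalarTower ℂ R M] (c : ℂ) (m : M) : c • m = (c • (1 : R)) • m := by
  rw [smul_assoc, one_smul]

namespace Chain

instance : ∀ n, ContinuousConstSMul R (Chain R A n)
  | 0 => inferInstanceAs (ContinuousConstSMul R A)
  | n + 1 => inferInstanceAs
      (ContinuousConstSMul R (UniformSpace.Completion (PreChain R A (n + 1))))

instance (n : ℕ) : ContinuousConstSMul ℂ (Chain R A n) where
  continuous_const_smul c :=
    (continuous_const_smul (c • (1 : R))).congr fun z => (complex_smul_eq c z).symm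

instance [T2Space A] : ∀ n, T2Space (Chain R A n)
  | 0 => inferInstanceAs (T2Space A)
  | n + 1 => inferInstanceAs (T2Space (UniformSpace.Completion (PreChain R A (n + 1))))

theorem hasSeminormNhds (hA : HasSeminormNhds A) : ∀ n, HasSeminormNhds (Chain R A n)
  | 0 => hA
  | n + 1 => by
    have : PolynormableSpace ℂ (PreChain R A (n + 1)) :=
      (PreChain.withSeminorms (n + 1)).toPolynormableSpace
    exact (hasSeminormNhds_of_polynormable (PreChain R A (n + 1))).completion

/-- Completeness of `A` enters only in degree `0`; the other spaces are completions by definition.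
-/
theorem completeSpace
    (hA : @CompleteSpace A (IsTopologicalAddGroup.rightUniformSpace A)) :
    ∀ n, @CompleteSpace (Chain R A n) (IsTopologicalAddGroup.rightUniformSpace _)
  | 0 => hA
  | n + 1 => by
    have h := IsUniformAddGroup.rightUniformSpace_eq
      (G := UniformSpace.Completion (PreChain R A (n + 1)))
    have : CompleteSpace (UniformSpace.Completion (PreChain R A (n + 1))) := inferInstance
    rw [← h] at this
    exact this

theorem smul_elem (n : ℕ) (r : R) (x : ℕ → U) :
    r • elem n x = elem n (Function.update x 0 (r • x 0)) := by
  cases n with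
  | zero => rfl
  | succ n =>
    simp only [elem]
    refine (UniformSpace.Completion.coe_smul r _).symm.trans ?_
    rw [PreChain.smul_tensor]
    congr 3

theorem descends_elem (n : ℕ) : Descends n (elem (R := R) (A := A) n) := by
  intro x y h0 h
  cases n with
  | zero => exact h 0 le_rfl
  | succ n =>
    simp only [elem]
    rw [h0 (by omega)]
    congr 3
    funext i
    exact h _ (by omega)

theorem elem_succ_update_succ (n : ℕ) (x : ℕ → U) (k : ℕ) (hk : k < n + 1) (u : U) :
    elem (n + 1) (Function.update x (k + 1) u) =
      ((PreChain.tensor (x 0, Function.update (fun i : Fin (n + 1) => (x (i + 1)).snd) ⟨k, hk⟩ u.snd) :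
        PreChain R A (n + 1)) : UniformSpace.Completion (PreChain R A (n + 1))) := by
  simp only [elem]
  congr 3
  funext i
  simp only [Function.update_apply, Fin.ext_iff, Nat.add_right_cancel_iff]
  split_ifs <;> rfl

theorem isMultilin_elem (n : ℕ) : IsMultilin n (elem (R := R) (A := A) n) where
  isLocal := (descends_elem n).isLocal
  add k hk x u v := by
    cases n with
    | zero =>
      obtain rfl := Nat.le_zero.1 hk
      change (Function.update x 0 (u + v) 0).snd =
        (Function.update x 0 u 0).snd + (Function.update x 0 v 0).snd
      simp
    | succ n =>
      cases k with
      | zero =>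
        simp only [elem, Function.update_self, Function.update_of_ne (Nat.succ_ne_zero _)]
        refine Eq.trans ?_ (UniformSpace.Completion.coe_add _ _)
        congr 1
        exact TensorProduct.add_tmul _ _ _
      | succ k =>
        rw [elem_succ_update_succ n x k (by omega), elem_succ_update_succ n x k (by omega),
          elem_succ_update_succ n x k (by omega)]
        refine Eq.trans ?_ (UniformSpace.Completion.coe_add _ _)
        congr 1
        simp only [PreChain.tensor, Unitization.snd_add, MultilinearMap.map_update_add]
        exact TensorProduct.tmul_add _ _ _
  smul k hk x r u := by
    cases n with
    | zero =>
      obtain rfl := Nat.le_zero.1 hk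
      change (Function.update x 0 (r • u) 0).snd = r • (Function.update x 0 u 0).snd
      simp
    | succ n =>
      cases k with
      | zero => rw [smul_elem, Function.update_idem, Function.update_self]
      | succ k =>
        rw [elem_succ_update_succ n x k (by omega), elem_succ_update_succ n x k (by omega)]
        refine Eq.trans ?_ (UniformSpace.Completion.coe_smul r _)
        congr 1
        simp only [PreChain.tensor, Unitization.snd_smul, MultilinearMap.map_update_smul]
        exact TensorProduct.tmul_smul _ _ _

theorem continuous_fst : Continuous fun u : U => u.fst :=
  _root_.continuous_fst.comp (continuous_induced_dom (f := fun x : U => (x.fst, x.snd)))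

theorem continuous_snd : Continuous fun u : U => u.snd :=
  _root_.continuous_snd.comp (continuous_induced_dom (f := fun x : U => (x.fst, x.snd)))

theorem continuous_unitization_iff {W : Type*} [TopologicalSpace W] {f : W → U} :
    Continuous f ↔ (Continuous fun w => (f w).fst) ∧ Continuous fun w => (f w).snd :=
  continuous_induced_rng.trans continuous_prodMk

theorem continuous_elem (n : ℕ) : Continuous (elem (R := R) (A := A) n) := by
  cases n with
  | zero => exact (continuous_snd (R := R) (A := A)).comp (continuous_apply 0)
  | succ n =>
    refine (UniformSpace.Completion.continuous_coe _).comp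
      ((PreChain.continuous_tensor (n + 1)).comp ?_)
    exact (continuous_apply 0).prodMk (continuous_pi fun i => continuous_snd.comp (continuous_apply _))

theorem tensor_eq_elem {n : ℕ} (s : U × (Fin (n + 1) → A)) :
    ((PreChain.tensor s : PreChain R A (n + 1)) :
      UniformSpace.Completion (PreChain R A (n + 1))) = elem (n + 1) (PreChain.toWord s) := by
  simp only [elem]
  congr 2
  refine Prod.ext rfl (funext fun i => ?_)
  simp [PreChain.toWord, i.is_le]

/-- Continuous additive maps on chains that agree on the elementary chains are equal. -/
theorem hom_ext {n : ℕ} {M : Type*} [AddCommGroup M] [TopologicalSpace M] [T2Space M]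
    {S T : Chain R A n →+ M} (hS : Continuous S) (hT : Continuous T)
    (h : ∀ x, S (elem n x) = T (elem n x)) (z : Chain R A n) : S z = T z := by
  cases n with
  | zero => exact h fun _ => Unitization.inr (show A from z)
  | succ n =>
    refine UniformSpace.Completion.induction_on (α := PreChain R A (n + 1)) z
      (isClosed_eq hS hT) fun a => ?_
    induction a using PreChain.tensor_induction with
    | h0 => exact (map_zero S).trans (map_zero T).symm
    | ht s => rw [tensor_eq_elem]; exact h _
    | ha a b ha hb =>
      rw [UniformSpace.Completion.coe_add]
      exact (map_add S _ _).trans ((congrArg₂ _ ha hb).trans (map_add T _ _).symm)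

end Chain

theorem continuous_toWord (n : ℕ) :
    Continuous (PreChain.toWord : U × (Fin n → A) → ℕ → U) := by
  refine continuous_pi fun i => ?_
  simp only [PreChain.toWord]
  split_ifs with h h'
  · exact continuous_fst
  · refine Chain.continuous_unitization_iff.2 ⟨?_, ?_⟩
    · exact continuous_const
    · exact (continuous_apply _).comp continuous_snd
  · exact continuous_const

/-- A formula defines a continuous operator if it is slotwise additive, balanced over `R`,
complex linear and continuous. -/
theorem exists_continuous_hom {n : ℕ} {M : Type*} [AddCommGroup M] [Module ℂ M]
    [TopologicalSpace M] [IsTopologicalAddGroup M] [T2Space M]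
    (hM : HasSeminormNhds M) (hMc : @CompleteSpace M (IsTopologicalAddGroup.rightUniformSpace M))
    {φ : (ℕ → U) → M} (hloc : IsLocal n φ) (hadd : ∀ k ≤ n, AddAt k φ)
    (hbal : ∀ k ≤ n, ∀ (x : ℕ → U) (r : R),
      φ (Function.update x k (r • x k)) = φ (Function.update x 0 (r • x 0)))
    (hsmul : ∀ (x : ℕ → U) (c : ℂ), φ (Function.update x 0 (c • x 0)) = c • φ x)
    (hcont : Continuous φ) :
    ∃ T : Chain R A n →+ M, Continuous T ∧ ∀ (a₀ : U) (a : ℕ → A), (n = 0 → a₀.fst = 0) →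
      T (Chain.elem n (word a₀ a)) = φ (word a₀ a) := by
  cases n with
  | zero =>
    refine ⟨(AddMonoidHom.mk' (fun a : A => φ (Function.update (0 : ℕ → U) 0 (a : U))) fun a b => by
      rw [Unitization.inr_add, hadd 0 le_rfl] : A →+ M), ?_, fun a₀ a h => ?_⟩
    · refine hcont.comp (continuous_const.update 0 ?_)
      exact Chain.continuous_unitization_iff.2 ⟨continuous_const, continuous_id⟩
    · refine hloc _ _ fun i hi => ?_
      obtain rfl := Nat.le_zero.1 hi
      simp only [Chain.elem, word, if_true, Function.update_self]
      ext
      · simp [h rfl]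
      · simp
  | succ n =>
    obtain ⟨T, hT⟩ := PreChain.exists_lift hadd hbal
    have hTs : ∀ (c : ℂ) z, T (c • z) = c • T z := fun c z => by
      induction z using PreChain.tensor_induction with
      | h0 => simp
      | ht s =>
        have : c • PreChain.tensor s = PreChain.tensor (c • s.1, s.2) := rfl
        rw [this, hT, hT, ← hsmul]
        change _ = φ (Function.update (PreChain.toWord (s.1, s.2)) 0 (c • s.1))
        rw [PreChain.toWord_update_zero]
      | ha a b ha hb => rw [smul_add, map_add, map_add, smul_add, ha, hb]
    let T' : PreChain R A (n + 1) →ₗ[ℂ] M := { T with map_smul' := hTs }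
    have hTc : Continuous T' := PreChain.continuous_of_tensor hM T' (by
      have : (fun s => T' (PreChain.tensor s)) = φ ∘ PreChain.toWord := funext hT
      rw [this]
      exact hcont.comp (continuous_toWord _))
    let _ : UniformSpace M := IsTopologicalAddGroup.rightUniformSpace M
    have : IsUniformAddGroup M := isUniformAddGroup_of_addCommGroup
    have : CompleteSpace M := hMc
    refine ⟨AddMonoidHom.extension T hTc, AddMonoidHom.continuous_extension T hTc, fun a₀ a _ => ?_⟩
    refine (AddMonoidHom.extension_coe T hTc _).trans ?_
    rw [hT]
    refine hloc _ _ fun i hi => ?_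
    simp only [PreChain.toWord, word]
    by_cases h1 : i = 0
    · simp [h1]
    · have h2 : i - 1 < n + 1 := by omega
      simp only [h1, h2, if_false, dif_pos]
      rw [show i - 1 + 1 = i by omega, if_neg h1]
      rfl

/-- `ActsBy` tests only words with interior letters in `A`. If the formula descends, any word may be
replaced by such a word, so the operator identities can be computed with arbitrary letters in $A_+$.
-/
theorem ActsBy.apply_elem {S : Type*} [Semiring S] {n m : ℕ} [Module S (Chain R A n)]
    [Module S (Chain R A m)] {T : Chain R A n →L[S] Chain R A m} {φ : (ℕ → U) → Chain R A m}
    (h : ActsBy T φ) (hφ : Descends n φ) (x : ℕ → U) : T (Chain.elem n x) = φ x := by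
  have key : ∀ a₀ : U, (n ≠ 0 → x 0 = a₀) → (x 0).snd = a₀.snd → (n = 0 → a₀.fst = 0) →
      T (Chain.elem n x) = φ x := fun a₀ h1 h2 h3 => by
    have hs : ∀ i ≤ n, (x i).snd = (word a₀ (fun i => (x i).snd) i).snd := fun i _ => by
      simp only [word]
      split_ifs with hi
      · rw [hi, h2]
      · rfl
    rw [Chain.descends_elem n x (word a₀ fun i => (x i).snd) h1 hs,
      hφ x (word a₀ fun i => (x i).snd) h1 hs]
    exact h _ _ h3
  by_cases hn : n = 0
  · exact key ((x 0).snd : U) (fun h => absurd hn h) rfl fun _ => rfl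
  · exact key (x 0) (fun _ => rfl) rfl fun h => absurd h hn

theorem extend_actsBy {S : Type*} [Semiring S] {n m : ℕ} [Module S (Chain R A n)]
    [Module S (Chain R A m)] {φ : (ℕ → U) → Chain R A m}
    (h : ∃ T : Chain R A n →L[S] Chain R A m, ActsBy T φ) : ActsBy (extend S n m φ) φ := by
  rw [extend, dif_pos h]
  exact h.choose_spec

variable [T2Space A]

theorem exists_actsBy_complex (hA : HasSeminormNhds A)
    (hAc : @CompleteSpace A (IsTopologicalAddGroup.rightUniformSpace A)) {n m : ℕ}
    {φ : (ℕ → U) → Chain R A m} (hloc : Descends n φ) (hadd : ∀ k ≤ n, AddAt k φ)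
    (hbal : ∀ k ≤ n, ∀ (x : ℕ → U) (r : R),
      φ (Function.update x k (r • x k)) = φ (Function.update x 0 (r • x 0)))
    (hsmul : ∀ (x : ℕ → U) (c : ℂ), φ (Function.update x 0 (c • x 0)) = c • φ x)
    (hcont : Continuous φ) :
    ∃ T : Chain R A n →L[ℂ] Chain R A m, ActsBy T φ := by
  obtain ⟨T, hTc, hT⟩ := exists_continuous_hom (Chain.hasSeminormNhds hA m)
    (Chain.completeSpace hAc m) hloc.isLocal hadd hbal hsmul hcont
  -- Only additivity is known so far; `ℕ`-linearity suffices to evaluate on all words, and complex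
  -- linearity then follows by density.
  let T₀ : Chain R A n →L[ℕ] Chain R A m := ⟨T.toNatLinearMap, hTc⟩
  have hT₀ : ∀ x, T (Chain.elem n x) = φ x :=
    ActsBy.apply_elem (T := T₀) (fun a₀ a h => hT a₀ a h) hloc
  refine ⟨⟨{ T with map_smul' := fun c z => ?_ }, hTc⟩, hT⟩
  refine Chain.hom_ext (S := T.comp (DistribSMul.toAddMonoidHom _ c))
    (T := (DistribSMul.toAddMonoidHom _ c).comp T) (hTc.comp (continuous_const_smul c))
    (hTc.const_smul c) (fun x => ?_) z
  change T (c • Chain.elem n x) = c • T (Chain.elem n x)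
  have : c • x 0 = (c • (1 : R)) • x 0 := complex_smul_eq c _
  rw [complex_smul_eq (R := R) c (Chain.elem n x), Chain.smul_elem, ← this, hT₀, hT₀, hsmul]

theorem exists_actsBy (hA : HasSeminormNhds A)
    (hAc : @CompleteSpace A (IsTopologicalAddGroup.rightUniformSpace A)) {n m : ℕ}
    {φ : (ℕ → U) → Chain R A m} (hloc : Descends n φ) (hφ : IsMultilin n φ)
    (hcont : Continuous φ) :
    ∃ T : Chain R A n →L[R] Chain R A m, ActsBy T φ := by
  have hsm : ∀ k ≤ n, ∀ (x : ℕ → U) (r : R), φ (Function.update x k (r • x k)) = r • φ x :=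
    fun k hk x r => by rw [hφ.smul k hk, Function.update_eq_self]
  obtain ⟨T, hT⟩ := exists_actsBy_complex hA hAc hloc hφ.add
    (fun k hk x r => by rw [hsm k hk, hsm 0 (Nat.zero_le n)])
    (fun x c => by
      rw [complex_smul_eq (R := R) c (x 0), hsm 0 (Nat.zero_le n), ← complex_smul_eq]) hcont
  have hT₀ := hT.apply_elem hloc
  refine ⟨⟨{ (T : Chain R A n →+ Chain R A m) with map_smul' := fun c z => ?_ }, T.continuous⟩, hT⟩
  refine Chain.hom_ext (S := (T : Chain R A n →+ Chain R A m).comp (DistribSMul.toAddMonoidHom _ c))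
    (T := (DistribSMul.toAddMonoidHom _ c).comp (T : Chain R A n →+ Chain R A m))
    (T.continuous.comp (continuous_const_smul c))
    (T.continuous.const_smul c) (fun x => ?_) z
  change T (c • Chain.elem n x) = c • T (Chain.elem n x)
  rw [Chain.smul_elem, hT₀, hT₀, hsm 0 (Nat.zero_le n)]

end ChainTopology

/-! ### The space of smooth functions -/

section SmoothSpace

variable {J : Opens ℝ} {X Y Z : Type*}

section Bilinear

variable [AddCommGroup X] [Module ℂ X] [TopologicalSpace X] [IsTopologicalAddGroup X]
  [ContinuousSMul ℂ X] [T2Space X]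
variable [AddCommGroup Y] [Module ℂ Y] [TopologicalSpace Y] [IsTopologicalAddGroup Y]
  [ContinuousSMul ℂ Y] [T2Space Y]
variable [AddCommGroup Z] [Module ℂ Z] [TopologicalSpace Z] [IsTopologicalAddGroup Z]
  [ContinuousSMul ℂ Z] [T2Space Z]

namespace SmoothFun

/-- The product of smooth functions given by a smooth family of bilinear maps. -/
def bilin (N : X →ₗ[ℂ] Y →ₗ[ℂ] SmoothFun J Z) (hN : Continuous fun p : X × Y => N p.1 p.2)
    (a : SmoothFun J X) (b : SmoothFun J Y) : SmoothFun J Z :=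
  ⟨fun t => N (a t) (b t) t, isSmooth_bilin N hN a b⟩

theorem D_bilin (N : X →ₗ[ℂ] Y →ₗ[ℂ] SmoothFun J Z) (hN : Continuous fun p : X × Y => N p.1 p.2)
    (a : SmoothFun J X) (b : SmoothFun J Y) :
    D (bilin N hN a b) = bilin (N.compr₂ D) (continuous_D.comp hN) a b +
      (bilin N hN (D a) b + bilin N hN a (D b)) :=
  D_eq (hasDeriv_bilin N hN a b)

/-- The derivative of such a product is a sum of three products of the same kind, one of them for
the family differentiated in `t`. Hence the induction on the order of the derivative has to allow
`N` to vary. -/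
theorem continuous_bilin (N : X →ₗ[ℂ] Y →ₗ[ℂ] SmoothFun J Z)
    (hN : Continuous fun p : X × Y => N p.1 p.2) :
    Continuous fun p : SmoothFun J X × SmoothFun J Y => bilin N hN p.1 p.2 := by
  refine continuous_rng_iff.2 fun k => ?_
  induction k generalizing N with
  | zero =>
    refine ContinuousMap.continuous_of_continuous_uncurry _ ?_
    have h1 : Continuous fun q : (SmoothFun J X × SmoothFun J Y) × J => q.1.1 q.2 :=
      continuous_eval.comp ((continuous_fst.comp continuous_fst).prodMk continuous_snd)
    have h2 : Continuous fun q : (SmoothFun J X × SmoothFun J Y) × J => q.1.2 q.2 :=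
      continuous_eval.comp ((continuous_snd.comp continuous_fst).prodMk continuous_snd)
    exact continuous_eval.comp ((hN.comp (h1.prodMk h2)).prodMk continuous_snd)
  | succ k ih =>
    have : (fun p : SmoothFun J X × SmoothFun J Y => toC ((D ^ (k + 1)) (bilin N hN p.1 p.2))) =
        fun p => toC ((D ^ k) (bilin (N.compr₂ D) (continuous_D.comp hN) p.1 p.2)) +
          (toC ((D ^ k) (bilin N hN (D p.1) p.2)) + toC ((D ^ k) (bilin N hN p.1 (D p.2)))) := by
      funext p
      rw [pow_succ, Module.End.mul_apply, D_bilin, map_add, map_add, map_add, map_add]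
    rw [this]
    exact (ih _ _).add (((ih N hN).comp ((continuous_D.comp continuous_fst).prodMk continuous_snd)).add
      ((ih N hN).comp (continuous_fst.prodMk (continuous_D.comp continuous_snd))))

theorem continuous_fsmul₂ :
    Continuous fun p : SmoothFun J ℂ × SmoothFun J X => fsmul p.1 p.2 :=
  continuous_bilin _ continuous_smulBilin

instance : ContinuousMul (SmoothFun J ℂ) := ⟨continuous_fsmul₂⟩

instance : T2Space (SmoothFun J X) :=
  T2Space.of_injective_continuous (f := fun f : SmoothFun J X => toC f)
    (fun _ _ h => SmoothFun.ext fun t => DFunLike.congr_fun h t) (continuous_toC_pow 0)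

end SmoothFun

namespace SmoothDeformation

variable {𝒜 : SmoothDeformation J X}

instance : ContinuousMul 𝒜.Sections := by
  obtain ⟨M, hM, h⟩ := 𝒜.smooth
  let M' : X →ₗ[ℂ] X →ₗ[ℂ] SmoothFun J X := LinearMap.mk₂ ℂ M
    (fun _ _ _ => SmoothFun.ext fun _ => by simp [h])
    (fun _ _ _ => SmoothFun.ext fun _ => by simp [h])
    (fun _ _ _ => SmoothFun.ext fun _ => by simp [h])
    (fun _ _ _ => SmoothFun.ext fun _ => by simp [h])
  refine ⟨(SmoothFun.continuous_bilin M' hM).congr fun p => SmoothFun.ext fun t => ?_⟩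
  exact h _ _ _

instance : ContinuousSMul (SmoothFun J ℂ) 𝒜.Sections :=
  ⟨SmoothFun.continuous_fsmul₂ (X := X)⟩

instance : T2Space 𝒜.Sections := inferInstanceAs (T2Space (SmoothFun J X))

end SmoothDeformation

end Bilinear

theorem map_val_punctured (t : J) : Filter.map Subtype.val (𝓝[≠] t) = 𝓝[≠] (t : ℝ) := by
  have h : Topology.IsOpenEmbedding (Subtype.val : J → ℝ) := J.isOpen.isOpenEmbedding_subtypeVal
  have := h.toIsEmbedding.map_nhdsWithin_eq {t}ᶜ t
  have h2 : (Subtype.val '' ({t}ᶜ : Set J)) = (J : Set ℝ) \ {(t : ℝ)} := by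
    ext s
    constructor
    · rintro ⟨u, hu, rfl⟩
      exact ⟨u.2, fun h => hu (Subtype.ext h)⟩
    · rintro ⟨h1, h2⟩
      exact ⟨⟨s, h1⟩, fun h => h2 (congrArg Subtype.val h), rfl⟩
  rwa [h2, Set.sdiff_eq, Set.inter_comm, nhdsWithin_inter_of_mem'] at this
  exact mem_nhdsWithin_of_mem_nhds (J.isOpen.mem_nhds t.2)

section LocallyConvex

variable [AddCommGroup X] [Module ℂ X] [TopologicalSpace X] [IsTopologicalAddGroup X]
  [ContinuousSMul ℂ X] [PolynormableSpace ℂ X]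

open Classical in
theorem HasDeriv.hasDerivAt_functional {f f' : J → X} (h : HasDeriv f f') (g : StrongDual ℂ X)
    (t : J) : HasDerivAt (fun u : ℝ => if hu : u ∈ J then g (f ⟨u, hu⟩) else 0) (g (f' t)) t := by
  rw [hasDerivAt_iff_tendsto_slope, ← map_val_punctured, tendsto_map'_iff]
  refine ((g.continuous.tendsto _).comp (h t)).congr fun s => ?_
  simp only [Function.comp, map_smul, map_sub, slope, vsub_eq_sub]
  rw [dif_pos s.2, dif_pos t.2]
  simp [Complex.real_smul]

theorem exists_functional {q : Seminorm ℂ X} (hq : Continuous q) (w : X) :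
    ∃ g : StrongDual ℂ X, g w = q w ∧ ∀ x, ‖g x‖ ≤ q x := by
  by_cases hw : w = 0
  · exact ⟨0, by simp [hw], fun x => by simp⟩
  -- Hahn–Banach for the functional $cw\mapsto c\,q(w)$ on the line through `w`.
  · obtain ⟨g, hg, hle⟩ := Module.Dual.exists_continuous_extension_of_le_seminorm
      (Submodule.span ℂ {w}) ((q w : ℂ) • (LinearEquiv.coord ℂ X w hw : _ →ₗ[ℂ] ℂ)) hq (by
        rintro ⟨x, hx⟩
        obtain ⟨c, rfl⟩ := Submodule.mem_span_singleton.1 hx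
        have : LinearEquiv.coord ℂ X w hw ⟨c • w, hx⟩ = c := by
          rw [LinearEquiv.coord, LinearEquiv.symm_apply_eq]
          rfl
        simp only [LinearMap.smul_apply, LinearEquiv.coe_coe, this, smul_eq_mul, norm_mul,
          Complex.norm_real, Real.norm_eq_abs, abs_of_nonneg (apply_nonneg q w)]
        rw [map_smul_eq_mul, mul_comm])
    refine ⟨g, ?_, hle⟩
    have := hg ⟨w, Submodule.mem_span_singleton_self w⟩
    simpa [LinearEquiv.coord_self] using this

/-- The mean value inequality. -/
theorem HasDeriv.seminorm_sub_le (hJ : (J : Set ℝ).OrdConnected) {f f' : J → X}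
    (h : HasDeriv f f') {q : Seminorm ℂ X} (hq : Continuous q) (v : X) {c : ℝ} {s t : J}
    (hb : ∀ u : J, (u : ℝ) ∈ Set.uIcc (s : ℝ) t → q (f' u - v) ≤ c) :
    q (f s - f t - (((s : ℝ) - t : ℝ) : ℂ) • v) ≤ c * |(s : ℝ) - t| := by
  classical
  -- A functional that attains `q` on the vector to be estimated reduces the claim to the scalar
  -- function $u\mapsto g(f(u))-u\,g(v)$.
  obtain ⟨g, hg, hle⟩ := exists_functional hq (f s - f t - (((s : ℝ) - t : ℝ) : ℂ) • v)
  have hsub : Set.uIcc (s : ℝ) t ⊆ J := hJ.uIcc_subset s.2 t.2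
  have key := Convex.norm_image_sub_le_of_norm_hasDerivWithin_le (𝕜 := ℝ) (C := c)
    (s := Set.uIcc (s : ℝ) t) (x := (t : ℝ)) (y := (s : ℝ))
    (f := fun u : ℝ => (if hu : u ∈ J then g (f ⟨u, hu⟩) else 0) - u • g v)
    (f' := fun u : ℝ => (if hu : u ∈ J then g (f' ⟨u, hu⟩) else 0) - (1 : ℝ) • g v)
    (fun u hu => by
      have h1 := h.hasDerivAt_functional g ⟨u, hsub hu⟩
      have h2 := h1.sub ((hasDerivAt_id u).smul_const (g v))
      rw [dif_pos (show u ∈ J from hsub hu)]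
      exact h2.hasDerivWithinAt)
    (fun u hu => by
      rw [dif_pos (show u ∈ J from hsub hu), one_smul, ← map_sub]
      exact (hle _).trans (hb ⟨u, hsub hu⟩ hu))
    (convex_uIcc _ _) Set.right_mem_uIcc Set.left_mem_uIcc
  rw [dif_pos s.2, dif_pos t.2, Real.norm_eq_abs] at key
  refine le_trans (le_of_eq ?_) key
  have e : g (f s) - (s : ℝ) • g v - (g (f t) - (t : ℝ) • g v) =
      g (f s - f t - (((s : ℝ) - t : ℝ) : ℂ) • v) := by
    simp only [map_sub, map_smul, Complex.real_smul, smul_eq_mul, Complex.ofReal_sub]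
    ring
  rw [Subtype.coe_eta, Subtype.coe_eta, e, hg, Complex.norm_real, Real.norm_eq_abs,
    abs_of_nonneg (apply_nonneg q _)]

/-- A converse of the mean value inequality. The estimate in the hypothesis is preserved by locally
uniform limits of `f` and `f'`, which is not evident for the limit of difference quotients. -/
theorem hasDeriv_of_seminorm_le {f f' : J → X}
    (hf' : Continuous f')
    (h : ∀ (q : Seminorm ℂ X), Continuous q → ∀ (s t : J) (c : ℝ),
      (∀ u : J, (u : ℝ) ∈ Set.uIcc (s : ℝ) t → q (f' u - f' t) ≤ c) →
      q (f s - f t - (((s : ℝ) - t : ℝ) : ℂ) • f' t) ≤ c * |(s : ℝ) - t|) :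
    HasDeriv f f' := by
  intro t
  refine ((PolynormableSpace.withSeminorms ℂ X).tendsto_nhds _ _).2 fun q ε hε => ?_
  have hc : Continuous fun u => q.1 (f' u - f' t) := q.2.comp (hf'.sub continuous_const)
  have ho : {u | q.1 (f' u - f' t) < ε / 2} ∈ 𝓝 t :=
    (isOpen_lt hc continuous_const).mem_nhds (by simpa using hε)
  obtain ⟨δ, hδ, hball⟩ := Metric.mem_nhds_iff.1 ho
  filter_upwards [self_mem_nhdsWithin, mem_nhdsWithin_of_mem_nhds (Metric.ball_mem_nhds t hδ)]
    with s hs hsδ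
  have hne : (s : ℝ) - t ≠ 0 := sub_ne_zero.2 fun h => hs (Subtype.ext h)
  have hb := h q.1 q.2 s t (ε / 2) fun u hu => by
    refine le_of_lt (hball (show dist u t < δ from ?_) : q.1 (f' u - f' t) < ε / 2)
    refine lt_of_le_of_lt ?_ hsδ
    rw [Subtype.dist_eq, Subtype.dist_eq, Real.dist_eq, Real.dist_eq]
    exact Set.abs_sub_left_of_mem_uIcc (Set.uIcc_comm (s : ℝ) t ▸ hu)
  have e : (((s : ℝ) - t : ℝ) : ℂ)⁻¹ • (f s - f t) - f' t =
      (((s : ℝ) - t : ℝ) : ℂ)⁻¹ • (f s - f t - (((s : ℝ) - t : ℝ) : ℂ) • f' t) := by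
    rw [smul_sub _ (f s - f t), inv_smul_smul₀ (Complex.ofReal_ne_zero.2 hne)]
  rw [e, map_smul_eq_mul, norm_inv, Complex.norm_real, Real.norm_eq_abs,
    inv_mul_lt_iff₀ (abs_pos.2 hne), mul_comm]
  exact hb.trans_lt (mul_lt_mul_of_pos_right (half_lt_self hε) (abs_pos.2 hne))

end LocallyConvex

section Complete

variable [AddCommGroup X] [Module ℂ X] [UniformSpace X] [IsUniformAddGroup X]
  [ContinuousSMul ℂ X] [PolynormableSpace ℂ X] [T2Space X]

namespace SmoothFun

open scoped ComplexOrder in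
theorem polynormableSpace : PolynormableSpace ℂ (SmoothFun J X) := by
  have h1 : LocallyConvexSpace ℝ X :=
    (PolynormableSpace.withSeminorms ℂ X).toLocallyConvexSpace
  have : ContinuousSMul ℝ X := IsScalarTower.continuousSMul ℂ
  have : ContinuousSMul ℝ C(J, X) := IsScalarTower.continuousSMul ℂ
  -- The nonnegative complex numbers are the nonnegative reals, so convexity over `ℂ` and over `ℝ`
  -- agree.
  have : LocallyConvexSpace ℂ C(J, X) := LocallyConvexSpace.ofBasisZero _ _ _ _
    (LocallyConvexSpace.convex_basis_zero ℝ C(J, X)) fun _ hs =>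
      convex_of_nonneg_surjective_algebraMap _ (fun z hz => (RCLike.nonneg_iff_exists_ofReal (z := z)).1 hz) hs.2
  have h2 : PolynormableSpace ℂ C(J, X) := LocallyConvexSpace.toPolynormableSpace
  exact PolynormableSpace.iInf fun k =>
    PolynormableSpace.induced ((toC : SmoothFun J X →ₗ[ℂ] C(J, X)) ∘ₗ (D ^ k))

/-- All derivatives of a smooth function. -/
def jet : SmoothFun J X →+ (ℕ → C(J, X)) where
  toFun f k := toC ((D ^ k) f)
  map_zero' := by funext k; simp
  map_add' f g := by funext k; simp

theorem isInducing_jet : IsInducing (jet : SmoothFun J X → ℕ → C(J, X)) := by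
  refine ⟨?_⟩
  simp only [Pi.topologicalSpace, induced_iInf, induced_compose]
  rfl

theorem mem_range_jet {g : ℕ → C(J, X)} (hg : ∀ k, HasDeriv (g k) (g (k + 1))) :
    g ∈ Set.range (jet : SmoothFun J X → ℕ → C(J, X)) := by
  have hs : ∀ k, IsSmooth (g k) := fun k => ⟨fun l => g (k + l), rfl, fun l => hg (k + l)⟩
  refine ⟨⟨g 0, hs 0⟩, ?_⟩
  have : ∀ k, (D ^ k) (⟨g 0, hs 0⟩ : SmoothFun J X) = ⟨g k, hs k⟩ := fun k => by
    induction k with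
    | zero => rfl
    | succ k ih =>
      rw [pow_succ', Module.End.mul_apply, ih]
      exact D_eq (hg k)
  funext k
  ext t
  change (D ^ k) (⟨g 0, hs 0⟩ : SmoothFun J X) t = _
  rw [this]
  rfl

/-- A limit of jets still satisfies the mean value estimate for consecutive entries, so each entry
is the derivative of the preceding one. Convexity of `J` is needed to keep the segment from `s` to
`t` inside `J`. -/
theorem isClosed_range_jet (hJ : (J : Set ℝ).OrdConnected) :
    IsClosed (Set.range (jet : SmoothFun J X → ℕ → C(J, X))) := by
  refine isClosed_of_closure_subset fun g hg => mem_range_jet fun k => ?_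
  refine hasDeriv_of_seminorm_le (g (k + 1)).continuous fun q hq s t c hc => ?_
  have hK : IsCompact {u : J | (u : ℝ) ∈ Set.uIcc (s : ℝ) t} := by
    rw [Subtype.isCompact_iff]
    convert isCompact_uIcc (a := (s : ℝ)) (b := (t : ℝ))
    ext u
    exact ⟨fun ⟨v, hv, e⟩ => e ▸ hv, fun hu => ⟨⟨u, hJ.uIcc_subset s.2 t.2 hu⟩, hu, rfl⟩⟩
  -- A jet is chosen within `ε` of `g` on the segment: the error of the derivative enlarges `c` to
  -- `c + ε`, and the errors at the two endpoints add `2 * ε`.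
  have key : ∀ ε > 0, q (g k s - g k t - (((s : ℝ) - t : ℝ) : ℂ) • g (k + 1) t) ≤
      (c + ε) * |(s : ℝ) - t| + 2 * ε := by
    intro ε hε
    have ho : IsOpen {x : X | q x < ε} := isOpen_lt hq _root_.continuous_const
    have hn : ∀ l, {p : ℕ → C(J, X) | Set.MapsTo (p l - g l) {u : J | (u : ℝ) ∈ Set.uIcc (s : ℝ) t}
        {x | q x < ε}} ∈ 𝓝 g := fun l => by
      have hcont : Continuous fun p : ℕ → C(J, X) => p l - g l :=
        (continuous_apply l).sub _root_.continuous_const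
      refine ((ContinuousMap.isOpen_setOfPred_mapsTo hK ho).preimage hcont).mem_nhds ?_
      intro u _
      simpa using hε
    obtain ⟨_, ⟨h1, h2⟩, f, rfl⟩ := mem_closure_iff_nhds.1 hg _ (inter_mem (hn k) (hn (k + 1)))
    have h1 : ∀ u : J, (u : ℝ) ∈ Set.uIcc (s : ℝ) t → q ((D ^ k) f u - g k u) < ε :=
      fun u hu => h1 hu
    have h2 : ∀ u : J, (u : ℝ) ∈ Set.uIcc (s : ℝ) t → q ((D ^ (k + 1)) f u - g (k + 1) u) < ε :=
      fun u hu => h2 hu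
    have hd : HasDeriv ((D ^ k) f) ((D ^ (k + 1)) f) := by
      rw [pow_succ', Module.End.mul_apply]
      exact hasDeriv_D _
    have h3 := hd.seminorm_sub_le hJ hq (g (k + 1) t) (c := c + ε) (s := s) (t := t) fun u hu => by
      have := map_add_le_add q ((D ^ (k + 1)) f u - g (k + 1) u) (g (k + 1) u - g (k + 1) t)
      rw [sub_add_sub_cancel] at this
      linarith [hc u hu, h2 u hu]
    have h4 := h1 s Set.left_mem_uIcc
    have h5 := h1 t Set.right_mem_uIcc
    have e : g k s - g k t - (((s : ℝ) - t : ℝ) : ℂ) • g (k + 1) t =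
        ((D ^ k) f s - (D ^ k) f t - (((s : ℝ) - t : ℝ) : ℂ) • g (k + 1) t) -
          ((D ^ k) f s - g k s) + ((D ^ k) f t - g k t) := by abel
    rw [e]
    have h6 := map_add_le_add q (((D ^ k) f s - (D ^ k) f t - (((s : ℝ) - t : ℝ) : ℂ) • g (k + 1) t) -
          ((D ^ k) f s - g k s)) ((D ^ k) f t - g k t)
    have h7 := map_sub_le_add q ((D ^ k) f s - (D ^ k) f t - (((s : ℝ) - t : ℝ) : ℂ) • g (k + 1) t)
      ((D ^ k) f s - g k s)
    linarith
  refine le_of_forall_pos_le_add fun δ hδ => ?_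
  have hpos : 0 < |(s : ℝ) - t| + 2 := by positivity
  -- This choice of `ε` makes the total error exactly `δ`.
  have := key (δ / (|(s : ℝ) - t| + 2)) (by positivity)
  have e : (c + δ / (|(s : ℝ) - t| + 2)) * |(s : ℝ) - t| + 2 * (δ / (|(s : ℝ) - t| + 2)) =
      c * |(s : ℝ) - t| + δ := by
    field_simp
    ring
  rwa [e] at this

/-- The jet embeds the smooth functions as a closed subgroup of a countable product of spaces `C(J,
X)`, which are complete because `J` is locally compact. -/
theorem completeSpace [CompleteSpace X] (hJ : (J : Set ℝ).OrdConnected) :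
    @CompleteSpace (SmoothFun J X) (IsTopologicalAddGroup.rightUniformSpace _) := by
  let _ : UniformSpace (SmoothFun J X) := IsTopologicalAddGroup.rightUniformSpace _
  have : IsUniformAddGroup (SmoothFun J X) := isUniformAddGroup_of_addCommGroup
  have : LocallyCompactSpace J := J.isOpen.locallyCompactSpace
  have : IsUniformAddGroup C(J, X) := IsUniformInducing.isUniformAddGroup
    ({ toFun := ContinuousMap.toUniformOnFunIsCompact, map_zero' := rfl, map_add' _ _ := rfl } :
      C(J, X) →+ UniformOnFun J X {K | IsCompact K})
    ContinuousMap.isUniformEmbedding_toUniformOnFunIsCompact.isUniformInducing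
  rw [completeSpace_iff_isComplete_range
    (AddMonoidHom.isUniformInducing_of_isInducing (f := (jet : SmoothFun J X →+ (ℕ → C(J, X)))) isInducing_jet)]
  exact (isClosed_range_jet hJ).isComplete

end SmoothFun

end Complete

end SmoothSpace

/-! ### The operators on chains -/

section WordTopology

variable {U M : Type*} [Ring U] [TopologicalSpace U] [AddCommGroup M] [TopologicalSpace M]
  [IsTopologicalAddGroup M]

theorem continuous_merge {β : U → U → U} (hβ : Continuous fun p : U × U => β p.1 p.2) (m : ℕ) :
    Continuous (merge β m) := by
  refine continuous_pi fun i => ?_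
  simp only [merge]
  split_ifs
  · exact continuous_apply _
  · exact hβ.comp (by fun_prop : Continuous fun x : ℕ → U => (x m, x (m + 1)))
  · exact continuous_apply _

theorem continuous_app {D : U → U} (hD : Continuous D) (p : ℕ) : Continuous (app D p) :=
  continuous_id.update p (hD.comp (continuous_apply p))

theorem continuous_rot (n j : ℕ) : Continuous (rot n j : (ℕ → U) → ℕ → U) := by
  refine continuous_pi fun i => ?_
  simp only [rot]
  split_ifs <;> exact continuous_apply _

theorem continuous_ins : Continuous (ins : (ℕ → U) → ℕ → U) := by
  refine continuous_pi fun i => ?_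
  simp only [ins]
  split_ifs
  · exact continuous_const
  · exact continuous_apply _

theorem continuous_face (hm : Continuous fun p : U × U => p.1 * p.2) (n k : ℕ) :
    Continuous (face n k : (ℕ → U) → ℕ → U) := by
  unfold face
  split_ifs
  · exact continuous_merge hm k
  · refine continuous_pi fun i => ?_
    split_ifs
    · exact hm.comp (by fun_prop : Continuous fun x : ℕ → U => (x n, x 0))
    · exact continuous_apply _

variable {g : (ℕ → U) → M}

theorem continuous_bF (hm : Continuous fun p : U × U => p.1 * p.2) (hg : Continuous g) (n : ℕ) :
    Continuous (bF n g) :=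
  continuous_finsetSum _ fun _ _ => (hg.comp (continuous_face hm _ _)).zsmul _

theorem continuous_BF (hg : Continuous g) (n : ℕ) : Continuous (BF n g) :=
  continuous_finsetSum _ fun _ _ => (hg.comp (continuous_ins.comp (continuous_rot _ _))).zsmul _

theorem continuous_lieF {D : U → U} (hD : Continuous D) (hg : Continuous g) (n : ℕ) :
    Continuous (lieF D n g) :=
  continuous_finsetSum _ fun _ _ => hg.comp (continuous_app hD _)

theorem continuous_iotaD (hm : Continuous fun p : U × U => p.1 * p.2) {D : U → U}
    (hD : Continuous D) (hg : Continuous g) : Continuous (iotaD D g) :=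
  hg.comp ((continuous_merge hm 0).comp (continuous_app hD 1))

theorem continuous_SD {D : U → U} (hD : Continuous D) (hg : Continuous g) (n : ℕ) :
    Continuous (SD D n g) :=
  continuous_finsetSum _ fun _ _ => continuous_finsetSum _ fun _ _ =>
    (hg.comp (continuous_ins.comp ((continuous_app hD _).comp (continuous_rot _ _)))).zsmul _

theorem continuous_iotaE (hm : Continuous fun p : U × U => p.1 * p.2) {E : U → U → U}
    (hE : Continuous fun p : U × U => E p.1 p.2) (hg : Continuous g) : Continuous (iotaE E g) :=
  (hg.comp ((continuous_merge hm 0).comp (continuous_merge hE 1))).neg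

theorem continuous_SE {E : U → U → U} (hE : Continuous fun p : U × U => E p.1 p.2)
    (hg : Continuous g) (n : ℕ) : Continuous (SE E n g) :=
  continuous_finsetSum _ fun _ _ => continuous_finsetSum _ fun _ _ =>
    (hg.comp (continuous_ins.comp ((continuous_merge hE _).comp (continuous_rot _ _)))).zsmul _

end WordTopology

/-! ### Additive maps commute with the operators on functions of words. -/

section WordMaps

variable {U M M' F : Type*} [Ring U] [AddCommGroup M] [AddCommGroup M'] [FunLike F M M']
  [AddMonoidHomClass F M M'] (T : F) (g : (ℕ → U) → M) (x : ℕ → U)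

theorem map_bF (n : ℕ) : T (bF n g x) = bF n (fun y => T (g y)) x := by
  simp only [bF, map_sum, map_zsmul]

theorem map_BF (n : ℕ) : T (BF n g x) = BF n (fun y => T (g y)) x := by
  simp only [BF, map_sum, map_zsmul]

theorem map_lieF (D : U → U) (n : ℕ) : T (lieF D n g x) = lieF D n (fun y => T (g y)) x := by
  simp only [lieF, map_sum]

theorem map_iotaD (D : U → U) : T (iotaD D g x) = iotaD D (fun y => T (g y)) x := rfl

theorem map_SD (D : U → U) (n : ℕ) : T (SD D n g x) = SD D n (fun y => T (g y)) x := by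
  simp only [SD, map_sum, map_zsmul]

theorem map_iotaE (E : U → U → U) : T (iotaE E g x) = iotaE E (fun y => T (g y)) x := by
  simp only [iotaE, map_neg]

theorem map_SE (E : U → U → U) (n : ℕ) : T (SE E n g x) = SE E n (fun y => T (g y)) x := by
  simp only [SE, map_sum, map_zsmul]

end WordMaps

/-! ### Additivity of the word operators in the cochain. -/

section WordDifference

variable {U M : Type*} [Ring U] [AddCommGroup M] {g : (ℕ → U) → M} {n : ℕ}

theorem merge_eq_update (β : U → U → U) (m : ℕ) (x : ℕ → U) :
    merge β m x = Function.update (merge (fun _ _ => 0) m x) m (β (x m) (x (m + 1))) := by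
  funext i
  simp only [merge, Function.update_apply]
  grind

theorem lieF_sub (ha : ∀ k ≤ n, AddAt k g) (D D' : U → U) (x : ℕ → U) :
    lieF (fun u => D u - D' u) n g x = lieF D n g x - lieF D' n g x := by
  simp only [lieF, ← Finset.sum_sub_distrib]
  exact Finset.sum_congr rfl fun i hi =>
    (ha i (Nat.lt_succ_iff.1 (Finset.mem_range.1 hi))).map_sub _ _ _

theorem iotaE_sub (ha : AddAt 0 g) (E E' : U → U → U) (x : ℕ → U) :
    iotaE (fun u v => E u v - E' u v) g x = iotaE E g x - iotaE E' g x := by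
  have key : ∀ E : U → U → U, merge (· * ·) 0 (merge E 1 x) =
      Function.update (merge (fun _ _ => 0) 0 (merge (fun _ _ => 0) 1 x)) 0 (x 0 * E (x 1) (x 2)) :=
    fun E => by
      funext i
      simp only [merge, Function.update_apply]
      grind
  simp only [iotaE, key, mul_sub, ha.map_sub]
  abel

theorem SE_sub (ha : ∀ k ≤ n, AddAt k g) (E E' : U → U → U) (x : ℕ → U) :
    SE (fun u v => E u v - E' u v) n g x = SE E n g x - SE E' n g x := by
  simp only [SE, ← Finset.sum_sub_distrib, ← smul_sub]
  refine Finset.sum_congr rfl fun j _ => Finset.sum_congr rfl fun m hm => ?_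
  have key : ∀ (w : ℕ → U) (u : U),
      ins (Function.update w m u) = Function.update (ins w) (m + 1) u := fun w u => by
    funext i
    simp only [ins, Function.update_apply]
    grind
  rw [merge_eq_update, merge_eq_update E, merge_eq_update E', key, key, key,
    (ha (m + 1) (Finset.mem_Ico.1 hm).2).map_sub]

end WordDifference

section Operators

variable {R : Type} {A : Type*} [CommRing R] [Algebra ℂ R] [TopologicalSpace R]
  [ContinuousConstSMul R R]
  [NonUnitalRing A] [Module ℂ A] [Module R A] [IsScalarTower ℂ R A] [IsScalarTower R A A]
  [SMulCommClass R A A] [TopologicalSpace A] [IsTopologicalAddGroup A] [ContinuousConstSMul R A]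

local notation "U" => Unitization R A

/-! #### The formulas as functions of words -/

theorem bFormula_eq (n : ℕ) : bFormula n = bF n (Chain.elem (R := R) (A := A) n) := by
  funext x
  rw [bFormula, bF, Finset.sum_range_succ _ (n + 1)]
  refine congrArg₂ (· + ·) (Finset.sum_congr rfl fun j hj => ?_) ?_
  · rw [face, if_pos (Finset.mem_range.1 hj)]
    rfl
  · rw [face, if_neg (lt_irrefl _)]

/-- The word that begins with $a_j$ is the rotation to the right by $n+1-j$. The unrotated terms
match directly, the others after reflecting the sum. -/
theorem BFormula_eq (n : ℕ) : BFormula n = BF n (Chain.elem (R := R) (A := A) (n + 1)) := by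
  funext x
  rw [BFormula, BF, Finset.sum_range_succ', Finset.sum_range_succ', ← Finset.sum_range_reflect]
  have hloc := (Chain.descends_elem (R := R) (A := A) (n + 1)).isLocal
  congr 1
  · refine Finset.sum_congr rfl fun j hj => ?_
    rw [Finset.mem_range] at hj
    congr 1
    -- The two exponents add up to $(n+1)n$, so the signs agree.
    · have h : Even ((n - 1 - j + 1) * n + (j + 1) * n) := by
        rw [← add_mul, show n - 1 - j + 1 + (j + 1) = n + 1 by omega, mul_comm]
        exact Nat.even_mul_succ_self n
      exact neg_one_pow_congr (Nat.even_add.1 h)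
    · refine hloc _ _ fun i hi => ?_
      simp only [ins, rot]
      by_cases h0 : i = 0
      · simp [h0]
      · rw [if_neg h0, if_neg h0]
        split_ifs with h
        · congr 1
          rw [Nat.mod_eq_of_lt (by omega)]
          omega
        · congr 1
          rw [Nat.mod_eq_sub_mod (by omega), Nat.mod_eq_of_lt (by omega)]
          omega
  · congr 1
    refine hloc _ _ fun i hi => ?_
    simp only [ins, rot]
    by_cases h0 : i = 0
    · simp [h0]
    · rw [if_neg h0, if_neg h0, Nat.mod_eq_of_lt (by omega), if_neg (by omega)]
      rfl

/-- The extension of a map `A → A` to `A₊` along a map `R → R`. -/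
def extendUnit (der : R → R) (nabla : A → A) (u : U) : U :=
  Unitization.inl (der u.fst) + (nabla u.snd : U)

/-- The extension of a `2`-cochain of `A` to `A₊` that vanishes if one of the arguments is `e`. -/
def extendCochain (E : A → A → A) (u v : U) : U := (E u.snd v.snd : U)

theorem iotaFormula_eq (E : A → A → A) (n : ℕ) :
    iotaFormula E n = iotaE (extendCochain E) (Chain.elem (R := R) n) := by
  funext x
  rw [iotaFormula, iotaE]
  congr 2
  funext i
  simp only [merge, extendCochain]
  grind

theorem sFormula_eq (E : A → A → A) (n : ℕ) :
    sFormula E n = SE (extendCochain E) n (Chain.elem (R := R) n) := by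
  funext x
  rw [sFormula, SE, sum_range_Ico_diag n fun m j =>
    (-1 : ℤ) ^ (m + j * n) • Chain.elem n (ins (merge (extendCochain E) m (rot n j x)))]
  have : Finset.Icc 1 (n - 1) = Finset.Ico 1 n := by
    ext i
    simp only [Finset.mem_Icc, Finset.mem_Ico]
    omega
  rw [this]
  refine Finset.sum_congr rfl fun i hi => Finset.sum_congr rfl fun j hj => ?_
  rw [Finset.mem_Ico] at hi
  rw [Finset.mem_range] at hj
  congr 1
  · obtain ⟨n, rfl⟩ : ∃ m, n = m + 1 := ⟨n - 1, by omega⟩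
    exact (neg_one_pow_congr' j (by rw [Nat.add_sub_cancel]; ring)).symm
  · refine congrArg _ (funext fun k => ?_)
    simp only [ins, merge, rot, extendCochain]
    have h1 : ¬ i + j < j := by omega
    have h2 : ¬ i + j + 1 < j := by omega
    have h3 : i + j + 1 - j = i + 1 := by omega
    simp only [h1, h2, h3, if_false, Nat.add_sub_cancel]
    rcases Nat.eq_zero_or_pos k with rfl | hk
    · rfl
    · obtain ⟨k, rfl⟩ : ∃ m, k = m + 1 := ⟨k - 1, by omega⟩
      simp only [Nat.add_sub_cancel]
      grind

end Operators

/-! ### Existence and continuity of $b$, $B$, $L_\nabla$, $\iota_E$ and $S_E$ on chains. -/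

section ExistenceOfOperators

variable {R : Type} {A : Type*} [CommRing R] [Algebra ℂ R] [TopologicalSpace R]
  [ContinuousConstSMul R R]
  [NonUnitalRing A] [Module ℂ A] [Module R A] [IsScalarTower ℂ R A] [IsScalarTower R A A]
  [SMulCommClass R A A] [TopologicalSpace A] [IsTopologicalAddGroup A] [ContinuousConstSMul R A]

local notation "U" => Unitization R A

@[simp] theorem fst_extendUnit (der : R → R) (nabla : A → A) (u : U) :
    (extendUnit der nabla u).fst = der u.fst := by simp [extendUnit]

@[simp] theorem snd_extendUnit (der : R → R) (nabla : A → A) (u : U) :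
    (extendUnit der nabla u).snd = nabla u.snd := by simp [extendUnit]

/-- The map `nabla` satisfies the Leibniz rule with respect to the continuous derivation `der`. -/
structure IsConnectionOver (der : R →+ R) (nabla : A →+ A) : Prop where
  continuous_der : Continuous der
  continuous : Continuous nabla
  der_mul : ∀ r s, der (r * s) = der r * s + r * der s
  leibniz : ∀ (r : R) a, nabla (r • a) = der r • a + r • nabla a
  der_complex : ∀ c : ℂ, der (c • 1) = 0

namespace IsConnectionOver

variable {der : R →+ R} {nabla : A →+ A} (h : IsConnectionOver der nabla)
include h

theorem continuous_extendUnit : Continuous (extendUnit der nabla) := by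
  refine Chain.continuous_unitization_iff.2 ⟨?_, ?_⟩
  · simp only [fst_extendUnit]
    exact h.continuous_der.comp Chain.continuous_fst
  · simp only [snd_extendUnit]
    exact h.continuous.comp Chain.continuous_snd

theorem extendUnit_smul (r : R) (u : U) :
    extendUnit der nabla (r • u) = der r • u + r • extendUnit der nabla u := by
  ext
  · simp [extendUnit, h.der_mul]
  · simp [extendUnit, h.leibniz]

theorem extendUnit_one : extendUnit der nabla (1 : U) = 0 := by
  have := h.der_complex 1
  rw [one_smul] at this
  ext <;> simp [extendUnit, this]

/-- The scalar parts cancel by the product rule in `R` and the mixed terms by the Leibniz rule.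
Hence the coboundary formed in $A_+$ is $\delta\nabla$ extended by zero, and the word identities
apply to the extended connection. -/
theorem cobd_extendUnit (u v : U) :
    cobd (extendUnit der nabla) u v = extendCochain (coboundary nabla) u v := by
  ext
  · simp only [cobd, sub_eq_add_neg, Unitization.fst_add, Unitization.fst_neg, Unitization.fst_mul,
      fst_extendUnit, h.der_mul, add_neg_cancel]
    rfl
  · simp only [cobd, sub_eq_add_neg, Unitization.snd_add, Unitization.snd_neg, Unitization.snd_mul,
      fst_extendUnit, snd_extendUnit, map_add, h.leibniz]
    simp only [extendCochain, coboundary, Unitization.snd_inr]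
    abel

/-- The coboundary of a connection is bilinear over `R`. -/
def coboundaryₗ : U →ₗ[R] U →ₗ[R] U :=
  LinearMap.mk₂ R (extendCochain (coboundary nabla))
    (fun u u' v => by
      simp only [extendCochain, coboundary, Unitization.snd_add, map_add, add_mul,
        ← Unitization.inr_add]
      congr 1; abel)
    -- The term containing `der r` from differentiating the first factor cancels the one from
    -- differentiating the product.
    (fun r u v => by
      simp only [extendCochain, coboundary, Unitization.snd_smul, h.leibniz, add_mul, smul_mul_assoc,
        ← Unitization.inr_smul]
      congr 1; rw [smul_sub, smul_add]; abel)
    (fun u v v' => by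
      simp only [extendCochain, coboundary, Unitization.snd_add, map_add, mul_add,
        ← Unitization.inr_add]
      congr 1; abel)
    (fun r u v => by
      simp only [extendCochain, coboundary, Unitization.snd_smul, h.leibniz, mul_add, mul_smul_comm,
        ← Unitization.inr_smul]
      congr 1; rw [smul_sub, smul_add]; abel)

end IsConnectionOver

theorem extendUnit_add (der : R →+ R) (nabla : A →+ A) (u v : U) :
    extendUnit der nabla (u + v) = extendUnit der nabla u + extendUnit der nabla v := by
  ext <;> simp [extendUnit]

theorem AddAt.comp_app {M : Type*} [AddCommGroup M] {g : (ℕ → U) → M} {k : ℕ} (ha : AddAt k g)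
    {D : U → U} (hD : ∀ u v, D (u + v) = D u + D v) (p : ℕ) : AddAt k fun x => g (app D p x) := by
  intro x u v
  by_cases hp : p = k
  · subst hp
    simp only [app, Function.update_self, Function.update_idem, hD, ha x]
  · simp only [app, Function.update_of_ne hp]
    simp only [Function.update_comm (Ne.symm hp)]
    exact ha _ _ _

/-- Only the summand that differentiates the letter `k` sees `der r`. The right side does not depend
on `k`: this gives both the descent of $L_\nabla$ to tensor products over `R` and its Leibniz rule.
-/
theorem lieF_smul {M : Type*} [AddCommGroup M] [Module R M] {n : ℕ} {g : (ℕ → U) → M}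
    (hg : IsMultilin n g) {der : R →+ R} {nabla : A →+ A} (h : IsConnectionOver der nabla)
    {k : ℕ} (hk : k ≤ n) (x : ℕ → U) (r : R) :
    lieF (extendUnit der nabla) n g (Function.update x k (r • x k)) =
      der r • g x + r • lieF (extendUnit der nabla) n g x := by
  have hk' : k ∈ Finset.range (n + 1) := Finset.mem_range.2 (Nat.lt_succ_iff.2 hk)
  have e : ∀ i, g (app (extendUnit der nabla) i (Function.update x k (r • x k))) =
      r • g (app (extendUnit der nabla) i x) + if i = k then der r • g x else 0 := fun i => by
    by_cases hi : i = k
    · subst hi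
      rw [if_pos rfl]
      simp only [app, Function.update_self, Function.update_idem, h.extendUnit_smul]
      rw [hg.add _ hk, hg.smul _ hk, hg.smul _ hk, Function.update_eq_self, add_comm]
    · rw [if_neg hi, add_zero]
      simp only [app, Function.update_of_ne hi]
      rw [Function.update_comm (Ne.symm hi), hg.smul _ hk, Function.update_comm hi,
        Function.update_eq_self]
  simp only [lieF, e, Finset.sum_add_distrib, ← Finset.smul_sum, Finset.sum_ite_eq', if_pos hk']
  rw [add_comm]

theorem descends_lieF_elem (der : R → R) (nabla : A → A) (n : ℕ) :
    Descends n (lieF (extendUnit der nabla) n (Chain.elem (R := R) n)) :=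
  (Chain.descends_elem n).lieF fun u v e => by simp [e]

theorem extendCochain_congr (E : A → A → A) (u u' v v' : U) (h : u.snd = u'.snd)
    (h' : v.snd = v'.snd) : extendCochain E u v = extendCochain E u' v' := by
  rw [extendCochain, extendCochain, h, h']

variable [ContinuousMul R] [ContinuousMul A] [ContinuousSMul R A]

theorem continuous_unitization_mul : Continuous fun p : U × U => p.1 * p.2 := by
  have h1 : Continuous fun p : U × U => p.1.fst := Chain.continuous_fst.comp continuous_fst
  have h2 : Continuous fun p : U × U => p.2.fst := Chain.continuous_fst.comp continuous_snd
  have h3 : Continuous fun p : U × U => p.1.snd := Chain.continuous_snd.comp continuous_fst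
  have h4 : Continuous fun p : U × U => p.2.snd := Chain.continuous_snd.comp continuous_snd
  refine Chain.continuous_unitization_iff.2 ⟨?_, ?_⟩
  · simp only [Unitization.fst_mul]
    exact h1.mul h2
  · simp only [Unitization.snd_mul]
    exact ((h1.smul h4).add (h2.smul h3)).add (h3.mul h4)

theorem IsConnectionOver.continuous_extendCochain {der : R →+ R} {nabla : A →+ A}
    (h : IsConnectionOver der nabla) :
    Continuous fun p : U × U => extendCochain (coboundary nabla) p.1 p.2 := by
  have h3 : Continuous fun p : U × U => p.1.snd := Chain.continuous_snd.comp continuous_fst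
  have h4 : Continuous fun p : U × U => p.2.snd := Chain.continuous_snd.comp continuous_snd
  have hn := h.continuous
  refine Chain.continuous_unitization_iff.2 ⟨?_, ?_⟩
  · exact continuous_const
  · exact (((hn.comp h3).mul h4).add (h3.mul (hn.comp h4))).sub (hn.comp (h3.mul h4))

variable [T2Space A] (hA : HasSeminormNhds A)
  (hAc : @CompleteSpace A (IsTopologicalAddGroup.rightUniformSpace A))
include hA hAc

theorem hochschildB_actsBy (n : ℕ) : ActsBy (hochschildB R A n) (bFormula n) := by
  refine extend_actsBy (exists_actsBy hA hAc ?_ ?_ ?_) <;> rw [bFormula_eq]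
  · exact (Chain.descends_elem n).bF (Chain.isMultilin_elem n)
  · exact (Chain.isMultilin_elem n).bF
  · exact continuous_bF continuous_unitization_mul (Chain.continuous_elem n) n

theorem connesB_actsBy (n : ℕ) : ActsBy (connesB R A n) (BFormula n) := by
  refine extend_actsBy (exists_actsBy hA hAc ?_ ?_ ?_) <;> rw [BFormula_eq]
  · exact (Chain.descends_elem (n + 1)).BF
  · exact (Chain.isMultilin_elem (n + 1)).BF
  · exact continuous_BF (Chain.continuous_elem (n + 1)) n

theorem hochschildB_elem (n : ℕ) (x : ℕ → U) :
    hochschildB R A n (Chain.elem (n + 1) x) = bF n (Chain.elem n) x := by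
  rw [(hochschildB_actsBy hA hAc n).apply_elem, bFormula_eq]
  rw [bFormula_eq]
  exact (Chain.descends_elem n).bF (Chain.isMultilin_elem n)

theorem connesB_elem (n : ℕ) (x : ℕ → U) :
    connesB R A n (Chain.elem n x) = BF n (Chain.elem (n + 1)) x := by
  rw [(connesB_actsBy hA hAc n).apply_elem, BFormula_eq]
  rw [BFormula_eq]
  exact (Chain.descends_elem (n + 1)).BF

namespace IsConnectionOver

variable {der : R →+ R} {nabla : A →+ A} (h : IsConnectionOver der nabla)
include h

theorem lie_actsBy (n : ℕ) : ActsBy (lie der nabla n) (lieFormula (R := R) der nabla n) := by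
  have hsm := fun k hk x r => lieF_smul (Chain.isMultilin_elem (R := R) (A := A) n) h (k := k) hk x r
  refine extend_actsBy (exists_actsBy_complex hA hAc (descends_lieF_elem _ _ n) (fun k hk => ?_)
    (fun k hk x r => ?_) (fun x c => ?_) ?_)
  · exact AddAt.sum fun i _ => ((Chain.isMultilin_elem n).add k hk).comp_app (extendUnit_add der nabla) i
  · exact (hsm k hk x r).trans (hsm 0 (Nat.zero_le n) x r).symm
  · rw [complex_smul_eq (R := R) c (x 0), complex_smul_eq (R := R) c (lieFormula der nabla n x)]
    refine (hsm 0 (Nat.zero_le n) x _).trans ?_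
    -- Complex linearity survives because the derivation kills constants.
    rw [h.der_complex, zero_smul, zero_add]
    rfl
  · exact continuous_lieF h.continuous_extendUnit (Chain.continuous_elem n) n

theorem lie_elem (n : ℕ) (x : ℕ → U) : lie der nabla n (Chain.elem n x) =
    lieF (extendUnit der nabla) n (Chain.elem n) x :=
  (h.lie_actsBy hA hAc n).apply_elem (descends_lieF_elem _ _ n) x

theorem iota_actsBy (n : ℕ) : ActsBy (iota R (coboundary nabla) n) (iotaFormula (coboundary nabla) n) := by
  refine extend_actsBy (exists_actsBy hA hAc ?_ ?_ ?_) <;> rw [iotaFormula_eq]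
  · exact (Chain.descends_elem n).iotaE (extendCochain_congr _)
  · exact (Chain.isMultilin_elem n).iotaE h.coboundaryₗ
  · exact continuous_iotaE continuous_unitization_mul h.continuous_extendCochain
      (Chain.continuous_elem n)

theorem iota_elem (n : ℕ) (x : ℕ → U) : iota R (coboundary nabla) n (Chain.elem (n + 2) x) =
    iotaE (extendCochain (coboundary nabla)) (Chain.elem n) x := by
  rw [(h.iota_actsBy hA hAc n).apply_elem, iotaFormula_eq]
  rw [iotaFormula_eq]
  exact (Chain.descends_elem n).iotaE (extendCochain_congr _)

theorem cyclicS_actsBy (n : ℕ) :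
    ActsBy (cyclicS R (coboundary nabla) n) (sFormula (coboundary nabla) n) := by
  refine extend_actsBy (exists_actsBy hA hAc ?_ ?_ ?_) <;> rw [sFormula_eq]
  · exact (Chain.descends_elem n).SE (extendCochain_congr _)
  · exact (Chain.isMultilin_elem n).SE h.coboundaryₗ
  · exact continuous_SE h.continuous_extendCochain (Chain.continuous_elem n) n

theorem cyclicS_elem (n : ℕ) (x : ℕ → U) : cyclicS R (coboundary nabla) n (Chain.elem n x) =
    SE (extendCochain (coboundary nabla)) n (Chain.elem n) x := by
  rw [(h.cyclicS_actsBy hA hAc n).apply_elem, sFormula_eq]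
  rw [sFormula_eq]
  exact (Chain.descends_elem n).SE (extendCochain_congr _)

end IsConnectionOver

end ExistenceOfOperators

/-! ### Identities between the operators on chains -/

section OperatorIdentities

variable {R : Type} {A : Type*} [CommRing R] [Algebra ℂ R] [TopologicalSpace R]
  [ContinuousConstSMul R R]
  [NonUnitalRing A] [Module ℂ A] [Module R A] [IsScalarTower ℂ R A] [IsScalarTower R A A]
  [SMulCommClass R A A] [TopologicalSpace A] [IsTopologicalAddGroup A] [ContinuousConstSMul R A]

local notation "U" => Unitization R A

/-- Continuous additive functions on chains that agree on the elementary chains are equal. -/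
theorem Chain.eq_of_elem {n : ℕ} {M : Type*} [AddCommGroup M] [TopologicalSpace M] [T2Space M]
    {f g : Chain R A n → M} (hf : Continuous f) (hg : Continuous g)
    (hfa : ∀ z w, f (z + w) = f z + f w) (hga : ∀ z w, g (z + w) = g z + g w)
    (h : ∀ x, f (elem n x) = g (elem n x)) : ∀ z, f z = g z :=
  Chain.hom_ext (S := AddMonoidHom.mk' f hfa) (T := AddMonoidHom.mk' g hga) hf hg h

theorem Chain.isNormalized_elem (n : ℕ) : IsNormalized n (elem (R := R) (A := A) n) :=
  (descends_elem n).isNormalized (isMultilin_elem n).add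

theorem IsConnectionOver.cobd_eq {der : R →+ R} {nabla : A →+ A} (h : IsConnectionOver der nabla) :
    extendCochain (coboundary nabla) = cobd (extendUnit (R := R) der nabla) := by
  funext u v
  exact (h.cobd_extendUnit u v).symm

theorem IsConnectionOver.sub {der : R →+ R} {nabla nabla' : A →+ A}
    (h : IsConnectionOver der nabla) (h' : IsConnectionOver der nabla') :
    IsConnectionOver (0 : R →+ R) (nabla - nabla') where
  continuous_der := continuous_const
  continuous := h.continuous.sub h'.continuous
  der_mul r s := by simp
  leibniz r a := by
    simp only [AddMonoidHom.sub_apply, h.leibniz, h'.leibniz, AddMonoidHom.zero_apply, zero_smul,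
      smul_sub]
    abel
  der_complex c := rfl

theorem extendCochain_coboundary_sub (nabla nabla' : A →+ A) :
    extendCochain (R := R) (coboundary (nabla - nabla' : A →+ A)) = fun u v =>
      extendCochain (coboundary nabla) u v - extendCochain (coboundary nabla') u v := by
  funext u v
  simp only [extendCochain, coboundary, ← Unitization.inr_sub, AddMonoidHom.sub_apply, sub_mul,
    mul_sub]
  congr 1
  abel

/-- The contraction of chains with a `1`-cochain. -/
def iotaOne (R : Type) {A : Type*} [CommRing R] [Algebra ℂ R] [TopologicalSpace R]
    [ContinuousConstSMul R R] [NonUnitalRing A] [Module ℂ A] [Module R A] [IsScalarTower ℂ R A]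
    [IsScalarTower R A A] [SMulCommClass R A A] [TopologicalSpace A] [IsTopologicalAddGroup A]
    [ContinuousConstSMul R A] (D : A → A) (n : ℕ) : Chain R A (n + 1) →L[R] Chain R A n :=
  extend R _ _ (iotaD (extendUnit 0 D) (Chain.elem n))

/-- The cyclic correction of the contraction with a `1`-cochain. -/
def cyclicSOne (R : Type) {A : Type*} [CommRing R] [Algebra ℂ R] [TopologicalSpace R]
    [ContinuousConstSMul R R] [NonUnitalRing A] [Module ℂ A] [Module R A] [IsScalarTower ℂ R A]
    [IsScalarTower R A A] [SMulCommClass R A A] [TopologicalSpace A] [IsTopologicalAddGroup A]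
    [ContinuousConstSMul R A] (D : A → A) (n : ℕ) : Chain R A n →L[R] Chain R A (n + 1) :=
  extend R _ _ (SD (extendUnit 0 D) n (Chain.elem (n + 1)))

variable [ContinuousMul R] [ContinuousMul A] [ContinuousSMul R A]
variable [T2Space A] (hA : HasSeminormNhds A)
  (hAc : @CompleteSpace A (IsTopologicalAddGroup.rightUniformSpace A))
include hA hAc

namespace IsConnectionOver

section Homotopy

variable {D : A →+ A} (h : IsConnectionOver (0 : R →+ R) D)
include h

theorem iotaOne_elem (n : ℕ) (x : ℕ → U) : iotaOne R D n (Chain.elem (n + 1) x) =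
    iotaD (extendUnit 0 D) (Chain.elem n) x := by
  have hd : Descends (n + 1) (iotaD (extendUnit 0 D) (Chain.elem (R := R) (A := A) n)) :=
    (Chain.descends_elem n).iotaD fun u v e => by simp [extendUnit, e]
  -- With derivation `0` the Leibniz rule is `R`-linearity, so contraction with the cochain is
  -- multilinear.
  let D' : U →ₗ[R] U :=
    { toFun := extendUnit (0 : R →+ R) D
      map_add' := extendUnit_add 0 D
      map_smul' := fun r u => by simp [h.extendUnit_smul] }
  refine (extend_actsBy (exists_actsBy hA hAc hd ?_ ?_)).apply_elem hd x
  · exact (Chain.isMultilin_elem n).iotaD D'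
  · exact continuous_iotaD continuous_unitization_mul h.continuous_extendUnit
      (Chain.continuous_elem n)

theorem cyclicSOne_elem (n : ℕ) (x : ℕ → U) : cyclicSOne R D n (Chain.elem n x) =
    SD (extendUnit 0 D) n (Chain.elem (n + 1)) x := by
  have hd : Descends n (SD (extendUnit 0 D) n (Chain.elem (R := R) (A := A) (n + 1))) :=
    (Chain.descends_elem (n + 1)).SD fun u v e => by simp [e]
  let D' : U →ₗ[R] U :=
    { toFun := extendUnit (0 : R →+ R) D
      map_add' := extendUnit_add 0 D
      map_smul' := fun r u => by simp [h.extendUnit_smul] }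
  refine (extend_actsBy (exists_actsBy hA hAc hd ?_ ?_)).apply_elem hd x
  · exact (Chain.isMultilin_elem (n + 1)).SD D'
  · exact continuous_SD h.continuous_extendUnit (Chain.continuous_elem (n + 1)) n

theorem hochschildB_iotaOne (n : ℕ) (z : Chain R A (n + 2)) :
    hochschildB R A n (iotaOne R D (n + 1) z) + iotaOne R D n (hochschildB R A (n + 1) z) =
      -iota R (coboundary D) n z := by
  revert z
  refine Chain.eq_of_elem (by fun_prop) (by fun_prop) (fun z w => by simp only [map_add]; abel)
    (fun z w => by simp only [map_add]; abel) fun x => ?_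
  simp only [h.iotaOne_elem hA hAc, hochschildB_elem hA hAc, h.iota_elem hA hAc, map_iotaD, map_bF]
  rw [h.cobd_eq]
  exact iotaD_bF_add (Chain.isMultilin_elem n).isLocal
    ((Chain.isMultilin_elem n).add 0 (Nat.zero_le n)) _ x

theorem cyclicSOne_zero (z : Chain R A 0) : cyclicSOne R D 0 z = 0 := by
  revert z
  refine Chain.eq_of_elem (by fun_prop) continuous_const (fun z w => by simp only [map_add])
    (fun z w => by simp) fun x => ?_
  rw [h.cyclicSOne_elem hA hAc, SD_zero]

theorem iotaOne_connesB_zero (z : Chain R A 0) :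
    iotaOne R D 0 (connesB R A 0 z) = lie 0 D 0 z := by
  revert z
  refine Chain.eq_of_elem (by fun_prop) (by fun_prop) (fun z w => by simp only [map_add])
    (fun z w => by simp only [map_add]) fun x => ?_
  have hl := h.lie_elem hA hAc 0 x
  rw [connesB_elem hA hAc, map_BF]
  simp only [h.iotaOne_elem hA hAc]
  exact (homotopy_formula_zero (Chain.isMultilin_elem 0).isLocal _ x).trans hl.symm

theorem homotopy_succ (n : ℕ) (z : Chain R A (n + 1)) :
    hochschildB R A (n + 1) (cyclicSOne R D (n + 1) z) + cyclicSOne R D n (hochschildB R A n z) +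
        connesB R A n (iotaOne R D n z) + iotaOne R D (n + 1) (connesB R A (n + 1) z) =
      lie 0 D (n + 1) z - cyclicS R (coboundary D) (n + 1) z := by
  revert z
  refine Chain.eq_of_elem (by fun_prop) (by fun_prop) (fun z w => by simp only [map_add]; abel)
    (fun z w => by simp only [map_add]; abel) fun x => ?_
  have hl := h.lie_elem hA hAc (n + 1) x
  rw [show lie (0 : R → R) D (n + 1) (Chain.elem (n + 1) x) = _ from hl]
  simp only [h.iotaOne_elem hA hAc, h.cyclicSOne_elem hA hAc, hochschildB_elem hA hAc,
    connesB_elem hA hAc, h.cyclicS_elem hA hAc, map_iotaD, map_bF, map_BF, map_SD]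
  rw [h.cobd_eq]
  exact homotopy_formula (Chain.isMultilin_elem (n + 1)).isLocal
    (Chain.isMultilin_elem (n + 1)).add _ x

theorem connesB_cyclicSOne (n : ℕ) (z : Chain R A n) :
    connesB R A (n + 1) (cyclicSOne R D n z) = 0 := by
  revert z
  refine Chain.eq_of_elem (by fun_prop) continuous_const (fun z w => by simp only [map_add])
    (fun z w => by simp) fun x => ?_
  simp only [h.cyclicSOne_elem hA hAc, connesB_elem hA hAc, map_SD]
  exact SD_BF (Chain.isNormalized_elem (n + 2)) _ x

theorem cyclicSOne_connesB (n : ℕ) (z : Chain R A n) :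
    cyclicSOne R D (n + 1) (connesB R A n z) = 0 := by
  revert z
  refine Chain.eq_of_elem (by fun_prop) continuous_const (fun z w => by simp only [map_add])
    (fun z w => by simp) fun x => ?_
  simp only [h.cyclicSOne_elem hA hAc, connesB_elem hA hAc, map_BF]
  exact BF_SD (Chain.isNormalized_elem (n + 2)) _ x

end Homotopy

variable {der : R →+ R} {nabla nabla' : A →+ A} (h : IsConnectionOver der nabla)
include h

/-- By density it is enough to treat elementary chains, where the word identity is applied to the
extended connection. The contraction with $\nabla$ is used in its proof only on words and need not
be an operator over `R`. The same holds for `hochschildB_lie_zero` and `hochschildB_lie_succ`. -/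
theorem hochschildB_iota (n : ℕ) (z : Chain R A (n + 3)) :
    hochschildB R A n (iota R (coboundary nabla) (n + 1) z) =
      iota R (coboundary nabla) n (hochschildB R A (n + 2) z) := by
  revert z
  refine Chain.eq_of_elem (by fun_prop) (by fun_prop) (fun z w => by simp only [map_add])
    (fun z w => by simp only [map_add]) fun x => ?_
  simp only [h.iota_elem hA hAc, hochschildB_elem hA hAc, map_bF, map_iotaE]
  rw [h.cobd_eq]
  exact iotaE_bF (Chain.isMultilin_elem n).isLocal
    ((Chain.isMultilin_elem n).add 0 (Nat.zero_le n))
    ((Chain.isMultilin_elem n).bF.add 0 (Nat.zero_le _)) _ x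

theorem cyclicS_zero (z : Chain R A 0) : cyclicS R (coboundary nabla) 0 z = 0 := by
  revert z
  refine Chain.eq_of_elem (by fun_prop) continuous_const (fun z w => by simp only [map_add])
    (fun z w => by simp) fun x => ?_
  rw [h.cyclicS_elem hA hAc, SE_zero]

theorem hochschildB_lie_zero (z : Chain R A 1) :
    hochschildB R A 0 (lie der nabla 1 z) -
        hochschildB R A 0 (cyclicS R (coboundary nabla) 1 z) =
      lie der nabla 0 (hochschildB R A 0 z) -
        iota R (coboundary nabla) 0 (connesB R A 1 z) := by
  revert z
  refine Chain.eq_of_elem (by fun_prop) (by fun_prop) (fun z w => by simp only [map_add]; abel)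
    (fun z w => by simp only [map_add]; abel) fun x => ?_
  simp only [h.iota_elem hA hAc, h.lie_elem hA hAc, h.cyclicS_elem hA hAc,
    hochschildB_elem hA hAc, connesB_elem hA hAc, map_bF, map_BF, map_SE, map_lieF]
  rw [h.cobd_eq]
  exact lieF_bF_zero (Chain.isMultilin_elem 0).isLocal ((Chain.isMultilin_elem 0).add 0 le_rfl)
    (Chain.isMultilin_elem 0).bF.add _ x

theorem hochschildB_lie_succ (n : ℕ) (z : Chain R A (n + 2)) :
    hochschildB R A (n + 1) (lie der nabla (n + 2) z) -
        hochschildB R A (n + 1) (cyclicS R (coboundary nabla) (n + 2) z) -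
        connesB R A n (iota R (coboundary nabla) n z) =
      lie der nabla (n + 1) (hochschildB R A (n + 1) z) -
        cyclicS R (coboundary nabla) (n + 1) (hochschildB R A (n + 1) z) -
        iota R (coboundary nabla) (n + 1) (connesB R A (n + 2) z) := by
  revert z
  refine Chain.eq_of_elem (by fun_prop) (by fun_prop) (fun z w => by simp only [map_add]; abel)
    (fun z w => by simp only [map_add]; abel) fun x => ?_
  simp only [h.iota_elem hA hAc, h.lie_elem hA hAc, h.cyclicS_elem hA hAc,
    hochschildB_elem hA hAc, connesB_elem hA hAc, map_bF, map_BF, map_SE, map_lieF, map_iotaE]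
  rw [h.cobd_eq]
  exact lieF_bF_succ (Chain.isMultilin_elem (n + 1)).isLocal (Chain.isMultilin_elem (n + 1)).add
    (Chain.isMultilin_elem (n + 1)).bF.add
    ((Chain.isMultilin_elem (n + 1)).BF.add 0 (Nat.zero_le _)) _ x

theorem connesB_lie (n : ℕ) (z : Chain R A n) :
    connesB R A n (lie der nabla n z) = lie der nabla (n + 1) (connesB R A n z) := by
  revert z
  refine Chain.eq_of_elem (by fun_prop) (by fun_prop) (fun z w => by simp only [map_add])
    (fun z w => by simp only [map_add]) fun x => ?_
  simp only [h.lie_elem hA hAc, connesB_elem hA hAc, map_BF, map_lieF]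
  exact lieF_BF (Chain.isMultilin_elem (n + 1)).isLocal
    ((Chain.isMultilin_elem (n + 1)).add 0 (Nat.zero_le _)) _ h.extendUnit_one x

theorem connesB_cyclicS (n : ℕ) (z : Chain R A n) :
    connesB R A n (cyclicS R (coboundary nabla) n z) = 0 := by
  revert z
  refine Chain.eq_of_elem (by fun_prop) continuous_const (fun z w => by simp only [map_add])
    (fun z w => by simp) fun x => ?_
  simp only [h.cyclicS_elem hA hAc, connesB_elem hA hAc, map_SE]
  exact SE_BF (Chain.isNormalized_elem (n + 1)) _ x

theorem cyclicS_connesB (n : ℕ) (z : Chain R A n) :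
    cyclicS R (coboundary nabla) (n + 1) (connesB R A n z) = 0 := by
  revert z
  refine Chain.eq_of_elem (by fun_prop) continuous_const (fun z w => by simp only [map_add])
    (fun z w => by simp) fun x => ?_
  simp only [h.cyclicS_elem hA hAc, connesB_elem hA hAc, map_BF]
  exact BF_SE (Chain.isNormalized_elem (n + 1)) _ x

theorem lie_smul (n : ℕ) (r : R) (z : Chain R A n) :
    lie der nabla n (r • z) = der r • z + r • lie der nabla n z := by
  revert z
  refine Chain.eq_of_elem (by fun_prop) (by fun_prop)
    (fun z w => by simp only [map_add, smul_add])
    (fun z w => by simp only [map_add, smul_add]; abel) fun x => ?_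
  rw [Chain.smul_elem, h.lie_elem hA hAc, h.lie_elem hA hAc]
  exact lieF_smul (Chain.isMultilin_elem n) h (Nat.zero_le n) x r

theorem lie_sub (h' : IsConnectionOver der nabla') (n : ℕ) (z : Chain R A n) :
    lie 0 (nabla - nabla' : A →+ A) n z = lie der nabla n z - lie der nabla' n z := by
  revert z
  refine Chain.eq_of_elem (by fun_prop) (by fun_prop) (fun z w => by simp only [map_add])
    (fun z w => by simp only [map_add]; abel) fun x => ?_
  have hl := (h.sub h').lie_elem hA hAc n x
  rw [show lie (0 : R → R) (nabla - nabla' : A →+ A) n (Chain.elem n x) = _ from hl,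
    h.lie_elem hA hAc, h'.lie_elem hA hAc, ← lieF_sub (Chain.isMultilin_elem n).add]
  congr 1
  funext u
  ext <;> simp [sub_eq_add_neg]

theorem iota_sub (h' : IsConnectionOver der nabla') (n : ℕ) (z : Chain R A (n + 2)) :
    iota R (coboundary (nabla - nabla' : A →+ A)) n z =
      iota R (coboundary nabla) n z - iota R (coboundary nabla') n z := by
  revert z
  refine Chain.eq_of_elem (by fun_prop) (by fun_prop) (fun z w => by simp only [map_add])
    (fun z w => by simp only [map_add]; abel) fun x => ?_
  rw [(h.sub h').iota_elem hA hAc, h.iota_elem hA hAc, h'.iota_elem hA hAc,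
    extendCochain_coboundary_sub, iotaE_sub ((Chain.isMultilin_elem n).add 0 (Nat.zero_le n))]

theorem cyclicS_sub (h' : IsConnectionOver der nabla') (n : ℕ) (z : Chain R A n) :
    cyclicS R (coboundary (nabla - nabla' : A →+ A)) n z =
      cyclicS R (coboundary nabla) n z - cyclicS R (coboundary nabla') n z := by
  revert z
  refine Chain.eq_of_elem (by fun_prop) (by fun_prop) (fun z w => by simp only [map_add])
    (fun z w => by simp only [map_add]; abel) fun x => ?_
  rw [(h.sub h').cyclicS_elem hA hAc, h.cyclicS_elem hA hAc, h'.cyclicS_elem hA hAc,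
    extendCochain_coboundary_sub, SE_sub (Chain.isMultilin_elem n).add]

end IsConnectionOver

end OperatorIdentities

/-! ### The periodic complex -/

section Periodic

variable {R : Type} {A : Type*} [CommRing R] [Algebra ℂ R] [TopologicalSpace R]
  [ContinuousConstSMul R R]
  [NonUnitalRing A] [Module ℂ A] [Module R A] [IsScalarTower ℂ R A] [IsScalarTower R A A]
  [SMulCommClass R A A] [TopologicalSpace A] [IsTopologicalAddGroup A] [ContinuousConstSMul R A]

theorem perD_apply_zero (c : Per R A) : perD R A c 0 = hochschildB R A 0 (c 1) := rfl

theorem perD_apply_succ (c : Per R A) (n : ℕ) : perD R A c (n + 1) =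
    hochschildB R A (n + 1) (c (n + 2)) + connesB R A n (c n) := rfl

theorem perGM_apply (der : R → R) (nabla : A → A) (c : Per R A) (n : ℕ) :
    perGM der nabla c n = lie der nabla n (c n) -
      (iota R (coboundary nabla) n (c (n + 2)) + cyclicS R (coboundary nabla) n (c n)) := rfl

variable (R) in
/-- The cyclic contraction of periodic chains with a `1`-cochain. -/
def perIOne (D : A → A) (c : Per R A) : Per R A
  | 0 => iotaOne R D 0 (c 1)
  | n + 1 => iotaOne R D (n + 1) (c (n + 2)) + cyclicSOne R D n (c n)

theorem perIOne_zero (D : A → A) : perIOne R D 0 = 0 := by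
  funext n
  cases n with
  | zero => exact map_zero _
  | succ n => simp [perIOne]

theorem perIOne_mem_parity (D : A → A) {p : ZMod 2} {c : Per R A} (hc : c ∈ parity R A p) :
    perIOne R D c ∈ parity R A (p + 1) := by
  have h2 : ∀ q : ZMod 2, q + 1 + 1 = q := by decide
  intro n hn
  have h1 : c (n + 1) = 0 := hc _ fun e => hn (by
    rw [← e]; push_cast; rw [h2])
  cases n with
  | zero => rw [perIOne, h1, map_zero]
  | succ n =>
    have h0 : c n = 0 := hc _ fun e => hn (by rw [← e]; push_cast; rfl)
    rw [perIOne, h1, h0, map_zero, map_zero, add_zero]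

theorem perGM_mem_parity (der : R → R) (nabla : A → A) {p : ZMod 2} {c : Per R A}
    (hc : c ∈ parity R A p) : perGM der nabla c ∈ parity R A p := by
  have h2 : ∀ q : ZMod 2, q + 2 = q := by decide
  intro n hn
  rw [perGM_apply, hc n hn, hc (n + 2) (by push_cast; rwa [h2]), map_zero, map_zero, map_zero,
    add_zero, sub_zero]

/-- An operator on periodic chains that commutes with `b + B` and preserves the parity induces an
operator on the periodic cyclic homology. -/
theorem exists_induces {T : Per R A →L[ℂ] Per R A} (hT : ∀ c, perD R A (T c) = T (perD R A c))
    (hp : ∀ p, ∀ c ∈ parity R A p, T c ∈ parity R A p) (p : ZMod 2) :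
    ∃ N : HP R A p →L[ℂ] HP R A p, Induces T p N := by
  have hz : ∀ z : cycles R A p, T z ∈ cycles R A p := fun z => by
    refine ⟨?_, hp p _ z.2.2⟩
    have h : perD R A z = 0 := z.2.1
    change perD R A (T z) = 0
    rw [hT, h, map_zero]
  let f : cycles R A p →ₗ[ℂ] HP R A p :=
    { toFun := fun z => Submodule.Quotient.mk ⟨T z, hz z⟩
      map_add' := fun z w => by
        rw [← Submodule.Quotient.mk_add]
        congr 1
        exact Subtype.ext (map_add T z.1 w.1)
      map_smul' := fun c z => by
        rw [RingHom.id_apply, ← Submodule.Quotient.mk_smul]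
        congr 1
        exact Subtype.ext (map_smul T c z.1) }
  let P := (boundaries R A p).submoduleOf (cycles R A p)
  -- A boundary $(b+B)w$ is mapped to $(b+B)Tw$; the relation $(b+B)^2=0$ is not needed.
  have hf : P.restrictScalars ℂ ≤ LinearMap.ker f := by
    rintro z ⟨w, hw, e⟩
    refine (Submodule.Quotient.mk_eq_zero _).2 ⟨T w, hp _ _ hw, ?_⟩
    change perD R A (T w) = T z
    rw [hT]
    exact congrArg T e
  -- The quotient is regarded as a complex one, since `T` is not assumed to be `R`-linear.
  refine ⟨⟨(P.restrictScalars ℂ).liftQ f hf ∘ₗ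
    (Submodule.Quotient.restrictScalarsEquiv ℂ P).symm.toLinearMap, ?_⟩, fun z => ⟨hz z, rfl⟩⟩
  refine (isQuotientMap_quot_mk : IsQuotientMap (Submodule.Quotient.mk : _ → HP R A p)).continuous_iff.2 ?_
  exact continuous_quot_mk.comp ((T.continuous.comp continuous_subtype_val).subtype_mk hz)

theorem Induces.leibniz {T : Per R A →L[ℂ] Per R A} {p : ZMod 2} {N : HP R A p →L[ℂ] HP R A p}
    (hN : Induces T p N) {der : R → R} (hT : ∀ (r : R) c, T (r • c) = der r • c + r • T c) (r : R)
    (m : HP R A p) : N (r • m) = der r • m + r • N m := by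
  obtain ⟨z, rfl⟩ := Submodule.Quotient.mk_surjective _ m
  obtain ⟨h1, e1⟩ := hN z
  obtain ⟨h2, e2⟩ := hN (r • z)
  rw [← Submodule.Quotient.mk_smul, e2, e1, ← Submodule.Quotient.mk_smul,
    ← Submodule.Quotient.mk_smul, ← Submodule.Quotient.mk_add]
  congr 1
  exact Subtype.ext (hT r z.1)

/-- Operators that differ by a homotopy induce the same operator on homology. -/
theorem Induces.eq_of_homotopy {T T' : Per R A →L[ℂ] Per R A} {p : ZMod 2}
    {N N' : HP R A p →L[ℂ] HP R A p} (hN : Induces T p N) (hN' : Induces T' p N')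
    {H : Per R A → Per R A} (h0 : H 0 = 0) (hp : ∀ c ∈ parity R A p, H c ∈ parity R A (p + 1))
    (hH : ∀ c, T c - T' c = perD R A (H c) + H (perD R A c)) : N = N' := by
  ext m
  obtain ⟨z, rfl⟩ := Submodule.Quotient.mk_surjective _ m
  obtain ⟨h1, e1⟩ := hN z
  obtain ⟨h2, e2⟩ := hN' z
  rw [e1, e2, Submodule.Quotient.eq]
  refine ⟨H z, hp _ z.2.2, ?_⟩
  have h : perD R A z = 0 := z.2.1
  have := hH z
  rw [h, h0, add_zero] at this
  exact this.symm

variable [ContinuousMul R] [ContinuousMul A] [ContinuousSMul R A]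
variable [T2Space A] (hA : HasSeminormNhds A)
  (hAc : @CompleteSpace A (IsTopologicalAddGroup.rightUniformSpace A))
include hA hAc

namespace IsConnectionOver

variable {der : R →+ R} {nabla nabla' : A →+ A} (h : IsConnectionOver der nabla)
include h

/-- Sorted by degree: $\iota_E$ commutes with $b$, $L_\nabla$ commutes with $B$, the products of $B$
and $S_E$ vanish, and the rest is `hochschildB_lie_succ`. In degree `0` some terms are absent,
whence the separate `hochschildB_lie_zero`. -/
theorem perD_perGM (c : Per R A) :
    perD R A (perGM der nabla c) = perGM der nabla (perD R A c) := by
  funext n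
  cases n with
  | zero =>
    have e := h.hochschildB_lie_zero hA hAc (c 1)
    simp only [perD_apply_zero, perD_apply_succ, perGM_apply, map_add, map_sub,
      h.hochschildB_iota hA hAc, h.cyclicS_zero hA hAc]
    rw [← sub_eq_zero] at e ⊢
    refine Eq.trans ?_ e
    abel
  | succ n =>
    have e := h.hochschildB_lie_succ hA hAc n (c (n + 2))
    simp only [perD_apply_succ, perGM_apply, map_add, map_sub,
      h.hochschildB_iota hA hAc, h.connesB_lie hA hAc, h.connesB_cyclicS hA hAc,
      h.cyclicS_connesB hA hAc]
    rw [← sub_eq_zero] at e ⊢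
    refine Eq.trans ?_ e
    abel

theorem perGM_smul (r : R) (c : Per R A) :
    perGM der nabla (r • c) = der r • c + r • perGM der nabla c := by
  funext n
  simp only [perGM_apply, Pi.add_apply, Pi.smul_apply, h.lie_smul hA hAc, map_smul, smul_sub,
    smul_add]
  abel

theorem perGM_sub (h' : IsConnectionOver der nabla') (c : Per R A) :
    perGM der nabla c - perGM der nabla' c =
      perD R A (perIOne R (nabla - nabla' : A →+ A) c) +
        perIOne R (nabla - nabla' : A →+ A) (perD R A c) := by
  have h0 := h.sub h'
  have e0 : ∀ n, perGM der nabla c n - perGM der nabla' c n =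
      lie 0 (nabla - nabla' : A →+ A) n (c n) -
        (iota R (coboundary (nabla - nabla' : A →+ A)) n (c (n + 2)) +
          cyclicS R (coboundary (nabla - nabla' : A →+ A)) n (c n)) := fun n => by
    rw [perGM_apply, perGM_apply, h.lie_sub hA hAc h', h.iota_sub hA hAc h',
      h.cyclicS_sub hA hAc h']
    abel
  funext n
  rw [Pi.sub_apply, e0, Pi.add_apply]
  cases n with
  | zero =>
    rw [perD_apply_zero, perIOne, perIOne, perD_apply_succ, map_add, map_add,
      h0.cyclicSOne_zero hA hAc, map_zero, h0.iotaOne_connesB_zero hA hAc, h0.cyclicS_zero hA hAc,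
      add_zero, add_zero, ← add_assoc, h0.hochschildB_iotaOne hA hAc]
    abel
  | succ n =>
    have e1 := h0.hochschildB_iotaOne hA hAc (n + 1) (c (n + 1 + 2))
    have e2 := h0.homotopy_succ hA hAc n (c (n + 1))
    -- The products of $B$ with $S_D$, in either order, vanish; only the products with $\iota_D$ and
    -- $b$ are left.
    have e3 : connesB R A n (perIOne R (nabla - nabla' : A →+ A) c n) =
        connesB R A n (iotaOne R (nabla - nabla' : A →+ A) n (c (n + 1))) := by
      cases n with
      | zero => rfl
      | succ n => rw [perIOne, map_add, h0.connesB_cyclicSOne hA hAc, add_zero]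
    have e4 : cyclicSOne R (nabla - nabla' : A →+ A) n (perD R A c n) =
        cyclicSOne R (nabla - nabla' : A →+ A) n (hochschildB R A n (c (n + 1))) := by
      cases n with
      | zero => rfl
      | succ n => rw [perD_apply_succ, map_add, h0.cyclicSOne_connesB hA hAc, add_zero]
    rw [perD_apply_succ, perIOne, perIOne, perD_apply_succ, map_add, map_add, e3, e4]
    have e5 := congrArg₂ (· + ·) e1 e2
    beta_reduce at e5
    rw [← sub_eq_zero] at e5 ⊢
    refine Eq.trans ?_ (neg_eq_zero.2 e5)
    abel

end IsConnectionOver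

end Periodic

end GaussManin

end

/-! ### The Gauss–Manin connection of a smooth deformation. -/

open GaussManin in
theorem mainTheorem3 {X : Type*} [AddCommGroup X] [Module ℂ X] [UniformSpace X]
    [IsUniformAddGroup X] [ContinuousSMul ℂ X] [PolynormableSpace ℂ X] [T2Space X]
    [CompleteSpace X] (J : TopologicalSpace.Opens ℝ) (hJ : (J : Set ℝ).OrdConnected)
    (hJ' : (J : Set ℝ).Nonempty) (𝒜 : SmoothDeformation J X) :
    -- `b` and `B` are well-defined on `C_per(A_J)`
    (∀ n, ActsBy (hochschildB (SmoothFun J ℂ) 𝒜.Sections n) (bFormula n)) ∧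
    (∀ n, ActsBy (connesB (SmoothFun J ℂ) 𝒜.Sections n) (BFormula n)) ∧
    (∀ nabla : 𝒜.Sections →L[ℂ] 𝒜.Sections, IsConnection (J := J) nabla →
      -- `L_∇` and `I_E` are well-defined on `C_per(A_J)`
      (∀ n, ActsBy (lie (SmoothFun.D (J := J) (X := ℂ)) nabla n)
        (lieFormula SmoothFun.D nabla n)) ∧
      (∀ n, ActsBy (iota (SmoothFun J ℂ) (coboundary nabla) n)
        (iotaFormula (coboundary nabla) n)) ∧
      (∀ n, ActsBy (cyclicS (SmoothFun J ℂ) (coboundary nabla) n)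
        (sFormula (coboundary nabla) n)) ∧
      -- `∇_GM` is a connection on `C_per(A_J)` and commutes with `b + B`
      IsConnection (J := J) (gaussManin nabla) ∧
      (∀ c, perD (SmoothFun J ℂ) 𝒜.Sections (gaussManin nabla c) =
        gaussManin nabla (perD (SmoothFun J ℂ) 𝒜.Sections c)) ∧
      -- it induces a connection on the even and the odd periodic cyclic homology
      (∀ p : ZMod 2, ∃ N : HP (SmoothFun J ℂ) 𝒜.Sections p →L[ℂ] HP (SmoothFun J ℂ) 𝒜.Sections p,
        Induces (gaussManin nabla) p N ∧ IsConnection (J := J) N)) ∧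
    -- the induced connection does not depend on `∇`
    (∀ nabla nabla' : 𝒜.Sections →L[ℂ] 𝒜.Sections,
      IsConnection (J := J) nabla → IsConnection (J := J) nabla' →
      ∀ (p : ZMod 2) (N N' : HP (SmoothFun J ℂ) 𝒜.Sections p →L[ℂ] HP (SmoothFun J ℂ) 𝒜.Sections p),
        Induces (gaussManin nabla) p N → Induces (gaussManin nabla') p N' → N = N') := by
  have hA : HasSeminormNhds 𝒜.Sections :=
    have : PolynormableSpace ℂ (SmoothFun J X) := SmoothFun.polynormableSpace
    hasSeminormNhds_of_polynormable (SmoothFun J X)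
  have hAc : @CompleteSpace 𝒜.Sections (IsTopologicalAddGroup.rightUniformSpace 𝒜.Sections) :=
    SmoothFun.completeSpace (X := X) hJ
  have hc : ∀ nabla : 𝒜.Sections →L[ℂ] 𝒜.Sections, IsConnection (J := J) nabla →
      IsConnectionOver (SmoothFun.D (J := J) (X := ℂ)).toAddMonoidHom
        (nabla : 𝒜.Sections →ₗ[ℂ] 𝒜.Sections).toAddMonoidHom := fun nabla h =>
    { continuous_der := SmoothFun.continuous_D
      continuous := nabla.continuous
      der_mul := SmoothFun.D_fsmul
      leibniz := h
      der_complex := fun c => (SmoothFun.D.map_smul c 1).trans (by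
        rw [show SmoothFun.D (1 : SmoothFun J ℂ) = 0 from SmoothFun.D_const 1, smul_zero]) }
  refine ⟨hochschildB_actsBy hA hAc, connesB_actsBy hA hAc, fun nabla h => ?_,
    fun nabla nabla' h h' p N N' hN hN' => ?_⟩
  · have hn := hc nabla h
    have hD : ∀ c, perD (SmoothFun J ℂ) 𝒜.Sections (gaussManin nabla c) =
        gaussManin nabla (perD (SmoothFun J ℂ) 𝒜.Sections c) := hn.perD_perGM hA hAc
    have hL : ∀ (r : SmoothFun J ℂ) c, gaussManin nabla (r • c) =
        SmoothFun.D r • c + r • gaussManin nabla c := hn.perGM_smul hA hAc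
    refine ⟨hn.lie_actsBy hA hAc, hn.iota_actsBy hA hAc, hn.cyclicS_actsBy hA hAc,
      hL, hD, fun p => ?_⟩
    obtain ⟨N, hN⟩ := exists_induces hD (fun p c => perGM_mem_parity _ _) p
    exact ⟨N, hN, hN.leibniz hL⟩
  -- The terms with $f'$ cancel in the difference of two connections, so contraction with it is a
  -- homotopy on the complex over $C^\infty(J)$.
  · let D₀ : 𝒜.Sections →+ 𝒜.Sections := (nabla : 𝒜.Sections →ₗ[ℂ] 𝒜.Sections).toAddMonoidHom -
      (nabla' : 𝒜.Sections →ₗ[ℂ] 𝒜.Sections).toAddMonoidHom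
    have hH : ∀ c, gaussManin nabla c - gaussManin nabla' c =
        perD (SmoothFun J ℂ) 𝒜.Sections (perIOne (SmoothFun J ℂ) D₀ c) +
          perIOne (SmoothFun J ℂ) D₀ (perD (SmoothFun J ℂ) 𝒜.Sections c) := fun c => by
      have e : ∀ nabla : 𝒜.Sections →L[ℂ] 𝒜.Sections, gaussManin nabla =
        perGM (SmoothFun.D (J := J) (X := ℂ)).toAddMonoidHom
          (nabla : 𝒜.Sections →ₗ[ℂ] 𝒜.Sections).toAddMonoidHom := fun _ => rfl
      rw [e, e]
      exact (hc nabla h).perGM_sub hA hAc (hc nabla' h') c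
    exact hN.eq_of_homotopy hN' (perIOne_zero D₀) (fun c => perIOne_mem_parity D₀) hH
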